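/- \textbf{Graphs.} All graphs are finite; loops and multiple edges are possible unless excluded. A \emph{BCR graph} is a connected graph whose vertices are external or internal and whose edges are solid or dashed, such that: there is at least one external vertex; each internal vertex has exactly three dashed half-edges and no solid one; each external vertex has exactly one dashed half-edge and at most two solid ones; the solid edges form a disjoint union of broken lines (no solid loops, double solid edges or solid cycles). A \emph{BCR chord diagram} is a BCR graph without internal vertices. \textbf{Colours.} There are two cases. In the odd case, a colour is a labelling of the vertices by $1,\dots,n$ together with an orientation of each edge. In the even case, a colour is a numbering of the edges by $1,\dots,m$. Two colours of isomorphic graphs have the same or opposite orientation according to the sign of the change of colour. In the odd case this is the sign of the permutation of the vertex labels times $-1$ for every reversed edge; in the even case it is the sign of the permutation of the edge numbers. Fix one of the two cases. Let $\mathcal D$ and $\mathcal D^c$ be the $\mathbb Q$-vector spaces generated by the coloured BCR graphs and the coloured BCR chord diagrams, and let $\iota:\mathcal D^c\to\mathcal D$ be the inclusion. \textbf{Relations.} \emph{Orientation relations:} isomorphic coloured graphs with the same (opposite) orientation are equal (opposite). In each of the following relations the graphs have the same vertices and edges and differ only at one edge $e$, and they are coloured in the same way, so that contracting $e$ gives the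 same coloured graph for every term. \begin{itemize} \item \emph{IHX:} $D_1+D_2+D_3=0$, where $e$ is a dashed edge between two distinct internal vertices and the other four half-edges $a,b,c,d$ at these vertices are distributed to them as $ab|cd$, $ac|bd$, $ad|bc$. \item \emph{STU:} let $e$ be a dashed edge of $S$ from an external vertex $v$ to an internal vertex $w$, and let $a,b$ be the other half-edges of $w$. (I) If $v$ has one or two solid edges, then $S+T+U=0$, where in $T$ and $U$ the vertex $w$ becomes external and the edge $e$ becomes solid and is inserted into the broken line in place of $v$, one of $a,b$ being attached to each of its two ends, in the two possible orders. (II) If $v$ has no solid edge, then $S+T=0$, where in $T$ the edge $e$ is a solid broken line of its own, with $a$ and $b$ attached to its two ends. \item \emph{4T} (for chord diagrams): $y-z=0$ whenever $y,z\in\mathcal D^c$ and $S+y=0$, $S+z=0$ are STU relations for the same coloured BCR graph $S$. \item \emph{Chord relations:} let $e$ be a dashed edge between external vertices $v,u$. The sum of the graphs obtained by distributing in all possible ways the solid half-edges of $v$ and $u$ to $v$ and $u$, at most two to each, is $0$; here distributions that differ by exchanging $v$ and $u$ are counted once. The relation is imposed only if all these graphs are BCR graphs (equivalently, if the contracted graph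 has no loop of solid edges). \end{itemize} \textbf{Spaces.} Let $\mathcal A_{BCR}$ be the quotient of $\mathcal D$ by the orientation, IHX and STU relations, and $\overline{\mathcal A}_{BCR}$ its quotient by the chord relations. Let $\mathcal A^c_{BCR}$ be the quotient of $\mathcal D^c$ by the orientation and 4T relations, and $\overline{\mathcal A}^c_{BCR}$ its quotient by the chord relations all of whose graphs are chord diagrams. \textbf{Theorem.} In the odd case and in the even case, the inclusion $\iota$ induces linear maps $\iota_*:\mathcal A^c_{BCR}\to\mathcal A_{BCR}$ and $\overline\iota_*:\overline{\mathcal A}^c_{BCR}\to\overline{\mathcal A}_{BCR}$, and both of these maps are isomorphisms. -/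

import Mathlib

namespace BCR

/-- A finite graph with two types of edges (solid / dashed) and two types of vertices
(external / internal), presented on the vertex set `Fin nV` and the edge set `Fin nE`; edge `e`
points from `ends (e, false)` to `ends (e, true)`.  Loops and multiple edges are possible.
So the vertices are labelled, and the edges are both oriented and numbered; which of these data
count as the colour depends on the `Parity`, the others are mere names. -/
structure ColoredGraph where
  /-- the number of vertices -/
  nV : ℕ
  /-- the number of edges -/
  nE : ℕ
  /-- the vertex at which a half-edge sits -/
  ends : Fin nE × Bool → Fin nV
  /-- is the edge solid (otherwise it is dashed) -/
  solid : Fin nE → Bool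
  /-- is the vertex external (otherwise it is internal) -/
  external : Fin nV → Bool

namespace ColoredGraph

/-- The half-edges of a graph; a loop has two of them. -/
abbrev HalfEdge (G : ColoredGraph) : Type := Fin G.nE × Bool

/-- The half-edges at a vertex. -/
def halfEdges (G : ColoredGraph) (v : Fin G.nV) : Finset G.HalfEdge :=
  Finset.univ.filter fun h => G.ends h = v

/-- The solid half-edges at a vertex. -/
def solidHalfEdges (G : ColoredGraph) (v : Fin G.nV) : Finset G.HalfEdge :=
  (G.halfEdges v).filter fun h => G.solid h.1 = true

/-- The dashed half-edges at a vertex. -/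
def dashedHalfEdges (G : ColoredGraph) (v : Fin G.nV) : Finset G.HalfEdge :=
  (G.halfEdges v).filter fun h => G.solid h.1 = false

/-- Adjacency through an arbitrary edge. -/
def underlying (G : ColoredGraph) : SimpleGraph (Fin G.nV) :=
  SimpleGraph.fromRel fun x y => ∃ e, G.ends (e, false) = x ∧ G.ends (e, true) = y

/-- Adjacency through a solid edge. -/
def solidUnderlying (G : ColoredGraph) : SimpleGraph (Fin G.nV) :=
  SimpleGraph.fromRel fun x y =>
    ∃ e, G.solid e = true ∧ G.ends (e, false) = x ∧ G.ends (e, true) = y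

/-- The conditions on a BCR graph. The last three clauses say that the solid edges form a forest
(as a multigraph); with at most two solid edges at every vertex, this is a disjoint union of
broken lines. -/
structure IsBCR (G : ColoredGraph) : Prop where
  connected : G.underlying.Connected
  exists_external : ∃ v, G.external v = true
  internal_dashed : ∀ v, G.external v = false → (G.dashedHalfEdges v).card = 3
  internal_solid : ∀ v, G.external v = false → (G.solidHalfEdges v).card = 0
  external_dashed : ∀ v, G.external v = true → (G.dashedHalfEdges v).card = 1
  external_solid : ∀ v, G.external v = true → (G.solidHalfEdges v).card ≤ 2
  no_solid_loop : ∀ e, G.solid e = true → G.ends (e, false) ≠ G.ends (e, true)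
  no_double_solid_edge : ∀ e e', G.solid e = true → G.solid e' = true →
    s(G.ends (e, false), G.ends (e, true)) = s(G.ends (e', false), G.ends (e', true)) → e = e'
  no_solid_cycle : G.solidUnderlying.IsAcyclic

/-- The same underlying graph with another colour: vertex `v` is renamed `σ v`, edge `e` is
renamed `τ e`, and the direction of edge `e` is reversed if `ε e` holds. -/
def relabel (G : ColoredGraph) (σ : Equiv.Perm (Fin G.nV)) (τ : Equiv.Perm (Fin G.nE))
    (ε : Fin G.nE → Bool) : ColoredGraph where
  nV := G.nV
  nE := G.nE
  ends h := σ (G.ends (τ.symm h.1, xor h.2 (ε (τ.symm h.1))))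
  solid e := G.solid (τ.symm e)
  external v := G.external (σ.symm v)

/-- The same vertices and edges, with the half-edges attached according to `f`. -/
def reattach (G : ColoredGraph) (f : G.HalfEdge → Fin G.nV) : ColoredGraph where
  nV := G.nV
  nE := G.nE
  ends := f
  solid := G.solid
  external := G.external

/-- The graph which replaces `G` in an STU relation at a dashed edge `e` from the external vertex
`v` to the internal vertex `w`: the edge `e` becomes solid, `w` becomes external, the dashed
half-edge `a` of `w` is moved to `v`, and the solid half-edges in `R` are moved from `v` to `w`.
Vertex labels, edge numbers and edge directions do not change. -/
def resolve (G : ColoredGraph) (e : Fin G.nE) (v w : Fin G.nV) (a : G.HalfEdge)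
    (R : Finset G.HalfEdge) : ColoredGraph where
  nV := G.nV
  nE := G.nE
  ends h := if h = a then v else if h ∈ R then w else G.ends h
  solid := Function.update G.solid e true
  external := Function.update G.external w true

end ColoredGraph

/-- Coloured BCR graphs. -/
abbrev Graph : Type := {G : ColoredGraph // G.IsBCR}

/-- Coloured BCR chord diagrams: no internal vertices. -/
abbrev ChordDiagram : Type := {G : Graph // ∀ v, G.1.external v = true}

/-- The two kinds of colours: in the odd case vertices are labelled and edges are oriented, in the
even case edges are numbered. -/
inductive Parity where
  | odd
  | even

/-- The sign by which a change of colour changes the orientation. In the odd case these are the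
sign of the permutation of the vertex labels and a factor `-1` for every reversed edge; in the
even case it is the sign of the permutation of the edge numbers. -/
def colorSign {n m : ℕ} (p : Parity) (σ : Equiv.Perm (Fin n)) (τ : Equiv.Perm (Fin m))
    (ε : Fin m → Bool) : ℤˣ :=
  match p with
  | Parity.odd => Equiv.Perm.sign σ * ∏ e, (if ε e = true then (-1 : ℤˣ) else 1)
  | Parity.even => Equiv.Perm.sign τ

/-- The rational vector space on the coloured BCR graphs. -/
abbrev D : Type := Graph →₀ ℚ

/-- The rational vector space on the coloured BCR chord diagrams. -/
abbrev Dc : Type := ChordDiagram →₀ ℚ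

/-- The basis vector of a coloured BCR graph. -/
noncomputable def cls (G : Graph) : D := Finsupp.single G 1

/-- The basis vector of a coloured BCR chord diagram. -/
noncomputable def clsc (G : ChordDiagram) : Dc := Finsupp.single G 1

/-- The inclusion of chord diagrams into BCR graphs, linearly extended. -/
noncomputable def iota : Dc →ₗ[ℚ] D := Finsupp.lmapDomain ℚ ℚ (fun G : ChordDiagram => G.1)

/-- Orientation relations: isomorphic graphs whose colours have the same (opposite) orientation
are equal (opposite). -/
def orientationRel (p : Parity) : Set D :=
  {x | ∃ (G H : Graph) (σ : Equiv.Perm (Fin G.1.nV)) (τ : Equiv.Perm (Fin G.1.nE))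
      (ε : Fin G.1.nE → Bool), H.1 = G.1.relabel σ τ ε ∧
      x = cls H - ((colorSign p σ τ ε : ℤ) : ℚ) • cls G}

/-- Orientation relations of chord diagrams. -/
def orientationRelc (p : Parity) : Set Dc :=
  {x | ∃ (G H : ChordDiagram) (σ : Equiv.Perm (Fin G.1.1.nV)) (τ : Equiv.Perm (Fin G.1.1.nE))
      (ε : Fin G.1.1.nE → Bool), H.1.1 = G.1.1.relabel σ τ ε ∧
      x = clsc H - ((colorSign p σ τ ε : ℤ) : ℚ) • clsc G}

/-- IHX relations `D₁ + D₂ + D₃ = 0`: the dashed edge `e` joins two internal vertices, whose other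
half-edges are `a, b` and `c, d`. The three graphs distribute `a, b, c, d` to the ends of `e` as
`ab|cd`, `ac|bd`, `ad|bc`; all colours are kept, so contracting `e` gives the same coloured graph
three times. -/
def ihxRel : Set D :=
  {x | ∃ (D₁ D₂ D₃ : Graph) (e : Fin D₁.1.nE) (a b c d : D₁.1.HalfEdge),
      D₁.1.solid e = false ∧
      D₁.1.ends (e, false) ≠ D₁.1.ends (e, true) ∧
      D₁.1.external (D₁.1.ends (e, false)) = false ∧
      D₁.1.external (D₁.1.ends (e, true)) = false ∧
      D₁.1.halfEdges (D₁.1.ends (e, false)) = {(e, false), a, b} ∧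
      D₁.1.halfEdges (D₁.1.ends (e, true)) = {(e, true), c, d} ∧
      D₂.1 = D₁.1.reattach (D₁.1.ends ∘ Equiv.swap b c) ∧
      D₃.1 = D₁.1.reattach (D₁.1.ends ∘ Equiv.swap b d) ∧
      x = cls D₁ + cls D₂ + cls D₃}

/-- `IsSTU S y` says that `S + y = 0` is an STU relation: `e` is a dashed edge of `S` from an
external vertex `v` to an internal vertex `w`, whose other half-edges are `a` and `b`.
* Type (I), `v` has one or two solid edges: `y = T + U`, where `T` and `U` arise by making `e` solid
  and inserting its two ends into the broken line of `v` with `a, b` attached in the two possible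
  orders. One solid half-edge `l` remains at `v`, the other one (if there is one) goes to `w`.
* Type (II), `v` has no solid edge: `y = T`, where `T` has the solid edge `e` as a broken line
  of its own, with `a` and `b` at its two ends.
All colours are kept, so contracting `e` gives the same coloured graph in all terms. -/
def IsSTU (S : Graph) (y : D) : Prop :=
  ∃ (e : Fin S.1.nE) (s : Bool) (v w : Fin S.1.nV) (a b : S.1.HalfEdge),
    S.1.solid e = false ∧
    S.1.ends (e, s) = v ∧ S.1.external v = true ∧
    S.1.ends (e, !s) = w ∧ S.1.external w = false ∧
    S.1.halfEdges w = {(e, !s), a, b} ∧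
    ((∃ l ∈ S.1.solidHalfEdges v, ∃ T U : Graph,
        T.1 = S.1.resolve e v w a ((S.1.solidHalfEdges v).erase l) ∧
        U.1 = S.1.resolve e v w b ((S.1.solidHalfEdges v).erase l) ∧
        y = cls T + cls U) ∨
     (S.1.solidHalfEdges v = ∅ ∧ ∃ T : Graph, T.1 = S.1.resolve e v w a ∅ ∧ y = cls T))

/-- STU relations. -/
def stuRel : Set D := {x | ∃ (S : Graph) (y : D), IsSTU S y ∧ x = cls S + y}

/-- 4T relations of chord diagrams: the difference of two expressions by chord diagrams
of the same BCR graph `S`, both given by STU relations. -/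
def fourTRel : Set Dc :=
  {x | ∃ (S : Graph) (y z : Dc), IsSTU S (iota y) ∧ IsSTU S (iota z) ∧ x = y - z}

/-- The distributions of a set `H` of solid half-edges to two vertices, at most two to each of
them, up to exchange of the two vertices. A distribution is given by the set `A` of the half-edges
that go to the same vertex as the chosen half-edge `h₀`. -/
def distributions {α : Type} [DecidableEq α] (H : Finset α) (h₀ : α) : Finset (Finset α) :=
  H.powerset.filter fun A => h₀ ∈ A ∧ A.card ≤ 2 ∧ (H \ A).card ≤ 2

/-- Chord relations: `e` is a chord of `C` (a dashed edge between external vertices `v` and `u`),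
and the sum of all graphs obtained by distributing in all possible ways the solid half-edges
`H` of `v` and `u` to `v` and `u`, at most two to each, is zero. All these graphs have
to be BCR graphs. (For `H = ∅` there is only `C` itself.) All colours are kept, so contracting `e`
gives the same coloured graph in all terms. -/
def chordRel : Set D :=
  {x | ∃ (C : Graph) (e : Fin C.1.nE) (v u : Fin C.1.nV) (H : Finset C.1.HalfEdge),
      C.1.solid e = false ∧
      C.1.ends (e, false) = v ∧ C.1.external v = true ∧
      C.1.ends (e, true) = u ∧ C.1.external u = true ∧
      H = C.1.solidHalfEdges v ∪ C.1.solidHalfEdges u ∧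
      ((H = ∅ ∧ x = cls C) ∨
       (∃ h₀ ∈ H, ∃ F : Finset C.1.HalfEdge → Graph,
          (∀ A ∈ distributions H h₀, (F A).1 =
            C.1.reattach fun h => if h ∈ A then v else if h ∈ H then u else C.1.ends h) ∧
          x = ∑ A ∈ distributions H h₀, cls (F A)))}

/-- Chord relations all of whose graphs are chord diagrams. -/
def chordRelc : Set Dc := {y | iota y ∈ chordRel}

/-- All relations of BCR graphs: orientation, IHX and STU. -/
noncomputable def relations (p : Parity) : Submodule ℚ D :=
  Submodule.span ℚ (orientationRel p ∪ ihxRel ∪ stuRel)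

/-- All relations of BCR graphs, with the chord relations. -/
noncomputable def relationsBar (p : Parity) : Submodule ℚ D :=
  Submodule.span ℚ (orientationRel p ∪ ihxRel ∪ stuRel ∪ chordRel)

/-- All relations of BCR chord diagrams: orientation and 4T. -/
noncomputable def relationsc (p : Parity) : Submodule ℚ Dc :=
  Submodule.span ℚ (orientationRelc p ∪ fourTRel)

/-- All relations of BCR chord diagrams, with the chord relations. -/
noncomputable def relationscBar (p : Parity) : Submodule ℚ Dc :=
  Submodule.span ℚ (orientationRelc p ∪ fourTRel ∪ chordRelc)

/-- The space of BCR graphs. -/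
abbrev A (p : Parity) : Type := D ⧸ relations p

/-- The space of BCR graphs modulo chord relations. -/
abbrev ABar (p : Parity) : Type := D ⧸ relationsBar p

/-- The space of BCR chord diagrams. -/
abbrev Ac (p : Parity) : Type := Dc ⧸ relationsc p

/-- The space of BCR chord diagrams modulo chord relations. -/
abbrev AcBar (p : Parity) : Type := Dc ⧸ relationscBar p

end BCR

/-!
An STU relation expresses a graph through graphs with one internal vertex less. Every BCR graph with
an internal vertex is connected to an external one, so it has a *leg*, a dashed edge from an
internal to an external vertex, where an STU relation applies. Hence chord diagrams span the
quotient by the STU relations (`BCR.Net.range_iota_sup`), which gives surjectivity.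

For injectivity, the projection from chord diagrams to their quotient is extended to all graphs:
`BCR.Net.extend` resolves the internal vertices one by one, at arbitrarily chosen legs. The
extension respects the orientation, STU and IHX relations (`BCR.Net.extend_spec`), so it induces
a left inverse of `ι_*`. This is proved for all three kinds of relations at once, by induction on
the number of internal vertices. The main points are as follows.

* *The value does not depend on the leg* (`BCR.Net.total_eq_total`); this gives the STU relations.
  Resolutions at different internal vertices commute (`BCR.Net.total_eq_of_ne`). If there is only
  one internal vertex, the claim is the 4T relation. There remains the case in which all legs are
  at one of several internal vertices. If there are two of them, the third edge at this vertex leads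
  to the rest of the graph, and both values vanish (`BCR.Net.Stuck.total_eq_zero`): the vertex, with
  its two legs, can be detached and inserted next to any half-edge of the rest. The sum over all
  these insertions vanishes by the IHX relations at the vertices of the rest, and the insertions at
  the two ends of an edge cancel, so that only the original graph remains.
* *The IHX relations* (`BCR.Net.ihxSum_edgeTotal`): the three graphs are resolved at a common leg.
  If the leg is away from the edge of the IHX relation, an IHX relation with fewer internal vertices
  results. Otherwise the edge itself can be resolved next. This leads to twelve graphs, in
  which the three remaining half-edges are attached to three consecutive vertices of a broken line;
  each of the six orders occurs twice, with opposite orientations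
  (`BCR.Net.chain'_eq_relabel`).

STU relations with and without solid edges at the external vertex are treated together: in the
second case the two ways to attach the half-edges are isomorphic with the same orientation, and the
single graph is replaced by the mean of the two (`BCR.Net.Leg.weight`).

Finally, the resolution of an internal vertex does not touch a chord or the solid edges at its ends.
So a chord relation turns into a sum of chord relations of chord diagrams
(`BCR.Net.sum_distribute_eq_zero`), and the left inverse descends to the quotients by the chord
relations.
-/

namespace BCR

/-! ### Graphs with given numbers of vertices and edges -/

/-- A coloured graph with vertex set `Fin n` and edge set `Fin m`; the numbers of vertices and edges
are parameters, since no relation changes them. -/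
@[ext] structure Net (n m : ℕ) where
  /-- the vertex at which a half-edge sits -/
  ends : Fin m × Bool → Fin n
  /-- is the edge solid -/
  solid : Fin m → Bool
  /-- is the vertex external -/
  external : Fin n → Bool

namespace Net

variable {n m : ℕ}

/-- The other half of the same edge. -/
def opp (h : Fin m × Bool) : Fin m × Bool := (h.1, !h.2)

@[simp] lemma opp_fst (h : Fin m × Bool) : (opp h).1 = h.1 := rfl

@[simp] lemma opp_opp (h : Fin m × Bool) : opp (opp h) = h := by simp [opp]

lemma opp_ne (h : Fin m × Bool) : opp h ≠ h := by
  rcases h with ⟨e, _ | _⟩ <;> simp [opp]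

lemma eq_or_eq_opp {h k : Fin m × Bool} (e : h.1 = k.1) : h = k ∨ h = opp k := by
  rcases h with ⟨h, _ | _⟩ <;> rcases k with ⟨k, _ | _⟩ <;> simp_all [opp]

/-- Forgetting that the numbers of vertices and edges are parameters. -/
abbrev toGraph (G : Net n m) : ColoredGraph := ⟨n, m, G.ends, G.solid, G.external⟩

/-- Being a BCR graph. -/
abbrev IsBCR (G : Net n m) : Prop := G.toGraph.IsBCR

/-- The solid half-edges at a vertex. -/
def solids (G : Net n m) (v : Fin n) : Finset (Fin m × Bool) :=
  Finset.univ.filter fun h => G.ends h = v ∧ G.solid h.1 = true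

@[simp] lemma mem_solids {G : Net n m} {v : Fin n} {h : Fin m × Bool} :
    h ∈ G.solids v ↔ G.ends h = v ∧ G.solid h.1 = true := by
  simp [solids]

lemma toGraph_solidHalfEdges (G : Net n m) (v : Fin n) :
    G.toGraph.solidHalfEdges v = G.solids v := by
  ext h
  simp [ColoredGraph.solidHalfEdges, ColoredGraph.halfEdges, toGraph]

/-- The dashed half-edges at a vertex. -/
def dasheds (G : Net n m) (v : Fin n) : Finset (Fin m × Bool) :=
  Finset.univ.filter fun h => G.ends h = v ∧ G.solid h.1 = false

@[simp] lemma mem_dasheds {G : Net n m} {v : Fin n} {h : Fin m × Bool} :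
    h ∈ G.dasheds v ↔ G.ends h = v ∧ G.solid h.1 = false := by
  simp [dasheds]

lemma toGraph_dashedHalfEdges (G : Net n m) (v : Fin n) :
    G.toGraph.dashedHalfEdges v = G.dasheds v := by
  ext h
  simp [ColoredGraph.dashedHalfEdges, ColoredGraph.halfEdges, toGraph]

/-- The number of internal vertices. -/
def internals (G : Net n m) : ℕ := (Finset.univ.filter fun v => G.external v = false).card

/-- Reachability along arbitrary edges. -/
abbrev Joined (G : Net n m) (x y : Fin n) : Prop := G.toGraph.underlying.Reachable x y

lemma joined_opp (G : Net n m) (h : Fin m × Bool) : G.Joined (G.ends h) (G.ends (opp h)) := by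
  by_cases e : G.ends h = G.ends (opp h)
  · rw [e]
  · apply SimpleGraph.Adj.reachable
    change (SimpleGraph.fromRel _).Adj _ _
    rw [SimpleGraph.fromRel_adj]
    refine ⟨e, ?_⟩
    rcases h with ⟨h, _ | _⟩
    · exact Or.inl ⟨h, rfl, rfl⟩
    · exact Or.inr ⟨h, rfl, rfl⟩

lemma exists_of_adj {G : Net n m} {x y : Fin n} (h : G.toGraph.underlying.Adj x y) :
    ∃ k, G.ends k = x ∧ G.ends (opp k) = y := by
  change (SimpleGraph.fromRel _).Adj _ _ at h
  rw [SimpleGraph.fromRel_adj] at h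
  rcases h with ⟨-, ⟨e, h1, h2⟩ | ⟨e, h1, h2⟩⟩
  · exact ⟨(e, false), h1, h2⟩
  · exact ⟨(e, true), h2, h1⟩

lemma _root_.SimpleGraph.Reachable.exists_adj_boundary {V : Type*} {Γ : SimpleGraph V} {x y : V}
    (h : Γ.Reachable x y) {X : Set V} (hx : x ∈ X) (hy : y ∉ X) :
    ∃ p q, p ∈ X ∧ q ∉ X ∧ Γ.Adj p q := by
  obtain ⟨w⟩ := h
  obtain ⟨d, -, h1, h2⟩ := w.exists_boundary_dart X hx hy
  exact ⟨_, _, h1, h2, d.adj⟩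

/-- In a connected graph some edge leaves a given proper nonempty set of vertices. -/
lemma exists_crossing {G : Net n m} (hG : G.toGraph.underlying.Connected) {X : Set (Fin n)}
    {x y : Fin n} (hx : x ∈ X) (hy : y ∉ X) : ∃ k, G.ends k ∈ X ∧ G.ends (opp k) ∉ X := by
  obtain ⟨p, q, hp, hq, h⟩ := (hG.preconnected x y).exists_adj_boundary hx hy
  obtain ⟨k, rfl, rfl⟩ := exists_of_adj h
  exact ⟨k, hp, hq⟩

lemma connected_of_joined {G G' : Net n m} (hG : G.toGraph.underlying.Connected)
    (h : ∀ k, G'.Joined (G.ends k) (G.ends (opp k))) : G'.toGraph.underlying.Connected := by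
  have : Nonempty (Fin n) := hG.nonempty
  refine @SimpleGraph.Connected.mk _ _ (fun x y => ?_) this
  by_contra hxy
  obtain ⟨k, h1, h2⟩ := exists_crossing hG (X := {z | G'.Joined x z})
    (SimpleGraph.Reachable.refl x) hxy
  exact h2 (SimpleGraph.Reachable.trans h1 (h k))

/-- Moving half-edges to joined vertices does not disconnect a graph. -/
lemma connected_of_joined_ends {G G' : Net n m} (hG : G.toGraph.underlying.Connected)
    (h : ∀ k, G'.Joined (G.ends k) (G'.ends k)) : G'.toGraph.underlying.Connected :=
  connected_of_joined hG fun k =>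
    ((h k).trans (G'.joined_opp k)).trans (h (opp k)).symm

namespace IsBCR

variable {G : Net n m}

lemma solid_eq_false (hG : G.IsBCR) {h : Fin m × Bool} (hh : G.external (G.ends h) = false) :
    G.solid h.1 = false := by
  have := hG.internal_solid _ hh
  rw [toGraph_solidHalfEdges, Finset.card_eq_zero] at this
  by_contra hs
  have : h ∈ G.solids (G.ends h) := by simpa using hs
  simp_all

lemma eq_of_dashed (hG : G.IsBCR) {h k : Fin m × Bool} (he : G.ends h = G.ends k)
    (hx : G.external (G.ends k) = true) (hh : G.solid h.1 = false) (hk : G.solid k.1 = false) :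
    h = k := by
  have := hG.external_dashed _ hx
  rw [toGraph_dashedHalfEdges] at this
  exact Finset.card_le_one.1 this.le h (by simp [he, hh]) k (by simp [hk])

lemma card_solids_le (hG : G.IsBCR) (v : Fin n) : (G.solids v).card ≤ 2 := by
  rw [← toGraph_solidHalfEdges]
  rcases h : G.external v with _ | _
  · rw [hG.internal_solid v h]; omega
  · exact hG.external_solid v h

lemma ends_opp_ne (hG : G.IsBCR) {h : Fin m × Bool} (hh : G.solid h.1 = true) :
    G.ends (opp h) ≠ G.ends h := by
  have := hG.no_solid_loop h.1 hh
  rcases h with ⟨h, _ | _⟩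
  · exact this.symm
  · exact this

lemma exists_halfEdges (hG : G.IsBCR) {k : Fin m × Bool} (hk : G.external (G.ends k) = false) :
    ∃ a b, k ≠ a ∧ k ≠ b ∧ a ≠ b ∧ ∀ h, G.ends h = G.ends k ↔ h = k ∨ h = a ∨ h = b := by
  have h3 := hG.internal_dashed _ hk
  rw [toGraph_dashedHalfEdges] at h3
  have hmem : ∀ h, h ∈ G.dasheds (G.ends k) ↔ G.ends h = G.ends k := fun h => by
    simp only [mem_dasheds, and_iff_left_iff_imp]
    intro e
    exact hG.solid_eq_false (e ▸ hk)
  have hkm := (hmem k).2 rfl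
  have h2 : ((G.dasheds (G.ends k)).erase k).card = 2 := by
    rw [Finset.card_erase_of_mem hkm, h3]
  obtain ⟨a, b, hab, e⟩ := Finset.card_eq_two.1 h2
  have ha : a ∈ (G.dasheds (G.ends k)).erase k := by simp [e]
  have hb : b ∈ (G.dasheds (G.ends k)).erase k := by simp [e]
  refine ⟨a, b, (Finset.ne_of_mem_erase ha).symm, (Finset.ne_of_mem_erase hb).symm, hab,
    fun h => ?_⟩
  rw [← hmem, ← Finset.insert_erase hkm, e]
  simp

end IsBCR

/-! ### Operations on coloured graphs -/

/-- The effect of an STU relation at the half-edge `k` of an internal vertex, see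
`ColoredGraph.resolve`. -/
def resolve (G : Net n m) (k a : Fin m × Bool) (R : Finset (Fin m × Bool)) : Net n m where
  ends h := if h = a then G.ends (opp k) else if h ∈ R then G.ends k else G.ends h
  solid := Function.update G.solid k.1 true
  external := Function.update G.external (G.ends k) true

/-- The half-edges are permuted by `π`. -/
def permute (G : Net n m) (π : Equiv.Perm (Fin m × Bool)) : Net n m where
  ends := G.ends ∘ π
  solid := G.solid
  external := G.external

/-- A change of colour, see `ColoredGraph.relabel`. -/
def relabel (G : Net n m) (σ : Equiv.Perm (Fin n)) (τ : Equiv.Perm (Fin m)) (ε : Fin m → Bool) :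
    Net n m where
  ends h := σ (G.ends (τ.symm h.1, xor h.2 (ε (τ.symm h.1))))
  solid e := G.solid (τ.symm e)
  external v := G.external (σ.symm v)

section Resolve

variable (G : Net n m) (k a : Fin m × Bool) (R : Finset (Fin m × Bool))

lemma resolve_ends (h : Fin m × Bool) : (G.resolve k a R).ends h =
    if h = a then G.ends (opp k) else if h ∈ R then G.ends k else G.ends h := rfl

lemma resolve_solid (e : Fin m) :
    (G.resolve k a R).solid e = if e = k.1 then true else G.solid e := by
  simp [resolve, Function.update_apply]

lemma resolve_external (v : Fin n) :
    (G.resolve k a R).external v = if v = G.ends k then true else G.external v := by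
  simp [resolve, Function.update_apply]

@[simp] lemma permute_ends (π : Equiv.Perm (Fin m × Bool)) (h : Fin m × Bool) :
    (G.permute π).ends h = G.ends (π h) := rfl

@[simp] lemma permute_solid (π : Equiv.Perm (Fin m × Bool)) : (G.permute π).solid = G.solid := rfl

@[simp] lemma permute_external (π : Equiv.Perm (Fin m × Bool)) :
    (G.permute π).external = G.external := rfl

end Resolve

lemma IsBCR.permute {G : Net n m} (hG : G.IsBCR) {π : Equiv.Perm (Fin m × Bool)}
    (hπ : ∀ h, G.solid h.1 = true → π h = h)
    (hc : (G.permute π).toGraph.underlying.Connected) : (G.permute π).IsBCR := by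
  have hπ' : ∀ h, G.solid (π h).1 = G.solid h.1 := fun h => by
    rcases e : G.solid h.1 with _ | _
    · rcases e' : G.solid (π h).1 with _ | _
      · rfl
      · rw [π.injective (hπ _ e'), e] at e'
        cases e'
    · rw [hπ h e, e]
  have hs : ∀ v, (G.permute π).solids v = G.solids v := fun v => by
    ext h
    simp only [mem_solids, permute_ends, permute_solid]
    constructor <;> rintro ⟨h1, h2⟩
    · exact ⟨by rwa [hπ h h2] at h1, h2⟩
    · exact ⟨by rwa [hπ h h2], h2⟩
  have hd : ∀ v, ((G.permute π).dasheds v).card = (G.dasheds v).card := fun v => by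
    apply Finset.card_bijective π π.bijective
    simp [hπ']
  have he : ∀ e b, G.solid e = true → (G.permute π).ends (e, b) = G.ends (e, b) :=
    fun e b h => by rw [permute_ends, hπ (e, b) h]
  refine ⟨hc, hG.exists_external, fun v hv => ?_, fun v hv => ?_, fun v hv => ?_, fun v hv => ?_,
    fun e h => ?_, fun e e' h h' hee => ?_, ?_⟩
  · have := hG.internal_dashed v hv
    rw [toGraph_dashedHalfEdges] at this ⊢
    rw [hd, this]
  · have := hG.internal_solid v hv
    rw [toGraph_solidHalfEdges] at this ⊢
    rw [hs, this]
  · have := hG.external_dashed v hv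
    rw [toGraph_dashedHalfEdges] at this ⊢
    rw [hd, this]
  · have := hG.external_solid v hv
    rw [toGraph_solidHalfEdges] at this ⊢
    rw [hs]
    exact this
  · change (G.permute π).ends _ ≠ (G.permute π).ends _
    rw [he _ _ h, he _ _ h]
    exact hG.no_solid_loop e h
  · change s((G.permute π).ends _, (G.permute π).ends _) =
      s((G.permute π).ends _, (G.permute π).ends _) at hee
    rw [he _ _ h, he _ _ h, he _ _ h', he _ _ h'] at hee
    exact hG.no_double_solid_edge e e' h h' hee
  · have : (G.permute π).toGraph.solidUnderlying = G.toGraph.solidUnderlying := by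
      unfold ColoredGraph.solidUnderlying
      congr 1
      ext x y
      constructor
      · rintro ⟨e, h, h1, h2⟩
        exact ⟨e, h, (he e _ h).symm.trans h1, (he e _ h).symm.trans h2⟩
      · rintro ⟨e, h, h1, h2⟩
        exact ⟨e, h, (he e _ h).trans h1, (he e _ h).trans h2⟩
    rw [this]
    exact hG.no_solid_cycle

/-! ### Legs -/

/-- A leg of `G` is a half-edge `k` at an internal vertex, with other half-edges `a` and `b`, whose
opposite half-edge sits at an external vertex; these are the places where STU relations apply. Part
of the datum is the set `R` of the solid half-edges at the external vertex that an STU relation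
moves to the new external vertex: all of them but one, or none if there are none. -/
structure Leg (G : Net n m) where
  /-- the half-edge at the internal vertex -/
  k : Fin m × Bool
  /-- the second half-edge at the internal vertex -/
  a : Fin m × Bool
  /-- the third half-edge at the internal vertex -/
  b : Fin m × Bool
  /-- the solid half-edges to be moved -/
  R : Finset (Fin m × Bool)
  external_opp : G.external (G.ends (opp k)) = true
  internal : G.external (G.ends k) = false
  ne_a : k ≠ a
  ne_b : k ≠ b
  a_ne_b : a ≠ b
  ends_iff : ∀ h, G.ends h = G.ends k ↔ h = k ∨ h = a ∨ h = b
  subset : R ⊆ G.solids (G.ends (opp k))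
  card : R.card = (G.solids (G.ends (opp k))).card - 1

namespace Leg

variable {G : Net n m} (L : Leg G)

/-- The external vertex of a leg. -/
abbrev v : Fin n := G.ends (opp L.k)

/-- The internal vertex of a leg. -/
abbrev w : Fin n := G.ends L.k

/-- The graph of the STU relation with `a` at the old external vertex. -/
abbrev fst : Net n m := G.resolve L.k L.a L.R

/-- The graph of the STU relation with `b` at the old external vertex. -/
abbrev snd : Net n m := G.resolve L.k L.b L.R

/-- Exchange of the half-edges `a` and `b`. -/
@[simps] def flip : Leg G where
  k := L.k
  a := L.b
  b := L.a
  R := L.R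
  external_opp := L.external_opp
  internal := L.internal
  ne_a := L.ne_b
  ne_b := L.ne_a
  a_ne_b := L.a_ne_b.symm
  ends_iff h := by rw [L.ends_iff, or_comm (a := h = L.a)]
  subset := L.subset
  card := L.card

/-- The coefficient of an STU relation. If the external vertex has no solid edge, the two graphs
`L.fst` and `L.snd` are isomorphic with the same orientation, and `1/2` makes the single graph of an
STU relation of type (II) the mean of the two. -/
def weight : ℚ := if G.solids L.v = ∅ then 1 / 2 else 1

lemma v_ne_w : L.v ≠ L.w := fun h => by
  have h1 : G.external L.v = true := L.external_opp
  rw [h, L.internal] at h1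
  cases h1

lemma ends_a : G.ends L.a = L.w := (L.ends_iff _).2 (Or.inr (Or.inl rfl))

lemma ends_b : G.ends L.b = L.w := (L.ends_iff _).2 (Or.inr (Or.inr rfl))

variable {L} in
lemma of_mem_R {h : Fin m × Bool} (hh : h ∈ L.R) : G.ends h = L.v ∧ G.solid h.1 = true := by
  simpa using L.subset hh

variable {L} in
lemma ends_ne_w_of_mem_R {h : Fin m × Bool} (hh : h ∈ L.R) : G.ends h ≠ L.w := by
  rw [(of_mem_R hh).1]
  exact L.v_ne_w

lemma a_notMem_R : L.a ∉ L.R := fun h => ends_ne_w_of_mem_R h L.ends_a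

lemma b_notMem_R : L.b ∉ L.R := fun h => ends_ne_w_of_mem_R h L.ends_b

lemma k_notMem_R : L.k ∉ L.R := fun h => ends_ne_w_of_mem_R h rfl

lemma opp_k_ne_a : opp L.k ≠ L.a := fun h => L.v_ne_w ((congrArg G.ends h).trans L.ends_a)

lemma internals_fst : L.fst.internals + 1 = G.internals := by
  unfold internals
  rw [← Finset.card_erase_add_one (s := Finset.univ.filter fun v => G.external v = false)
    (a := L.w) (by simp [L.internal])]
  congr 2
  ext y
  simp only [Finset.mem_filter, Finset.mem_univ, true_and, Finset.mem_erase, resolve_external]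
  by_cases h : y = L.w <;> simp [h]

lemma internals_snd : L.snd.internals + 1 = G.internals := L.flip.internals_fst

section BCR

variable (hG : G.IsBCR)
include hG

lemma solid_k : G.solid L.k.1 = false := hG.solid_eq_false L.internal

lemma solid_a : G.solid L.a.1 = false := hG.solid_eq_false (L.ends_a ▸ L.internal)

lemma solid_b : G.solid L.b.1 = false := hG.solid_eq_false (L.ends_b ▸ L.internal)

lemma fst_ne_of_solid {h : Fin m × Bool} (hh : G.solid h.1 = true) : h.1 ≠ L.k.1 := fun e => by
  rw [e, L.solid_k hG] at hh
  cases hh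

lemma opp_k_notMem_R : opp L.k ∉ L.R := fun h => L.fst_ne_of_solid hG (of_mem_R h).2 rfl

omit hG in
lemma fst_ends_k : L.fst.ends L.k = L.w := by
  rw [resolve_ends, if_neg L.ne_a, if_neg L.k_notMem_R]

lemma fst_ends_opp_k : L.fst.ends (opp L.k) = L.v := by
  rw [resolve_ends, if_neg L.opp_k_ne_a, if_neg (L.opp_k_notMem_R hG)]

lemma eq_opp_k {h : Fin m × Bool} (h1 : G.ends h = L.v) (h2 : G.solid h.1 = false) :
    h = opp L.k := hG.eq_of_dashed h1 L.external_opp h2 (L.solid_k hG)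

omit hG in
lemma a_fst_ne : L.a.1 ≠ L.k.1 := fun e => by
  rcases eq_or_eq_opp e with e | e
  · exact L.ne_a e.symm
  · exact L.opp_k_ne_a e.symm

omit hG in
lemma b_fst_ne : L.b.1 ≠ L.k.1 := L.flip.a_fst_ne

lemma solids_fst_v : L.fst.solids L.v = insert (opp L.k) (G.solids L.v \ L.R) := by
  ext h
  have h1 := L.v_ne_w
  have h2 := L.solid_a hG
  have h3 := L.a_fst_ne
  have h4 := L.opp_k_ne_a
  have h5 := L.opp_k_notMem_R hG
  have h6 : h.1 = L.k.1 → h = L.k ∨ h = opp L.k := eq_or_eq_opp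
  simp only [mem_solids, resolve_ends, resolve_solid, Finset.mem_insert, Finset.mem_sdiff]
  have h7 := L.fst_ends_k
  have h8 : (opp L.k).1 = L.k.1 := rfl
  grind [resolve_ends]

lemma solids_fst_w : L.fst.solids L.w = insert L.k L.R := by
  ext h
  have h1 := L.v_ne_w
  have h2 := L.solid_b hG
  have h3 := L.b_fst_ne
  have h5 := L.opp_k_notMem_R hG
  have h6 : h.1 = L.k.1 → h = L.k ∨ h = opp L.k := eq_or_eq_opp
  simp only [mem_solids, resolve_ends, resolve_solid, Finset.mem_insert]
  have h7 := L.ends_iff h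
  have h8 : h ∈ L.R → _ := of_mem_R
  have h9 := L.ne_a
  have h10 := L.k_notMem_R
  grind

omit hG in
lemma solids_fst_of_ne {y : Fin n} (hv : y ≠ L.v) (hw : y ≠ L.w) :
    L.fst.solids y = G.solids y := by
  ext h
  have h2 := L.ends_a
  have h6 : h.1 = L.k.1 → h = L.k ∨ h = opp L.k := eq_or_eq_opp
  simp only [mem_solids, resolve_ends, resolve_solid]
  have h8 : h ∈ L.R → _ := of_mem_R
  grind

lemma dasheds_fst_v : L.fst.dasheds L.v = {L.a} := by
  ext h
  have h1 := L.v_ne_w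
  have h2 := L.solid_a hG
  have h3 := L.a_fst_ne
  have h6 : _ → _ → h = _ := L.eq_opp_k hG
  have h7 : (opp L.k).1 = L.k.1 := rfl
  simp only [mem_dasheds, resolve_ends, resolve_solid, Finset.mem_singleton]
  grind

lemma dasheds_fst_w : L.fst.dasheds L.w = {L.b} := by
  ext h
  have h1 := L.v_ne_w
  have h2 := L.solid_b hG
  have h3 := L.b_fst_ne
  have h4 := L.a_ne_b
  have h5 := L.b_notMem_R
  have h7 := L.ends_iff h
  have h8 : h ∈ L.R → _ := of_mem_R
  simp only [mem_dasheds, resolve_ends, resolve_solid, Finset.mem_singleton]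
  grind

omit hG in
lemma dasheds_fst_of_ne {y : Fin n} (hv : y ≠ L.v) (hw : y ≠ L.w) :
    L.fst.dasheds y = G.dasheds y := by
  ext h
  have h2 := L.ends_a
  have h6 : h.1 = L.k.1 → h = L.k ∨ h = opp L.k := eq_or_eq_opp
  simp only [mem_dasheds, resolve_ends, resolve_solid]
  have h8 : h ∈ L.R → _ := of_mem_R
  grind

lemma connected_fst : L.fst.toGraph.underlying.Connected := by
  have hvw : L.fst.Joined L.w L.v := by
    have := L.fst.joined_opp L.k
    rwa [L.fst_ends_k, L.fst_ends_opp_k hG] at this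
  refine connected_of_joined_ends hG.connected fun h => ?_
  rw [resolve_ends]
  split_ifs with h1 h2
  · rw [h1, L.ends_a]
    exact hvw
  · rw [(of_mem_R h2).1]
    exact hvw.symm
  · exact SimpleGraph.Reachable.refl _

/-- Contracting the new solid edge gives back the old solid edges. -/
lemma ends_eq_of_solid_fst {h : Fin m × Bool} (hh : L.fst.solid h.1 = true) (hk : h.1 ≠ L.k.1) :
    G.solid h.1 = true ∧
      G.ends h = if L.fst.ends h = L.w then L.v else L.fst.ends h := by
  rw [resolve_solid, if_neg hk] at hh
  have h1 : h ∈ L.R → _ := of_mem_R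
  have h2 := L.solid_a hG
  have h3 : G.external L.w = false := L.internal
  have h4 : G.ends h ≠ L.w := fun e => by
    rw [← e] at h3
    rw [hG.solid_eq_false h3] at hh
    cases hh
  refine ⟨hh, ?_⟩
  rw [resolve_ends]
  grind

lemma card_R_le : L.R.card ≤ 1 := by
  have := hG.card_solids_le L.v
  have : L.R.card = (G.solids L.v).card - 1 := L.card
  omega

end BCR
end Leg

/-! ### Resolving a leg of a BCR graph -/

namespace Leg
variable {G : Net n m} (L : Leg G)

lemma solidUnderlying_adj {G : Net n m} {x y : Fin n} :
    G.toGraph.solidUnderlying.Adj x y ↔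
      x ≠ y ∧ ∃ h, G.solid h.1 = true ∧ G.ends h = x ∧ G.ends (opp h) = y := by
  unfold ColoredGraph.solidUnderlying
  rw [SimpleGraph.fromRel_adj]
  refine and_congr_right fun _ => ⟨?_, ?_⟩
  · rintro (⟨e, h, h1, h2⟩ | ⟨e, h, h1, h2⟩)
    · exact ⟨(e, false), h, h1, h2⟩
    · exact ⟨(e, true), h, h2, h1⟩
  · rintro ⟨⟨e, _ | _⟩, h, h1, h2⟩
    · exact Or.inl ⟨e, h, h1, h2⟩
    · exact Or.inr ⟨e, h, h2, h1⟩

lemma eq_of_ends_eq {G : Net n m} (hG : G.IsBCR) {h h' : Fin m × Bool} (hs : G.solid h.1 = true)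
    (hs' : G.solid h'.1 = true)
    (e : s(G.ends h, G.ends (opp h)) = s(G.ends h', G.ends (opp h'))) : h.1 = h'.1 := by
  have key : ∀ k : Fin m × Bool,
      s(G.ends k, G.ends (opp k)) = s(G.ends (k.1, false), G.ends (k.1, true)) := by
    rintro ⟨k, _ | _⟩
    · rfl
    · exact Sym2.eq_swap
  rw [key, key] at e
  exact hG.no_double_solid_edge _ _ hs hs' e

/-- Splitting a vertex of a forest into two vertices joined by an edge gives a forest: if the edges
in `L.R` (there is at most one) are deleted, then the isolated vertex `L.w` can be joined to the
other end of the deleted edge and to `L.v`. -/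
lemma isAcyclic_fst (hG : G.IsBCR) : L.fst.toGraph.solidUnderlying.IsAcyclic := by
  set F := G.toGraph.solidUnderlying with hF
  have hFw : ∀ y, ¬ F.Adj L.w y := fun y hy => by
    obtain ⟨-, h, h1, h2, -⟩ := solidUnderlying_adj.1 hy
    have h3 : G.external (G.ends h) = false := h2 ▸ L.internal
    rw [hG.solid_eq_false h3] at h1
    cases h1
  have hadj : ∀ {h : Fin m × Bool}, G.solid h.1 = true → F.Adj (G.ends h) (G.ends (opp h)) :=
    fun {h} hs => solidUnderlying_adj.2 ⟨(hG.ends_opp_ne hs).symm, h, hs, rfl, rfl⟩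
  -- Solid edges away from `L.R` are old.
  have hold : ∀ {h : Fin m × Bool}, L.fst.solid h.1 = true → h.1 ≠ L.k.1 → h ∉ L.R →
      L.fst.ends h = G.ends h := fun {h} hs hk hR => by
    have h2 := L.solid_a hG
    rw [resolve_ends, if_neg, if_neg hR]
    intro e
    rw [resolve_solid, if_neg hk, e, h2] at hs
    cases hs
  have hk : ∀ {h : Fin m × Bool}, h.1 = L.k.1 → L.fst.ends h ≠ L.fst.ends (opp h) →
      (SimpleGraph.edge L.v L.w).Adj (L.fst.ends h) (L.fst.ends (opp h)) := fun {h} e hne => by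
    rw [SimpleGraph.edge_adj]
    refine ⟨?_, hne⟩
    rcases eq_or_eq_opp e with e | e
    · rw [e, L.fst_ends_k, L.fst_ends_opp_k hG]
      simp
    · rw [e, opp_opp, L.fst_ends_k, L.fst_ends_opp_k hG]
      simp
  rcases Nat.le_one_iff_eq_zero_or_eq_one.1 (L.card_R_le hG) with hR | hR
  · rw [Finset.card_eq_zero] at hR
    have hvw : ¬ F.Reachable L.v L.w := fun h => by
      obtain ⟨p, q, -, hq, ha⟩ := h.exists_adj_boundary (X := {y | y ≠ L.w}) L.v_ne_w (by simp)
      have hq' : q = L.w := by simpa using hq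
      exact hFw p (hq' ▸ ha.symm)
    refine SimpleGraph.IsAcyclic.anti ?_
      ((SimpleGraph.isAcyclic_add_edge_iff_of_not_reachable _ _ hvw).2 hG.no_solid_cycle)
    intro x y hxy
    obtain ⟨hne, h, hs, rfl, rfl⟩ := solidUnderlying_adj.1 hxy
    rw [SimpleGraph.sup_adj]
    by_cases e : h.1 = L.k.1
    · exact Or.inr (hk e hne)
    · left
      rw [hold hs e (by simp [hR]), hold (h := opp h) hs e (by simp [hR])]
      exact hadj (L.ends_eq_of_solid_fst hG hs e).1
  obtain ⟨r, hr⟩ := Finset.card_eq_one.1 hR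
  have hrR : r ∈ L.R := by simp [hr]
  obtain ⟨hrv, hrs⟩ := of_mem_R hrR
  have hR : ∀ h, h ∈ L.R ↔ h = r := fun h => by simp [hr]
  set x := G.ends (opp r) with hx
  have hxv : x ≠ L.v := fun e => hG.ends_opp_ne hrs (e.trans hrv.symm)
  have hoR : opp r ∉ L.R := fun h => opp_ne r ((hR _).1 h)
  have hxw : x ≠ L.w := fun e => hFw L.v (by
    have := (hadj hrs).symm
    rwa [← hx, e, hrv] at this)
  set F' := F.deleteEdges {s(L.v, x)} with hF'
  have hF'w : ∀ y, ¬ F'.Adj L.w y := fun y hy => hFw y ((SimpleGraph.deleteEdges_le _) hy)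
  have hF'a : F'.IsAcyclic := hG.no_solid_cycle.anti (SimpleGraph.deleteEdges_le _)
  have hvx : ¬ F'.Reachable L.v x := by
    have h1 := hadj hrs
    rw [hrv, ← hx] at h1
    exact SimpleGraph.isAcyclic_iff_forall_adj_isBridge.1 hG.no_solid_cycle h1
  have hwx : ¬ F'.Reachable L.w x := fun h => by
    obtain ⟨p, q, hp, -, ha⟩ := h.exists_adj_boundary (X := {L.w}) rfl hxw
    rw [Set.mem_singleton_iff.1 hp] at ha
    exact hF'w _ ha
  have hvw : ¬ (F' ⊔ SimpleGraph.edge L.w x).Reachable L.v L.w := fun h => by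
    have hw : L.w ∉ {y | F'.Reachable L.v y} := fun h => by
      obtain ⟨p, q, -, hq, ha⟩ := h.exists_adj_boundary (X := {y | y ≠ L.w}) L.v_ne_w (by simp)
      have hq' : q = L.w := by simpa using hq
      exact hF'w p (hq' ▸ ha.symm)
    obtain ⟨p, q, hp, hq, ha⟩ := h.exists_adj_boundary (SimpleGraph.Reachable.refl _) hw
    rw [SimpleGraph.sup_adj, SimpleGraph.edge_adj] at ha
    rcases ha with ha | ⟨⟨rfl, -⟩ | ⟨rfl, -⟩, -⟩
    · exact hq (SimpleGraph.Reachable.trans hp ha.reachable)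
    · exact hw hp
    · exact hvx hp
  refine SimpleGraph.IsAcyclic.anti ?_
    ((SimpleGraph.isAcyclic_add_edge_iff_of_not_reachable _ _ hvw).2
      ((SimpleGraph.isAcyclic_add_edge_iff_of_not_reachable _ _ hwx).2 hF'a))
  intro y z hyz
  obtain ⟨hne, h, hs, rfl, rfl⟩ := solidUnderlying_adj.1 hyz
  rw [SimpleGraph.sup_adj, SimpleGraph.sup_adj]
  by_cases e : h.1 = L.k.1
  · exact Or.inr (hk e hne)
  left
  have hs0 := (L.ends_eq_of_solid_fst hG hs e).1
  have hr1 : r.1 ≠ L.k.1 := L.fst_ne_of_solid hG hrs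
  have hrs' : L.fst.solid r.1 = true := by rw [resolve_solid, if_neg hr1, hrs]
  have hrw : L.fst.ends r = L.w := by
    rw [resolve_ends, if_neg (fun e : r = L.a => L.a_notMem_R (e ▸ hrR)), if_pos hrR]
  have hrx : L.fst.ends (opp r) = x := hold (h := opp r) hrs' hr1 hoR
  by_cases e' : h.1 = r.1
  · right
    rw [SimpleGraph.edge_adj]
    refine ⟨?_, hne⟩
    rcases eq_or_eq_opp e' with e' | e'
    · rw [e', hrw, hrx]
      simp
    · rw [e', opp_opp, hrw, hrx]
      simp
  · left
    have h1 : h ∉ L.R := fun hh => e' (by rw [(hR _).1 hh])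
    have h2 : opp h ∉ L.R := fun hh => e' (by rw [← (hR _).1 hh, opp_fst])
    rw [hold hs e h1, hold (h := opp h) hs e h2, SimpleGraph.deleteEdges_adj]
    refine ⟨hadj hs0, fun hh => e' ?_⟩
    rw [Set.mem_singleton_iff, ← hrv, hx] at hh
    exact eq_of_ends_eq hG hs0 hrs hh

/-- Resolving a leg of a BCR graph gives a BCR graph. -/
lemma isBCR_fst (hG : G.IsBCR) : L.fst.IsBCR := by
  have hext : ∀ y, y ≠ L.w → L.fst.external y = G.external y := fun y hy => by
    rw [resolve_external, if_neg hy]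
  have hw : L.fst.external L.w = true := by rw [resolve_external, if_pos rfl]
  have hsolid : ∀ {e}, L.fst.solid e = true → L.fst.ends (e, false) ≠ L.fst.ends (e, true) := by
    intro e hs he
    by_cases hk : e = L.k.1
    · have h1 : L.fst.ends L.k = L.fst.ends (opp L.k) := by
        rcases eq_or_eq_opp (h := (e, false)) hk with h | h
        · have h' : (e, true) = opp L.k := by rw [← h]; rfl
          rwa [h, h'] at he
        · have h' : (e, true) = L.k := by rw [← opp_opp L.k, ← h]; rfl
          rw [h, h'] at he
          exact he.symm
      rw [L.fst_ends_k, L.fst_ends_opp_k hG] at h1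
      exact L.v_ne_w h1.symm
    · have h1 := L.ends_eq_of_solid_fst hG (h := (e, false)) hs hk
      have h2 := L.ends_eq_of_solid_fst hG (h := (e, true)) hs hk
      exact hG.no_solid_loop e h1.1 (h1.2.trans (Eq.trans (by rw [he]) h2.2.symm))
  refine ⟨L.connected_fst hG, ⟨_, hw⟩, fun y hy => ?_, fun y hy => ?_, fun y hy => ?_,
    fun y hy => ?_, fun e hs => hsolid hs, fun e e' hs hs' he => ?_, L.isAcyclic_fst hG⟩
  · have h1 : y ≠ L.w := fun e => by
      rw [e] at hy
      exact Bool.noConfusion (hw.symm.trans hy)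
    have h2 : G.external y = false := (hext y h1).symm.trans hy
    have h3 : y ≠ L.v := fun e => by
      rw [e] at h2
      exact Bool.noConfusion (L.external_opp.symm.trans h2)
    have := hG.internal_dashed y h2
    rw [toGraph_dashedHalfEdges] at this ⊢
    rw [L.dasheds_fst_of_ne h3 h1, this]
  · have h1 : y ≠ L.w := fun e => by
      rw [e] at hy
      exact Bool.noConfusion (hw.symm.trans hy)
    have h2 : G.external y = false := (hext y h1).symm.trans hy
    have h3 : y ≠ L.v := fun e => by
      rw [e] at h2
      exact Bool.noConfusion (L.external_opp.symm.trans h2)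
    have := hG.internal_solid y h2
    rw [toGraph_solidHalfEdges] at this ⊢
    rw [L.solids_fst_of_ne h3 h1, this]
  · rw [toGraph_dashedHalfEdges]
    by_cases h1 : y = L.w
    · rw [h1, L.dasheds_fst_w hG, Finset.card_singleton]
    by_cases h2 : y = L.v
    · rw [h2, L.dasheds_fst_v hG, Finset.card_singleton]
    · have := hG.external_dashed y ((hext y h1).symm.trans hy)
      rw [toGraph_dashedHalfEdges] at this
      rw [L.dasheds_fst_of_ne h2 h1, this]
  · rw [toGraph_solidHalfEdges]
    have hc : L.R.card = (G.solids L.v).card - 1 := L.card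
    have hc' := hG.card_solids_le L.v
    have hR := L.card_R_le hG
    by_cases h1 : y = L.w
    · rw [h1, L.solids_fst_w hG]
      exact (Finset.card_insert_le _ _).trans (by omega)
    by_cases h2 : y = L.v
    · rw [h2, L.solids_fst_v hG]
      refine (Finset.card_insert_le _ _).trans ?_
      have h3 := Finset.card_sdiff_of_subset L.subset
      change (G.solids L.v \ L.R).card = (G.solids L.v).card - L.R.card at h3
      omega
    · rw [L.solids_fst_of_ne h2 h1]
      exact hG.card_solids_le y
  · -- The edge `L.k.1` is contracted to a loop, the others to distinct solid edges.
    have hne := hsolid hs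
    have hne' := hsolid hs'
    change s(L.fst.ends (e, false), L.fst.ends (e, true)) =
      s(L.fst.ends (e', false), L.fst.ends (e', true)) at he
    have hk : ∀ e, e = L.k.1 → s(L.fst.ends (e, false), L.fst.ends (e, true)) = s(L.w, L.v) := by
      rintro e hk
      have h1 := L.fst_ends_k
      have h2 := L.fst_ends_opp_k hG
      rcases eq_or_eq_opp (h := (e, false)) hk with h | h
      · have h' : (e, true) = opp L.k := by rw [← h]; rfl
        rw [h, h', h1, h2]
      · have h' : (e, true) = L.k := by rw [← opp_opp L.k, ← h]; rfl
        rw [h, h', h1, h2, Sym2.eq_swap]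
    have hloop : ∀ e, e ≠ L.k.1 → L.fst.solid e = true →
        s(L.fst.ends (e, false), L.fst.ends (e, true)) ≠ s(L.w, L.v) := fun e hk hs h => by
      have h1 := L.ends_eq_of_solid_fst hG (h := (e, false)) hs hk
      have h2 := L.ends_eq_of_solid_fst hG (h := (e, true)) hs hk
      apply hG.no_solid_loop e h1.1
      refine h1.2.trans (Eq.trans ?_ h2.2.symm)
      rcases Sym2.eq_iff.1 h with ⟨h3, h4⟩ | ⟨h3, h4⟩ <;> rw [h3, h4] <;> simp
    by_cases h : e = L.k.1 <;> by_cases h' : e' = L.k.1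
    · rw [h, h']
    · exact absurd (he.symm.trans (hk e h)) (hloop e' h' hs')
    · exact absurd (he.trans (hk e' h')) (hloop e h hs)
    · have h1 := L.ends_eq_of_solid_fst hG (h := (e, false)) hs h
      have h2 := L.ends_eq_of_solid_fst hG (h := (e, true)) hs h
      have h3 := L.ends_eq_of_solid_fst hG (h := (e', false)) hs' h'
      have h4 := L.ends_eq_of_solid_fst hG (h := (e', true)) hs' h'
      apply hG.no_double_solid_edge e e' h1.1 h3.1
      change s(G.ends (e, false), G.ends (e, true)) = s(G.ends (e', false), G.ends (e', true))
      rw [h1.2, h2.2, h3.2, h4.2]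
      rcases Sym2.eq_iff.1 he with ⟨h5, h6⟩ | ⟨h5, h6⟩ <;> rw [h5, h6]
      exact Sym2.eq_swap

lemma isBCR_snd (hG : G.IsBCR) : L.snd.IsBCR := L.flip.isBCR_fst hG

end Leg

/-! ### Changes of colour -/

/-- The renaming of the half-edges in `relabel`. -/
def renameHalfEdge (τ : Equiv.Perm (Fin m)) (ε : Fin m → Bool) : Equiv.Perm (Fin m × Bool) where
  toFun h := (τ h.1, xor h.2 (ε h.1))
  invFun h := (τ.symm h.1, xor h.2 (ε (τ.symm h.1)))
  left_inv h := by simp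
  right_inv h := by simp

lemma renameHalfEdge_apply (τ : Equiv.Perm (Fin m)) (ε : Fin m → Bool) (h : Fin m × Bool) :
    renameHalfEdge τ ε h = (τ h.1, xor h.2 (ε h.1)) := rfl

lemma renameHalfEdge_opp (τ : Equiv.Perm (Fin m)) (ε : Fin m → Bool) (h : Fin m × Bool) :
    renameHalfEdge τ ε (opp h) = opp (renameHalfEdge τ ε h) := by
  simp [renameHalfEdge_apply, opp]

section Relabel

variable (G : Net n m) (σ : Equiv.Perm (Fin n)) (τ : Equiv.Perm (Fin m)) (ε : Fin m → Bool)

lemma relabel_ends (h : Fin m × Bool) :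
    (G.relabel σ τ ε).ends (renameHalfEdge τ ε h) = σ (G.ends h) := by
  simp [relabel, renameHalfEdge_apply]

lemma relabel_solid (e : Fin m) : (G.relabel σ τ ε).solid (τ e) = G.solid e := by
  simp [relabel]

lemma relabel_external (v : Fin n) : (G.relabel σ τ ε).external (σ v) = G.external v := by
  simp [relabel]

variable {G σ τ ε}

lemma eq_relabel {H : Net n m} (h1 : ∀ h, H.ends (renameHalfEdge τ ε h) = σ (G.ends h))
    (h2 : ∀ e, H.solid (τ e) = G.solid e) (h3 : ∀ v, H.external (σ v) = G.external v) :
    H = G.relabel σ τ ε := by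
  ext x
  · obtain ⟨h, rfl⟩ := (renameHalfEdge τ ε).surjective x
    rw [h1, relabel_ends]
  · obtain ⟨e, rfl⟩ := τ.surjective x
    rw [h2, relabel_solid]
  · obtain ⟨v, rfl⟩ := σ.surjective x
    rw [h3, relabel_external]

lemma relabel_internals : (G.relabel σ τ ε).internals = G.internals := by
  symm
  apply Finset.card_bijective σ σ.bijective
  simp [relabel_external]

lemma relabel_resolve (k a : Fin m × Bool) (R : Finset (Fin m × Bool)) :
    (G.relabel σ τ ε).resolve (renameHalfEdge τ ε k) (renameHalfEdge τ ε a)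
      (R.map (renameHalfEdge τ ε).toEmbedding) = (G.resolve k a R).relabel σ τ ε := by
  apply eq_relabel
  · intro h
    rw [resolve_ends, resolve_ends, ← renameHalfEdge_opp]
    simp only [relabel_ends, EmbeddingLike.apply_eq_iff_eq, Finset.mem_map_equiv,
      Equiv.symm_apply_apply]
    split_ifs <;> rfl
  · intro e
    rw [resolve_solid, resolve_solid, relabel_solid]
    simp [renameHalfEdge_apply]
  · intro v
    rw [resolve_external, resolve_external, relabel_external, relabel_ends]
    simp

lemma relabel_solids (v : Fin n) : (G.relabel σ τ ε).solids (σ v) =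
    (G.solids v).map (renameHalfEdge τ ε).toEmbedding := by
  ext x
  obtain ⟨h, rfl⟩ := (renameHalfEdge τ ε).surjective x
  have : (G.relabel σ τ ε).solid (renameHalfEdge τ ε h).1 = G.solid h.1 :=
    G.relabel_solid σ τ ε h.1
  rw [mem_solids, relabel_ends, this, Finset.mem_map_equiv, Equiv.symm_apply_apply, mem_solids]
  simp

end Relabel

/-- Transport of a leg along a change of colour. -/
@[simps] def Leg.relabel {G : Net n m} (L : Leg G) (σ : Equiv.Perm (Fin n))
    (τ : Equiv.Perm (Fin m)) (ε : Fin m → Bool) : Leg (G.relabel σ τ ε) where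
  k := renameHalfEdge τ ε L.k
  a := renameHalfEdge τ ε L.a
  b := renameHalfEdge τ ε L.b
  R := L.R.map (renameHalfEdge τ ε).toEmbedding
  external_opp := by
    rw [← renameHalfEdge_opp, relabel_ends, relabel_external]
    exact L.external_opp
  internal := by
    rw [relabel_ends, relabel_external]
    exact L.internal
  ne_a := by simpa using L.ne_a
  ne_b := by simpa using L.ne_b
  a_ne_b := by simpa using L.a_ne_b
  ends_iff x := by
    obtain ⟨h, rfl⟩ := (renameHalfEdge τ ε).surjective x
    simpa [relabel_ends] using L.ends_iff h
  subset := by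
    rw [← renameHalfEdge_opp, relabel_ends, relabel_solids]
    simpa using L.subset
  card := by
    rw [← renameHalfEdge_opp, relabel_ends, relabel_solids, Finset.card_map, Finset.card_map]
    exact L.card

lemma Leg.relabel_weight {G : Net n m} (L : Leg G) (σ : Equiv.Perm (Fin n))
    (τ : Equiv.Perm (Fin m)) (ε : Fin m → Bool) : (L.relabel σ τ ε).weight = L.weight := by
  unfold Leg.weight Leg.v
  rw [relabel_k, ← renameHalfEdge_opp, relabel_ends, relabel_solids]
  simp

/-- Reversing one edge and exchanging two vertices does not change the orientation. -/
lemma colorSign_swap (p : Parity) {v w : Fin n} (h : v ≠ w) (e : Fin m) :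
    colorSign p (Equiv.swap v w) 1 (fun d => decide (d = e)) = 1 := by
  cases p
  · simp [colorSign, Equiv.Perm.sign_swap h]
  · simp [colorSign]

/-- Exchanging two edges and reversing one of them reverses the orientation. -/
lemma colorSign_swap_edges (p : Parity) {σ : Equiv.Perm (Fin n)} (hσ : Equiv.Perm.sign σ = 1)
    {e f : Fin m} (h : e ≠ f) (s : Bool) :
    colorSign p σ (Equiv.swap e f) (fun d => if d = e then s else if d = f then !s else false) =
      -1 := by
  cases p
  · have h1 : ∀ d : Fin m, (if (if d = e then s else if d = f then !s else false) = true
        then (-1 : ℤˣ) else 1) = if d = (if s then e else f) then -1 else 1 := fun d => by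
      cases s <;> grind
    simp only [colorSign, hσ, one_mul]
    rw [Finset.prod_congr rfl fun d _ => h1 d]
    simp
  · simp [colorSign, Equiv.Perm.sign_swap h]

/-! ### STU expressions -/

section Resolutions

variable {M : Type*} [AddCommGroup M] [Module ℚ M]

/-- The value under `ψ` of the element `y` in the STU relation `G + y = 0` at a leg. -/
def total (ψ : Net n m → M) {G : Net n m} (L : Leg G) : M := L.weight • (ψ L.fst + ψ L.snd)

/-- The function `ψ` respects the orientation relations between graphs with `c` internal
vertices. -/
def OrientAt (p : Parity) (ψ : Net n m → M) (c : ℕ) : Prop :=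
  ∀ (G : Net n m) (σ : Equiv.Perm (Fin n)) (τ : Equiv.Perm (Fin m)) (ε : Fin m → Bool),
    G.IsBCR → (G.relabel σ τ ε).IsBCR → G.internals = c →
      ψ (G.relabel σ τ ε) = ((colorSign p σ τ ε : ℤ) : ℚ) • ψ G

/-- The function `ψ` respects the STU relations of the graphs with `c` internal vertices. -/
def StuAt (ψ : Net n m → M) (c : ℕ) : Prop :=
  ∀ G : Net n m, G.IsBCR → G.internals = c → ∀ L : Leg G, ψ G = -total ψ L

variable {ψ : Net n m → M} {p : Parity} {c : ℕ} {G : Net n m}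

lemma total_flip (L : Leg G) : total ψ L.flip = total ψ L := by
  unfold total
  rw [add_comm]
  rfl

lemma total_relabel (hO : OrientAt p ψ c) (L : Leg G) {σ : Equiv.Perm (Fin n)}
    {τ : Equiv.Perm (Fin m)} {ε : Fin m → Bool} (hG : G.IsBCR) (hH : (G.relabel σ τ ε).IsBCR)
    (hc : G.internals = c + 1) :
    total ψ (L.relabel σ τ ε) = ((colorSign p σ τ ε : ℤ) : ℚ) • total ψ L := by
  have h1 : (L.relabel σ τ ε).fst = L.fst.relabel σ τ ε := relabel_resolve _ _ _
  have h2 : (L.relabel σ τ ε).snd = L.snd.relabel σ τ ε := relabel_resolve _ _ _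
  have h3 := (L.relabel σ τ ε).isBCR_fst hH
  have h4 := (L.relabel σ τ ε).isBCR_snd hH
  have h5 := L.internals_fst
  have h6 := L.internals_snd
  rw [h1] at h3
  rw [h2] at h4
  unfold total
  rw [h1, h2, Leg.relabel_weight, hO _ _ _ _ (L.isBCR_fst hG) h3 (by omega),
    hO _ _ _ _ (L.isBCR_snd hG) h4 (by omega), ← smul_add, smul_comm]

/-- Exchanging the two vertices of the new solid edge, and reversing it, exchanges the sets `R` and
`R'` of solid half-edges as well as `a` and `b`. -/
lemma Leg.snd_eq_relabel_fst (L : Leg G) (hG : G.IsBCR) {R' : Finset (Fin m × Bool)}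
    (hd : Disjoint L.R R') (hu : L.R ∪ R' = G.solids L.v) :
    G.resolve L.k L.b R' =
      L.fst.relabel (Equiv.swap L.v L.w) 1 (fun d => decide (d = L.k.1)) := by
  have hvw := L.v_ne_w
  apply eq_relabel
  · intro h
    have h0 : renameHalfEdge 1 (fun d => decide (d = L.k.1)) h =
        if h.1 = L.k.1 then opp h else h := by
      rw [renameHalfEdge_apply]
      split_ifs with e <;> simp [e, opp]
    rw [h0, resolve_ends, resolve_ends]
    have h1 := L.ends_a
    have h2 := L.ends_b
    have h3 := L.a_ne_b
    have h4 : h.1 = L.k.1 → h = L.k ∨ h = opp L.k := eq_or_eq_opp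
    have h5 := L.a_fst_ne
    have h6 := L.b_fst_ne
    have h7 : ∀ x, x ∈ G.solids L.v ↔ x ∈ L.R ∨ x ∈ R' := fun x => by
      rw [← hu, Finset.mem_union]
    have h8 : ∀ x, x ∈ L.R → x ∉ R' := fun x h => Finset.disjoint_left.1 hd h
    have h9 : ∀ x, x ∈ G.solids L.v ↔ G.ends x = L.v ∧ G.solid x.1 = true := fun x => mem_solids
    have h10 : opp (opp L.k) = L.k := opp_opp _
    have h11 : (opp L.k).1 = L.k.1 := rfl
    have h12 := L.solid_k hG
    have h13 := L.ends_iff h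
    have h14 : _ → _ → h = _ := L.eq_opp_k hG
    rw [Equiv.swap_apply_def]
    grind
  · intro e
    simp [resolve_solid]
  · intro v
    have := L.external_opp
    rw [resolve_external, resolve_external, Equiv.swap_apply_def]
    grind

lemma Leg.apply_snd_eq (hO : OrientAt p ψ c) (L : Leg G) (hG : G.IsBCR)
    (hc : G.internals = c + 1) {R' : Finset (Fin m × Bool)} (hd : Disjoint L.R R')
    (hu : L.R ∪ R' = G.solids L.v) (hB : (G.resolve L.k L.b R').IsBCR) :
    ψ (G.resolve L.k L.b R') = ψ L.fst := by
  have h1 := L.snd_eq_relabel_fst hG hd hu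
  have h2 := L.internals_fst
  rw [h1] at hB ⊢
  rw [hO _ _ _ _ (L.isBCR_fst hG) hB (by omega), colorSign_swap p L.v_ne_w]
  simp

/-- The value of an STU expression only depends on the half-edge `L.k`. -/
lemma total_congr (hO : OrientAt p ψ c) (hG : G.IsBCR) (hc : G.internals = c + 1) {L L' : Leg G}
    (hk : L.k = L'.k) : total ψ L = total ψ L' := by
  wlog ha : L.a = L'.a generalizing L
  · rw [← total_flip]
    refine this (L := L.flip) hk ?_
    have h1 := L.ends_iff L'.a
    rw [hk] at h1
    have h2 := (h1.1 L'.ends_a).resolve_left L'.ne_a.symm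
    exact (h2.resolve_left fun e => ha e.symm).symm
  have hb : L.b = L'.b := by
    have h1 := L'.ends_iff L.b
    rw [← hk] at h1
    have h2 := (h1.1 L.ends_b).resolve_left (hk ▸ L.ne_b.symm)
    exact h2.resolve_left fun e => L.a_ne_b (ha.trans e.symm)
  have hw : L.weight = L'.weight := by unfold Leg.weight Leg.v; rw [hk]
  have hsub := L.subset
  have hcard := L.card
  have hsub' := L'.subset
  have hcard' := L'.card
  rw [← hk] at hsub' hcard'
  have h2 := hG.card_solids_le (G.ends (opp L.k))
  have e1 : L'.fst = G.resolve L.k L.a L'.R := by rw [hk, ha]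
  have e2 : L'.snd = G.resolve L.k L.b L'.R := by rw [hk, hb]
  by_cases hR : L.R = L'.R
  · unfold total
    rw [hw, e1, e2, ← hR]
  have hne : (G.solids (G.ends (opp L.k))).card = 2 := by
    by_contra hne
    apply hR
    rw [Finset.card_eq_zero.1 (show L.R.card = 0 by omega),
      Finset.card_eq_zero.1 (show L'.R.card = 0 by omega)]
  obtain ⟨r, hr⟩ := Finset.card_eq_one.1 (show L.R.card = 1 by omega)
  obtain ⟨r', hr'⟩ := Finset.card_eq_one.1 (show L'.R.card = 1 by omega)
  have hrr : r ≠ r' := fun e => hR (by rw [hr, hr', e])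
  have hd : Disjoint L.R L'.R := by rw [hr, hr']; simpa using hrr
  have hu : L.R ∪ L'.R = G.solids (G.ends (opp L.k)) :=
    Finset.eq_of_subset_of_card_le (Finset.union_subset hsub hsub')
      (by rw [Finset.card_union_of_disjoint hd]; omega)
  have h3 := L.apply_snd_eq hO hG hc hd hu (by rw [← e2]; exact L'.isBCR_snd hG)
  have h4 := L.flip.apply_snd_eq hO hG hc hd hu (by
    have := L'.isBCR_fst hG
    rwa [e1] at this)
  unfold total
  rw [e1, e2, h3, hw, add_comm]
  congr 2
  exact h4.symm

/-! ### Commuting resolutions -/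

lemma Leg.k_fst_ne {L L' : Leg G} (h : L.w ≠ L'.w) : L'.k.1 ≠ L.k.1 := fun e => by
  rcases eq_or_eq_opp e with e | e
  · exact h (congrArg G.ends e.symm)
  · have h1 := L'.internal
    have h2 := L.external_opp
    rw [e, h2] at h1
    cases h1

lemma Leg.v_ne_v (hG : G.IsBCR) {L L' : Leg G} (h : L.w ≠ L'.w) : L'.v ≠ L.v := fun e =>
  Leg.k_fst_ne h (by
    have := L.eq_opp_k hG e (L'.solid_k hG)
    rw [← opp_fst, this, opp_fst])

lemma Leg.v_ne_w' (L L' : Leg G) : L'.v ≠ L.w := fun h => by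
  have h1 : G.external L'.v = true := L'.external_opp
  rw [h, L.internal] at h1
  cases h1

/-- A leg remains a leg when a leg at another internal vertex is resolved. -/
@[simps] def Leg.after (L' L : Leg G) (hG : G.IsBCR) (h : L.w ≠ L'.w) : Leg L.fst :=
  have hv := Leg.v_ne_v hG h
  have hvw := L.v_ne_w' L'
  have e1 : L.fst.ends (opp L'.k) = L'.v := by
    have h1 := L.ends_a
    have h2 : opp L'.k ∈ L.R → _ := Leg.of_mem_R
    rw [resolve_ends]
    grind
  have e2 : ∀ x, L.fst.ends x = L'.w ↔ G.ends x = L'.w := fun x => by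
    have h1 := L.ends_a
    have h2 : x ∈ L.R → _ := Leg.of_mem_R
    have h3 := L'.v_ne_w' L
    rw [resolve_ends]
    grind
  have e3 : L.fst.ends L'.k = L'.w := (e2 _).2 rfl
  have e4 : L.fst.solids L'.v = G.solids L'.v := L.solids_fst_of_ne hv hvw
  { k := L'.k
    a := L'.a
    b := L'.b
    R := L'.R
    external_opp := by
      rw [e1, resolve_external, if_neg hvw]
      exact L'.external_opp
    internal := by
      rw [e3, resolve_external, if_neg h.symm]
      exact L'.internal
    ne_a := L'.ne_a
    ne_b := L'.ne_b
    a_ne_b := L'.a_ne_b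
    ends_iff := fun x => by
      rw [e3, e2]
      exact L'.ends_iff x
    subset := by
      rw [e1, e4]
      exact L'.subset
    card := by
      rw [e1, e4]
      exact L'.card }

lemma Leg.after_ends_opp (L' L : Leg G) (hG : G.IsBCR) (h : L.w ≠ L'.w) :
    L.fst.ends (opp L'.k) = L'.v := by
  have hv := Leg.v_ne_v hG h
  have h1 := L.ends_a
  have h2 : opp L'.k ∈ L.R → _ := Leg.of_mem_R
  have hvw := L.v_ne_w' L'
  rw [resolve_ends]
  grind

lemma Leg.after_weight (L' L : Leg G) (hG : G.IsBCR) (h : L.w ≠ L'.w) :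
    (L'.after L hG h).weight = L'.weight := by
  unfold Leg.weight Leg.v
  rw [after_k, L'.after_ends_opp L hG h,
    L.solids_fst_of_ne (Leg.v_ne_v hG h) (L.v_ne_w' L')]

lemma Leg.after_fst_comm (L L' : Leg G) (hG : G.IsBCR) (h : L.w ≠ L'.w) :
    (L'.after L hG h).fst = (L.after L' hG h.symm).fst := by
  have h1 := L.ends_a
  have h2 := L'.ends_a
  have h3 := L.v_ne_w
  have h4 := L'.v_ne_w
  have h5 := L.v_ne_w' L'
  have h6 := L'.v_ne_w' L
  have h7 := Leg.v_ne_v hG h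
  have h8 := L'.after_ends_opp L hG h
  have h9 := L.after_ends_opp L' hG h.symm
  have h10 : L.fst.ends L'.k = L'.w := by
    have : L'.k ∈ L.R → _ := Leg.of_mem_R
    rw [resolve_ends]
    grind
  have h11 : L'.fst.ends L.k = L.w := by
    have : L.k ∈ L'.R → _ := Leg.of_mem_R
    rw [resolve_ends]
    grind
  ext x
  · have h12 : x ∈ L.R → _ := Leg.of_mem_R
    have h13 : x ∈ L'.R → _ := Leg.of_mem_R
    simp only [resolve_ends, after_k, after_a, after_R] at h8 h9 h10 h11 ⊢
    grind
  · simp only [resolve_solid, after_k]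
    split_ifs <;> rfl
  · rw [resolve_external, resolve_external, resolve_external, resolve_external, after_k, after_k,
      h10, h11]
    split_ifs <;> rfl

/-- STU expressions of legs at different internal vertices have the same value, since the two
resolutions commute. -/
lemma total_eq_of_ne (hS : StuAt ψ c) (hG : G.IsBCR) (hc : G.internals = c + 1) {L L' : Leg G}
    (h : L.w ≠ L'.w) : total ψ L = total ψ L' := by
  have step : ∀ L L' : Leg G, ∀ h : L.w ≠ L'.w, ψ L.fst =
      -(L'.weight • (ψ (L'.after L hG h).fst + ψ (L'.after L hG h).snd)) := fun L L' h => by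
    have h1 := L.internals_fst
    rw [← L'.after_weight L hG h]
    exact hS _ (L.isBCR_fst hG) (by omega) (L'.after L hG h)
  have key : ∀ L L' : Leg G, ∀ h : L.w ≠ L'.w, ∀ h' : L.flip.w ≠ L'.w, total ψ L =
      -((L.weight * L'.weight) •
        ((ψ (L'.after L hG h).fst + ψ (L'.after L hG h).snd) +
          (ψ (L'.after L.flip hG h').fst + ψ (L'.after L.flip hG h').snd))) := fun L L' h h' => by
    have e2 : ψ L.snd = _ := step L.flip L' h'
    unfold total
    rw [step L L' h, e2, ← neg_add, ← smul_add, smul_neg, smul_smul]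
  have hf : L.flip.w ≠ L'.w := h
  have hf' : L'.flip.w ≠ L.w := h.symm
  rw [key L L' h hf, key L' L h.symm hf', mul_comm]
  congr 2
  have e1 := L.after_fst_comm L' hG h
  have e2 : (L'.after L.flip hG hf).fst = (L.after L' hG h.symm).snd :=
    L.flip.after_fst_comm L' hG hf
  have e3 : (L'.after L hG h).snd = (L.after L'.flip hG hf').fst :=
    L.after_fst_comm L'.flip hG hf'.symm
  have e4 : (L'.after L.flip hG hf).snd = (L.after L'.flip hG hf').snd :=
    L.flip.after_fst_comm L'.flip hG hf'.symm
  rw [e1, e2, e3, e4]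
  abel

end Resolutions

/-! ### Edges between internal vertices -/

/-- An edge between two distinct internal vertices, given by its half-edge `f`, with the other
half-edges `o`, `a` at the vertex of `f` and `b`, `c` at the opposite vertex. -/
structure InternalEdge (G : Net n m) where
  /-- a half of the edge -/
  f : Fin m × Bool
  /-- a half-edge at the same vertex as `f` -/
  o : Fin m × Bool
  /-- the other half-edge at the same vertex as `f` -/
  a : Fin m × Bool
  /-- a half-edge at the opposite vertex -/
  b : Fin m × Bool
  /-- the other half-edge at the opposite vertex -/
  c : Fin m × Bool
  internal : G.external (G.ends f) = false
  internal_opp : G.external (G.ends (opp f)) = false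
  ends_ne : G.ends f ≠ G.ends (opp f)
  f_ne_o : f ≠ o
  f_ne_a : f ≠ a
  o_ne_a : o ≠ a
  opp_ne_b : opp f ≠ b
  opp_ne_c : opp f ≠ c
  b_ne_c : b ≠ c
  ends_iff : ∀ h, G.ends h = G.ends f ↔ h = f ∨ h = o ∨ h = a
  ends_opp_iff : ∀ h, G.ends h = G.ends (opp f) ↔ h = opp f ∨ h = b ∨ h = c

/-- A leg stays a leg when half-edges other than those of its own edge are permuted. -/
@[simps] def Leg.permute {G : Net n m} (L : Leg G) (π : Equiv.Perm (Fin m × Bool))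
    (hk : π L.k = L.k) (ho : π (opp L.k) = opp L.k) (hs : ∀ h, G.solid h.1 = true → π h = h) :
    Leg (G.permute π) :=
  have e : (G.permute π).solids (G.ends (opp L.k)) = G.solids (G.ends (opp L.k)) := by
    ext h
    simp only [mem_solids, permute_ends, permute_solid]
    constructor <;> rintro ⟨h1, h2⟩
    · exact ⟨by rwa [hs h h2] at h1, h2⟩
    · exact ⟨by rwa [hs h h2], h2⟩
  { k := L.k
    a := π.symm L.a
    b := π.symm L.b
    R := L.R
    external_opp := by
      rw [permute_ends, ho]
      exact L.external_opp
    internal := by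
      rw [permute_ends, hk]
      exact L.internal
    ne_a := fun h => L.ne_a (by rw [← hk, h, Equiv.apply_symm_apply])
    ne_b := fun h => L.ne_b (by rw [← hk, h, Equiv.apply_symm_apply])
    a_ne_b := fun h => L.a_ne_b (π.symm.injective h)
    ends_iff := fun h => by
      rw [permute_ends, permute_ends, hk, L.ends_iff, Equiv.eq_symm_apply, Equiv.eq_symm_apply]
      rw [show π h = L.k ↔ h = L.k from ⟨fun e => π.injective (e.trans hk.symm), fun e => e ▸ hk⟩]
    subset := by
      rw [permute_ends, ho, e]
      exact L.subset
    card := by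
      rw [permute_ends, ho, e]
      exact L.card }

lemma Leg.permute_weight {G : Net n m} (L : Leg G) (π : Equiv.Perm (Fin m × Bool))
    (hk : π L.k = L.k) (ho : π (opp L.k) = opp L.k) (hs : ∀ h, G.solid h.1 = true → π h = h) :
    (L.permute π hk ho hs).weight = L.weight := by
  unfold Leg.weight Leg.v
  have e : (G.permute π).solids (G.ends (opp L.k)) = G.solids (G.ends (opp L.k)) := by
    ext h
    simp only [mem_solids, permute_ends, permute_solid]
    constructor <;> rintro ⟨h1, h2⟩
    · exact ⟨by rwa [hs h h2] at h1, h2⟩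
    · exact ⟨by rwa [hs h h2], h2⟩
  rw [permute_k, permute_ends, ho, e]

lemma Leg.permute_fst {G : Net n m} (L : Leg G) (π : Equiv.Perm (Fin m × Bool))
    (hk : π L.k = L.k) (ho : π (opp L.k) = opp L.k) (hs : ∀ h, G.solid h.1 = true → π h = h)
    (ha : π L.a = L.a) : (L.permute π hk ho hs).fst = L.fst.permute π := by
  have ha' : π.symm L.a = L.a := by rw [Equiv.symm_apply_eq, ha]
  ext x
  · simp only [resolve_ends, permute_ends, permute_k, permute_a, permute_R, hk, ho, ha']
    have h1 : x = L.a ↔ π x = L.a :=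
      ⟨fun e => e ▸ ha, fun e => π.injective (e.trans ha.symm)⟩
    have h2 : x ∈ L.R ↔ π x ∈ L.R := by
      constructor
      · intro h
        rwa [hs x (of_mem_R h).2]
      · intro h
        have := hs _ (of_mem_R h).2
        rw [π.injective this] at h
        exact h
    simp only [h1, h2]
  · rfl
  · simp only [resolve_external, permute_ends, permute_k, permute_external, hk]

namespace InternalEdge

variable {G : Net n m} (E : InternalEdge G)

lemma ends_o : G.ends E.o = G.ends E.f := (E.ends_iff _).2 (by simp)

lemma ends_a : G.ends E.a = G.ends E.f := (E.ends_iff _).2 (by simp)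

lemma ends_b : G.ends E.b = G.ends (opp E.f) := (E.ends_opp_iff _).2 (by simp)

lemma ends_c : G.ends E.c = G.ends (opp E.f) := (E.ends_opp_iff _).2 (by simp)

/-- Exchange of `b` and `c`. -/
@[simps] def swapBC : InternalEdge G where
  __ := E
  b := E.c
  c := E.b
  opp_ne_b := E.opp_ne_c
  opp_ne_c := E.opp_ne_b
  b_ne_c := E.b_ne_c.symm
  ends_opp_iff h := by rw [E.ends_opp_iff, or_comm (a := h = E.b)]

/-- Exchange of `o` and `a`. -/
@[simps] def swapOA : InternalEdge G where
  __ := E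
  o := E.a
  a := E.o
  f_ne_o := E.f_ne_a
  f_ne_a := E.f_ne_o
  o_ne_a := E.o_ne_a.symm
  ends_iff h := by rw [E.ends_iff, or_comm (a := h = E.o)]

/-- The same edge, given by its other half-edge. -/
@[simps] def reverse : InternalEdge G where
  f := opp E.f
  o := E.b
  a := E.c
  b := E.o
  c := E.a
  internal := E.internal_opp
  internal_opp := by rw [opp_opp]; exact E.internal
  ends_ne := by rw [opp_opp]; exact E.ends_ne.symm
  f_ne_o := E.opp_ne_b
  f_ne_a := E.opp_ne_c
  o_ne_a := E.b_ne_c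
  opp_ne_b := by rw [opp_opp]; exact E.f_ne_o
  opp_ne_c := by rw [opp_opp]; exact E.f_ne_a
  b_ne_c := E.o_ne_a
  ends_iff := E.ends_opp_iff
  ends_opp_iff := by rw [opp_opp]; exact E.ends_iff

lemma a_ne_b : E.a ≠ E.b := fun h => E.ends_ne (by rw [← E.ends_a, ← E.ends_b, h])

lemma a_ne_c : E.a ≠ E.c := E.swapBC.a_ne_b

lemma o_ne_b : E.o ≠ E.b := E.swapOA.a_ne_b

lemma o_ne_c : E.o ≠ E.c := E.swapBC.o_ne_b

lemma f_ne_b : E.f ≠ E.b := fun h => E.ends_ne (by rw [← E.ends_b, h])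

lemma f_ne_c : E.f ≠ E.c := E.swapBC.f_ne_b

lemma opp_f_ne_a : opp E.f ≠ E.a := fun h => E.ends_ne (by rw [← E.ends_a, h])

lemma opp_f_ne_o : opp E.f ≠ E.o := E.swapOA.opp_f_ne_a

lemma swap_of_solid (hG : G.IsBCR) {h : Fin m × Bool} (hh : G.solid h.1 = true) :
    Equiv.swap E.a E.b h = h := by
  apply Equiv.swap_apply_of_ne_of_ne <;> rintro rfl
  · rw [hG.solid_eq_false (E.ends_a ▸ E.internal)] at hh
    cases hh
  · rw [hG.solid_eq_false (E.ends_b ▸ E.internal_opp)] at hh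
    cases hh

lemma isBCR_swap (hG : G.IsBCR) : (G.permute (Equiv.swap E.a E.b)).IsBCR := by
  refine hG.permute (fun h hh => E.swap_of_solid hG hh) ?_
  have e1 : Equiv.swap E.a E.b E.f = E.f := Equiv.swap_apply_of_ne_of_ne E.f_ne_a E.f_ne_b
  have e2 : Equiv.swap E.a E.b (opp E.f) = opp E.f :=
    Equiv.swap_apply_of_ne_of_ne E.opp_f_ne_a E.opp_ne_b
  have h := (G.permute (Equiv.swap E.a E.b)).joined_opp E.f
  rw [permute_ends, permute_ends, e1, e2] at h
  refine connected_of_joined_ends hG.connected fun k => ?_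
  rw [permute_ends, Equiv.swap_apply_def]
  split_ifs with h1 h2
  · rw [h1, E.ends_a, E.ends_b]
    exact h
  · rw [h2, E.ends_a, E.ends_b]
    exact h.symm
  · exact SimpleGraph.Reachable.refl _

/-- The edge of the second graph of an IHX relation. -/
@[simps] def swapAB : InternalEdge (G.permute (Equiv.swap E.a E.b)) :=
  have e1 : Equiv.swap E.a E.b E.f = E.f := Equiv.swap_apply_of_ne_of_ne E.f_ne_a E.f_ne_b
  have e2 : Equiv.swap E.a E.b (opp E.f) = opp E.f :=
    Equiv.swap_apply_of_ne_of_ne E.opp_f_ne_a E.opp_ne_b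
  { f := E.f
    o := E.o
    a := E.b
    b := E.a
    c := E.c
    internal := by rw [permute_ends, e1]; exact E.internal
    internal_opp := by rw [permute_ends, e2]; exact E.internal_opp
    ends_ne := by rw [permute_ends, permute_ends, e1, e2]; exact E.ends_ne
    f_ne_o := E.f_ne_o
    f_ne_a := E.f_ne_b
    o_ne_a := E.o_ne_b
    opp_ne_b := E.opp_f_ne_a
    opp_ne_c := E.opp_ne_c
    b_ne_c := E.a_ne_c
    ends_iff := fun h => by
      rw [permute_ends, permute_ends, e1, E.ends_iff, Equiv.swap_apply_def]
      have h1 := E.f_ne_a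
      have h2 := E.f_ne_b
      have h3 := E.o_ne_a
      have h4 := E.o_ne_b
      grind
    ends_opp_iff := fun h => by
      rw [permute_ends, permute_ends, e2, E.ends_opp_iff, Equiv.swap_apply_def]
      have h1 := E.opp_f_ne_a
      have h2 := E.opp_ne_b
      have h3 := E.a_ne_c
      have h4 := E.b_ne_c
      grind }

/-- The edge of the third graph of an IHX relation. -/
@[simps!] def swapAC : InternalEdge (G.permute (Equiv.swap E.a E.c)) := E.swapBC.swapAB

/-- The distributions `ab|oc` and `oc|ab` of the four half-edges to the two vertices differ by an
exchange of the vertices and a reversal of the edge. -/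
lemma permute_eq_relabel : G.permute (Equiv.swap E.a E.c) =
    (G.permute (Equiv.swap E.o E.b)).relabel (Equiv.swap (G.ends E.f) (G.ends (opp E.f))) 1
      (fun d => decide (d = E.f.1)) := by
  apply eq_relabel
  · intro h
    have h0 : renameHalfEdge 1 (fun d => decide (d = E.f.1)) h =
        if h.1 = E.f.1 then opp h else h := by
      rw [renameHalfEdge_apply]
      split_ifs with e <;> simp [e, opp]
    have h1 : h.1 = E.f.1 → h = E.f ∨ h = opp E.f := eq_or_eq_opp
    have h2 : opp (opp E.f) = E.f := opp_opp _
    have h3 := E.ends_iff h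
    have h4 := E.ends_opp_iff h
    have h5 : ∀ x : Fin m × Bool, x.1 = E.f.1 → x = E.f ∨ x = opp E.f := fun x => eq_or_eq_opp
    have a1 := E.ends_o
    have a2 := E.ends_a
    have a3 := E.ends_b
    have a4 := E.ends_c
    have a5 := E.ends_ne
    have a6 := E.f_ne_o
    have a7 := E.f_ne_a
    have a8 := E.o_ne_a
    have a9 := E.opp_ne_b
    have b1 := E.opp_ne_c
    have b2 := E.b_ne_c
    have b3 : (opp E.f).1 = E.f.1 := rfl
    rw [h0, permute_ends, permute_ends, Equiv.swap_apply_def, Equiv.swap_apply_def,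
      Equiv.swap_apply_def]
    clear h0
    grind
  · intro e
    rfl
  · intro v
    have h1 := E.internal
    have h2 := E.internal_opp
    rw [permute_external, permute_external, Equiv.swap_apply_def]
    grind

end InternalEdge

/-! ### The IHX relation for STU expressions -/

/-- Let `k` be the half-edge of a leg and `f` a half-edge at the same internal vertex. The edges of
`k` and `f` become solid and form, in this order, a part of a broken line, with `x`, `y`, `z`
attached at its three vertices. -/
def chain (G : Net n m) (k f : Fin m × Bool) (R : Finset (Fin m × Bool)) (x y z : Fin m × Bool) :
    Net n m where
  ends h := if h = x then G.ends (opp k) else if h = y then G.ends k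
    else if h = z then G.ends (opp f) else if h ∈ R then G.ends (opp f) else G.ends h
  solid e := if e = f.1 then true else if e = k.1 then true else G.solid e
  external v := if v = G.ends (opp f) then true else if v = G.ends k then true else G.external v

/-- As `chain`, but the edge of `f` precedes the edge of `k`; so `f` moves to the external vertex
of the leg. -/
def chain' (G : Net n m) (k f : Fin m × Bool) (R : Finset (Fin m × Bool)) (x y z : Fin m × Bool) :
    Net n m where
  ends h := if h = x then G.ends (opp f) else if h = y then G.ends (opp k)
    else if h = z then G.ends k else if h = f then G.ends (opp k) else if h ∈ R then G.ends k
    else if h ∈ G.solids (G.ends (opp k)) then G.ends (opp f) else G.ends h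
  solid e := if e = f.1 then true else if e = k.1 then true else G.solid e
  external v := if v = G.ends (opp f) then true else if v = G.ends k then true else G.external v

/-- A leg at a vertex of an edge between internal vertices, with normalized names of the
half-edges. -/
structure InternalEdge.IsAt {G : Net n m} (E : InternalEdge G) (L : Leg G) : Prop where
  k_eq : L.k = E.o
  a_eq : L.a = E.a
  b_eq : L.b = E.f

namespace InternalEdge

section IsAt

variable {G : Net n m} {E : InternalEdge G} {L : Leg G}

/-- After a leg is resolved with `f` at the new external vertex, `f` belongs to a leg. -/
@[simps] def legFst (h : E.IsAt L) (hG : G.IsBCR) : Leg L.fst :=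
  have hk := h.k_eq
  have ha := h.a_eq
  have hb := h.b_eq
  have ew : L.w = G.ends E.f := by rw [← E.ends_o, ← hk]
  have e1 : L.fst.ends E.f = L.w := by
    rw [← hb, resolve_ends, if_neg L.a_ne_b.symm, if_neg L.b_notMem_R, L.ends_b]
  have e2 : ∀ x, L.fst.ends x = G.ends (opp E.f) ↔ G.ends x = G.ends (opp E.f) := fun x => by
    have h1 := L.ends_a
    have h2 : x ∈ L.R → _ := Leg.of_mem_R
    have h3 : G.external L.v = true := L.external_opp
    have h4 := E.ends_ne
    have h5 := E.internal_opp
    rw [resolve_ends]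
    grind
  have e3 : L.fst.ends (opp E.f) = G.ends (opp E.f) := (e2 _).2 rfl
  { k := opp E.f
    a := E.b
    b := E.c
    R := L.R
    external_opp := by rw [opp_opp, e1, resolve_external, if_pos rfl]
    internal := by
      rw [e3, resolve_external, if_neg, E.internal_opp]
      exact fun h => E.ends_ne (ew.symm.trans h.symm)
    ne_a := E.opp_ne_b
    ne_b := E.opp_ne_c
    a_ne_b := E.b_ne_c
    ends_iff := fun x => by rw [e3, e2, E.ends_opp_iff]
    subset := by
      rw [opp_opp, e1, L.solids_fst_w hG]
      exact Finset.subset_insert _ _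
    card := by
      rw [opp_opp, e1, L.solids_fst_w hG, Finset.card_insert_of_notMem L.k_notMem_R]
      rfl }

/-- After a leg is resolved with `f` at the old external vertex, `f` belongs to a leg. -/
@[simps] def legSnd (h : E.IsAt L) (hG : G.IsBCR) : Leg L.snd :=
  have hk := h.k_eq
  have hb := h.b_eq
  have ew : L.w = G.ends E.f := by rw [← E.ends_o, ← hk]
  have e1 : L.snd.ends E.f = L.v := by rw [← hb, resolve_ends, if_pos rfl]
  have e2 : ∀ x, L.snd.ends x = G.ends (opp E.f) ↔ G.ends x = G.ends (opp E.f) := fun x => by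
    have h1 := L.ends_b
    have h2 : x ∈ L.R → _ := Leg.of_mem_R
    have h3 : G.external L.v = true := L.external_opp
    have h4 := E.ends_ne
    have h5 := E.internal_opp
    rw [resolve_ends]
    grind
  have e3 : L.snd.ends (opp E.f) = G.ends (opp E.f) := (e2 _).2 rfl
  have e4 : L.snd.solids L.v = insert (opp L.k) (G.solids L.v \ L.R) := L.flip.solids_fst_v hG
  { k := opp E.f
    a := E.b
    b := E.c
    R := G.solids L.v \ L.R
    external_opp := by
      rw [opp_opp, e1, resolve_external, if_neg L.v_ne_w]
      exact L.external_opp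
    internal := by
      rw [e3, resolve_external, if_neg, E.internal_opp]
      exact fun h => E.ends_ne (ew.symm.trans h.symm)
    ne_a := E.opp_ne_b
    ne_b := E.opp_ne_c
    a_ne_b := E.b_ne_c
    ends_iff := fun x => by rw [e3, e2, E.ends_opp_iff]
    subset := by
      rw [opp_opp, e1, e4]
      exact Finset.subset_insert _ _
    card := by
      have h1 : opp L.k ∉ G.solids L.v \ L.R := fun h => by
        have := (mem_solids.1 (Finset.mem_sdiff.1 h).1).2
        rw [opp_fst, L.solid_k hG] at this
        cases this
      rw [opp_opp, e1, e4, Finset.card_insert_of_notMem h1]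
      rfl }

lemma legFst_weight (h : E.IsAt L) (hG : G.IsBCR) : (legFst h hG).weight = 1 := by
  have e1 : L.fst.ends E.f = L.w := by
    rw [← h.b_eq, resolve_ends, if_neg L.a_ne_b.symm, if_neg L.b_notMem_R, L.ends_b]
  unfold Leg.weight Leg.v
  rw [legFst_k, opp_opp, e1, L.solids_fst_w hG, if_neg (Finset.insert_ne_empty _ _)]

lemma legSnd_weight (h : E.IsAt L) (hG : G.IsBCR) : (legSnd h hG).weight = 1 := by
  have e1 : L.snd.ends E.f = L.v := by rw [← h.b_eq, resolve_ends, if_pos rfl]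
  have e4 : L.snd.solids L.v = insert (opp L.k) (G.solids L.v \ L.R) := L.flip.solids_fst_v hG
  unfold Leg.weight
  have e5 : (legSnd h hG).v = L.v := by
    unfold Leg.v
    rw [legSnd_k, opp_opp, e1]
  rw [e5, e4, if_neg (Finset.insert_ne_empty _ _)]

lemma legFst_fst (h : E.IsAt L) (hG : G.IsBCR) :
    (legFst h hG).fst = G.chain E.o E.f L.R E.a E.b E.c := by
  have hk := h.k_eq
  have ha := h.a_eq
  have hb := h.b_eq
  have e1 : L.fst.ends E.f = L.w := by
    rw [← hb, resolve_ends, if_neg L.a_ne_b.symm, if_neg L.b_notMem_R, L.ends_b]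
  have e3 : L.fst.ends (opp E.f) = G.ends (opp E.f) := by
    have h1 := L.ends_a
    have h2 : opp E.f ∈ L.R → _ := Leg.of_mem_R
    have h3 : G.external L.v = true := L.external_opp
    have h4 := E.ends_ne
    have h5 := E.internal_opp
    have h6 := E.ends_a
    rw [resolve_ends]
    grind
  refine Net.ext (funext fun x => ?_) (funext fun x => ?_) (funext fun x => ?_)
  · change (L.fst.resolve (opp E.f) E.b L.R).ends x = _
    rw [resolve_ends, opp_opp, e1, e3, resolve_ends]
    unfold chain
    dsimp only
    have h1 := L.a_notMem_R
    have h2 := E.ends_c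
    have h3 := E.a_ne_b
    have h4 := L.b_notMem_R
    have h5 : E.b ∉ L.R := fun hh => by
      have h6 := (Leg.of_mem_R hh).2
      rw [hG.solid_eq_false (E.ends_b ▸ E.internal_opp)] at h6
      cases h6
    rw [← hk, ← ha]
    rw [← ha] at h3
    have h6 : E.c ∉ L.R := fun hh => by
      have h6 := (Leg.of_mem_R hh).2
      rw [hG.solid_eq_false (E.ends_c ▸ E.internal_opp)] at h6
      cases h6
    grind
  · simp only [resolve_solid, legFst_k, chain, opp_fst, hk]
  · change (L.fst.resolve (opp E.f) E.b L.R).external x = _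
    rw [resolve_external, e3, resolve_external, hk]
    rfl

lemma legSnd_fst (h : E.IsAt L) (hG : G.IsBCR) :
    (legSnd h hG).fst = G.chain' E.o E.f L.R E.c E.b E.a := by
  have hk := h.k_eq
  have ha := h.a_eq
  have hb := h.b_eq
  have e1 : L.snd.ends E.f = L.v := by rw [← hb, resolve_ends, if_pos rfl]
  have e3 : L.snd.ends (opp E.f) = G.ends (opp E.f) := by
    have h1 := L.ends_b
    have h2 : opp E.f ∈ L.R → _ := Leg.of_mem_R
    have h3 : G.external L.v = true := L.external_opp
    have h4 := E.ends_ne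
    have h5 := E.internal_opp
    rw [resolve_ends]
    grind
  refine Net.ext (funext fun x => ?_) (funext fun x => ?_) (funext fun x => ?_)
  · change (L.snd.resolve (opp E.f) E.b (G.solids L.v \ L.R)).ends x = _
    rw [resolve_ends, opp_opp, e1, e3, resolve_ends]
    unfold chain'
    dsimp only
    have h2 := E.ends_c
    have h3 := E.a_ne_b
    have g1 := E.f_ne_a
    have g2 := E.f_ne_b
    have g3 := E.f_ne_c
    have g4 := E.a_ne_c
    have g5 := E.b_ne_c
    have g6 := L.ends_a
    have hs : ∀ y, (y = E.a ∨ y = E.b ∨ y = E.c ∨ y = E.f) → y ∉ G.solids L.v := fun y hy hh => by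
      have h6 := (mem_solids.1 hh).2
      have h7 : G.external (G.ends y) = false := by
        rcases hy with rfl | rfl | rfl | rfl
        · rw [E.ends_a, E.internal]
        · rw [E.ends_b, E.internal_opp]
        · rw [E.ends_c, E.internal_opp]
        · exact E.internal
      rw [hG.solid_eq_false h7] at h6
      cases h6
    have hR : x ∈ L.R → x ∈ G.solids L.v := fun h => L.subset h
    have q1 := hs x
    simp only [Finset.mem_sdiff]
    rw [← hk, ← hb, ← ha]
    rw [← ha] at h3 g1 g4 q1
    rw [← hb] at g1 g2 g3 q1
    clear hs
    grind
  · simp only [resolve_solid, legSnd_k, chain', opp_fst, hk]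
  · change (L.snd.resolve (opp E.f) E.b (G.solids L.v \ L.R)).external x = _
    rw [resolve_external, e3, resolve_external, hk]
    rfl

end IsAt

end InternalEdge

/-- The two ways to resolve the edges of `k` and `f` differ by a cyclic permutation of the three
vertices and a transposition of the two edges, one of which is reversed. -/
lemma chain'_eq_relabel {G : Net n m} (hG : G.IsBCR) (E : InternalEdge G) {L : Leg G}
    (hk : L.k = E.o) {x y z : Fin m × Bool}
    (h : ∀ t, t = E.a ∨ t = E.b ∨ t = E.c ↔ t = x ∨ t = y ∨ t = z) :
    G.chain' E.o E.f L.R x y z = (G.chain E.o E.f L.R x y z).relabel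
      (Equiv.swap L.v L.w * Equiv.swap L.v (G.ends (opp E.f))) (Equiv.swap E.o.1 E.f.1)
      (fun d => if d = E.o.1 then xor E.o.2 E.f.2 else if d = E.f.1 then !(xor E.o.2 E.f.2)
        else false) := by
  have ew : L.w = G.ends E.f := by rw [← E.ends_o, ← hk]
  have hvw := L.v_ne_w
  have hwq : L.w ≠ G.ends (opp E.f) := ew ▸ E.ends_ne
  have hvq : L.v ≠ G.ends (opp E.f) := fun e => by
    have h3 : G.external L.v = true := L.external_opp
    rw [e, E.internal_opp] at h3
    cases h3
  have hko : opp L.k = opp E.o := by rw [hk]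
  set q := G.ends (opp E.f) with hq
  set σ := Equiv.swap L.v L.w * Equiv.swap L.v q with hσ
  have σv : σ L.v = q := by
    rw [hσ, Equiv.Perm.mul_apply, Equiv.swap_apply_left,
      Equiv.swap_apply_of_ne_of_ne hvq.symm hwq.symm]
  have σw : σ L.w = L.v := by
    rw [hσ, Equiv.Perm.mul_apply, Equiv.swap_apply_of_ne_of_ne hvw.symm hwq,
      Equiv.swap_apply_right]
  have σq : σ q = L.w := by
    rw [hσ, Equiv.Perm.mul_apply, Equiv.swap_apply_right, Equiv.swap_apply_left]
  have σu : ∀ u, u ≠ L.v → u ≠ L.w → u ≠ q → σ u = u := fun u h1 h2 h3 => by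
    rw [hσ, Equiv.Perm.mul_apply, Equiv.swap_apply_of_ne_of_ne h1 h3,
      Equiv.swap_apply_of_ne_of_ne h1 h2]
  have hof : E.o.1 ≠ E.f.1 := fun e => by
    rcases eq_or_eq_opp e with e | e
    · exact E.f_ne_o e.symm
    · exact E.opp_f_ne_o e.symm
  have hx : ∀ t, t = x ∨ t = y ∨ t = z → t ≠ E.o ∧ t ≠ opp E.o ∧ t ≠ E.f ∧ t ≠ opp E.f := by
    intro t ht
    rw [← h] at ht
    have h2 : ∀ s, s = E.a ∨ s = E.b ∨ s = E.c → s ≠ opp L.k := by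
      rintro s hs rfl
      have h3 := L.external_opp
      rcases hs with hs | hs | hs <;> rw [hs] at h3
      · rw [E.ends_a, E.internal] at h3
        cases h3
      · rw [E.ends_b, E.internal_opp] at h3
        cases h3
      · rw [E.ends_c, E.internal_opp] at h3
        cases h3
    rw [← hko]
    refine ⟨?_, h2 t ht, ?_, ?_⟩
    · rcases ht with rfl | rfl | rfl
      · exact E.o_ne_a.symm
      · exact E.o_ne_b.symm
      · exact E.o_ne_c.symm
    · rcases ht with rfl | rfl | rfl
      · exact E.f_ne_a.symm
      · exact E.f_ne_b.symm
      · exact E.f_ne_c.symm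
    · rcases ht with rfl | rfl | rfl
      · exact E.opp_f_ne_a.symm
      · exact E.opp_ne_b.symm
      · exact E.opp_ne_c.symm
  have hsolid : ∀ t, t ∈ G.solids L.v → t.1 ≠ E.o.1 ∧ t.1 ≠ E.f.1 := by
    intro t ht
    have h1 := (mem_solids.1 ht).2
    constructor <;> intro e <;> rw [e] at h1
    · rw [← hk, L.solid_k hG] at h1
      cases h1
    · rw [hG.solid_eq_false E.internal] at h1
      cases h1
  have hR : ∀ t, t ∈ L.R → t ∈ G.solids L.v := fun t ht => L.subset ht
  have hx' : ∀ t, G.ends t = L.w ∨ G.ends t = q →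
      t = E.o ∨ t = E.f ∨ t = opp E.f ∨ t = x ∨ t = y ∨ t = z := fun t ht => by
    have h1 := E.ends_iff t
    have h2 := E.ends_opp_iff t
    rw [← ew] at h1
    rw [← hq] at h2
    rcases ht with ht | ht
    · rcases h1.1 ht with e | e | e
      · exact Or.inr (Or.inl e)
      · exact Or.inl e
      · exact Or.inr (Or.inr (Or.inr ((h t).1 (Or.inl e))))
    · rcases h2.1 ht with e | e
      · exact Or.inr (Or.inr (Or.inl e))
      · exact Or.inr (Or.inr (Or.inr ((h t).1 (Or.inr e))))
  have hv : ∀ t, G.ends t = L.v → t = opp E.o ∨ t ∈ G.solids L.v := fun t ht => by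
    rw [← hko]
    rcases e : G.solid t.1 with _ | _
    · exact Or.inl (L.eq_opp_k hG ht e)
    · exact Or.inr (mem_solids.2 ⟨ht, e⟩)
  have spec : ∀ t : Fin m × Bool, t.1 = E.o.1 ∨ t.1 = E.f.1 →
      t ≠ x ∧ t ≠ y ∧ t ≠ z ∧ t ∉ L.R ∧ t ∉ G.solids L.v := fun t ht => by
    have h0 : t = E.o ∨ t = opp E.o ∨ t = E.f ∨ t = opp E.f := by
      rcases ht with ht | ht <;> rcases eq_or_eq_opp ht with rfl | rfl <;> simp
    have h1 : ∀ s, s = x ∨ s = y ∨ s = z → t ≠ s := fun s hs e => by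
      obtain ⟨a1, a2, a3, a4⟩ := hx s hs
      rw [← e] at a1 a2 a3 a4
      rcases h0 with h0 | h0 | h0 | h0
      exacts [a1 h0, a2 h0, a3 h0, a4 h0]
    have h2 : t ∉ G.solids L.v := fun hs => by
      rcases ht with ht | ht
      exacts [(hsolid t hs).1 ht, (hsolid t hs).2 ht]
    exact ⟨h1 x (by simp), h1 y (by simp), h1 z (by simp), fun hs => h2 (hR t hs), h2⟩
  have eo : G.ends E.o = L.w := by rw [ew, E.ends_o]
  have eoo : G.ends (opp E.o) = L.v := by rw [← hko]
  have ef : G.ends E.f = L.w := ew.symm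
  have c1 : ∀ t : Fin m × Bool, t.1 = E.o.1 ∨ t.1 = E.f.1 →
      (G.chain E.o E.f L.R x y z).ends t = G.ends t := fun t ht => by
    obtain ⟨h1, h2, h3, h4, h5⟩ := spec t ht
    simp only [chain, if_neg h1, if_neg h2, if_neg h3, if_neg h4]
  have c2 : ∀ t : Fin m × Bool, t.1 = E.o.1 ∨ t.1 = E.f.1 →
      (G.chain' E.o E.f L.R x y z).ends t = if t = E.f then L.v else G.ends t := fun t ht => by
    obtain ⟨h1, h2, h3, h4, h5⟩ := spec t ht
    simp only [chain', if_neg h1, if_neg h2, if_neg h3, if_neg h4, eoo, if_neg h5]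
  set ε : Fin m → Bool := fun d => if d = E.o.1 then xor E.o.2 E.f.2 else if d = E.f.1
    then !(xor E.o.2 E.f.2) else false with hε
  have r1 : renameHalfEdge (Equiv.swap E.o.1 E.f.1) ε E.o = E.f := by
    rw [renameHalfEdge_apply]
    simp [hε]
  have r2 : renameHalfEdge (Equiv.swap E.o.1 E.f.1) ε E.f = opp E.o := by
    rw [renameHalfEdge_apply]
    simp only [hε, Equiv.swap_apply_right, if_neg hof.symm, if_pos, opp]
    generalize E.f.2 = s
    generalize E.o.2 = s'
    cases s <;> cases s' <;> rfl
  apply eq_relabel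
  · intro t
    by_cases t1 : t.1 = E.o.1
    · rcases eq_or_eq_opp t1 with rfl | rfl
      · rw [r1, c2 _ (Or.inr rfl), if_pos rfl, c1 _ (Or.inl rfl), eo, σw]
      · rw [renameHalfEdge_opp, r1, c2 (opp E.f) (Or.inr rfl), if_neg (opp_ne _),
          c1 (opp E.o) (Or.inl rfl), eoo, σv]
    by_cases t2 : t.1 = E.f.1
    · rcases eq_or_eq_opp t2 with rfl | rfl
      · rw [r2, c2 (opp E.o) (Or.inl rfl),
          if_neg (show opp E.o ≠ E.f from fun e => hof (congrArg (fun t => t.1) e)),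
          c1 E.f (Or.inr rfl), eoo, ef, σw]
      · rw [renameHalfEdge_opp, r2, opp_opp, c2 E.o (Or.inl rfl), if_neg E.f_ne_o.symm,
          c1 (opp E.f) (Or.inr rfl), eo, ← hq, σq]
    have r3 : renameHalfEdge (Equiv.swap E.o.1 E.f.1) ε t = t := by
      rw [renameHalfEdge_apply, Equiv.swap_apply_of_ne_of_ne t1 t2]
      simp [hε, t1, t2]
    have t11 : t ≠ E.f := fun e => t2 (by rw [e])
    rw [r3]
    simp only [chain, chain', ← hq, eo, eoo]
    by_cases hx1 : t = x
    · rw [if_pos hx1, if_pos hx1, σv]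
    rw [if_neg hx1, if_neg hx1]
    by_cases hy1 : t = y
    · rw [if_pos hy1, if_pos hy1, σw]
    rw [if_neg hy1, if_neg hy1]
    by_cases hz1 : t = z
    · rw [if_pos hz1, if_pos hz1, σq]
    rw [if_neg hz1, if_neg hz1, if_neg t11]
    by_cases hR1 : t ∈ L.R
    · rw [if_pos hR1, if_pos hR1, σq]
    rw [if_neg hR1, if_neg hR1]
    by_cases hs1 : t ∈ G.solids L.v
    · rw [if_pos hs1, (mem_solids.1 hs1).1, σv]
    rw [if_neg hs1, σu]
    · intro e
      rcases hv t e with e | e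
      · exact t1 (by rw [e]; rfl)
      · exact hs1 e
    · intro e
      rcases hx' t (Or.inl e) with e | e | e | e | e | e
      exacts [t1 (by rw [e]), t11 e, t2 (by rw [e]; rfl), hx1 e, hy1 e, hz1 e]
    · intro e
      rcases hx' t (Or.inr e) with e | e | e | e | e | e
      exacts [t1 (by rw [e]), t11 e, t2 (by rw [e]; rfl), hx1 e, hy1 e, hz1 e]
  · intro d
    simp only [chain, chain']
    by_cases d1 : d = E.o.1
    · rw [d1, Equiv.swap_apply_left]
      simp
    by_cases d2 : d = E.f.1
    · rw [d2, Equiv.swap_apply_right]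
      simp
    · rw [Equiv.swap_apply_of_ne_of_ne d1 d2]
  · intro u
    have u2 : G.external L.v = true := L.external_opp
    simp only [chain, chain', ← hq, eo]
    by_cases d1 : u = L.v
    · rw [d1, σv, if_pos rfl, if_neg hvq, if_neg hvw, u2]
    by_cases d2 : u = L.w
    · rw [d2, σw, if_neg hvq, if_neg hvw, if_neg hwq, if_pos rfl, u2]
    by_cases d3 : u = q
    · rw [d3, σq, if_neg hwq, if_pos rfl, if_pos rfl]
    · rw [σu u d1 d2 d3]

section Extension

variable {M : Type*} [AddCommGroup M] [Module ℚ M]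
variable {ψ : Net n m → M} {p : Parity} {c : ℕ} {G : Net n m}

/-- The even permutation of the vertices does not contribute to the sign of `chain'_eq_relabel`, so
the two ways to resolve the edges of `k` and `f` have opposite values. -/
lemma apply_chain' (hO : OrientAt p ψ c) (hG : G.IsBCR) (E : InternalEdge G) {L : Leg G}
    (hk : L.k = E.o) {x y z : Fin m × Bool}
    (h : ∀ t, t = E.a ∨ t = E.b ∨ t = E.c ↔ t = x ∨ t = y ∨ t = z)
    (h1 : (G.chain E.o E.f L.R x y z).IsBCR) (h2 : (G.chain' E.o E.f L.R x y z).IsBCR)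
    (hc : (G.chain E.o E.f L.R x y z).internals = c) :
    ψ (G.chain' E.o E.f L.R x y z) = -ψ (G.chain E.o E.f L.R x y z) := by
  have hvq : L.v ≠ G.ends (opp E.f) := fun e => by
    have h3 : G.external L.v = true := L.external_opp
    rw [e, E.internal_opp] at h3
    cases h3
  have hof : E.o.1 ≠ E.f.1 := fun e => by
    rcases eq_or_eq_opp e with e | e
    · exact E.f_ne_o e.symm
    · exact E.opp_f_ne_o e.symm
  have e := chain'_eq_relabel hG E hk h
  rw [e] at h2 ⊢
  rw [hO _ _ _ _ h1 h2 hc, colorSign_swap_edges p _ hof]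
  · simp
  · rw [Equiv.Perm.sign_mul, Equiv.Perm.sign_swap L.v_ne_w, Equiv.Perm.sign_swap hvq]
    rfl

/-- The sum of the three graphs of an IHX relation. -/
def ihxSum (φ : Net n m → M) (E : InternalEdge G) : M :=
  φ G + φ (G.permute (Equiv.swap E.a E.b)) + φ (G.permute (Equiv.swap E.a E.c))

/-- The function `ψ` respects the IHX relations between graphs with `c` internal vertices. -/
def IhxAt (ψ : Net n m → M) (c : ℕ) : Prop :=
  ∀ G : Net n m, G.IsBCR → G.internals = c → ∀ E : InternalEdge G, ihxSum ψ E = 0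

open Classical in
/-- The value of the STU expressions of the legs with the half-edge `k`. -/
noncomputable def edgeTotal (ψ : Net n m → M) (k : Fin m × Bool) (G : Net n m) : M :=
  if h : ∃ L : Leg G, L.k = k then total ψ h.choose else 0

lemma edgeTotal_eq (hO : OrientAt p ψ c) (hG : G.IsBCR) (hc : G.internals = c + 1) (L : Leg G) :
    edgeTotal ψ L.k G = total ψ L := by
  have h : ∃ L' : Leg G, L'.k = L.k := ⟨L, rfl⟩
  rw [edgeTotal, dif_pos h]
  exact total_congr hO hG hc h.choose_spec

lemma edgeTotal_relabel (hO : OrientAt p ψ c) (hG : G.IsBCR) (hc : G.internals = c + 1)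
    (L : Leg G) {σ : Equiv.Perm (Fin n)} {τ : Equiv.Perm (Fin m)} {ε : Fin m → Bool}
    (hH : (G.relabel σ τ ε).IsBCR) :
    edgeTotal ψ (renameHalfEdge τ ε L.k) (G.relabel σ τ ε) =
      ((colorSign p σ τ ε : ℤ) : ℚ) • edgeTotal ψ L.k G := by
  rw [edgeTotal_eq hO hG hc, ← total_relabel hO L hG hH hc]
  exact edgeTotal_eq hO hH (relabel_internals.trans hc) (L.relabel σ τ ε)

lemma chain_permute {k f : Fin m × Bool} {R : Finset (Fin m × Bool)} {x y z s t : Fin m × Bool}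
    (hs : s = x ∨ s = y ∨ s = z) (ht : t = x ∨ t = y ∨ t = z)
    (h : ∀ r, r = s ∨ r = t → r ≠ k ∧ r ≠ opp k ∧ r ≠ opp f) :
    (G.permute (Equiv.swap s t)).chain k f R x y z = G.chain k f R x y z := by
  have h1 := h s (Or.inl rfl)
  have h2 := h t (Or.inr rfl)
  have e1 : Equiv.swap s t k = k := Equiv.swap_apply_of_ne_of_ne h1.1.symm h2.1.symm
  have e2 : Equiv.swap s t (opp k) = opp k :=
    Equiv.swap_apply_of_ne_of_ne h1.2.1.symm h2.2.1.symm
  have e3 : Equiv.swap s t (opp f) = opp f :=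
    Equiv.swap_apply_of_ne_of_ne h1.2.2.symm h2.2.2.symm
  refine Net.ext (funext fun r => ?_) rfl (funext fun u => ?_)
  · simp only [chain, permute_ends, e1, e2, e3]
    by_cases r1 : r = x
    · rw [if_pos r1, if_pos r1]
    by_cases r2 : r = y
    · rw [if_neg r1, if_neg r1, if_pos r2, if_pos r2]
    by_cases r3 : r = z
    · rw [if_neg r1, if_neg r1, if_neg r2, if_neg r2, if_pos r3, if_pos r3]
    rw [Equiv.swap_apply_of_ne_of_ne]
    · rintro rfl
      rcases hs with e | e | e
      exacts [r1 e, r2 e, r3 e]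
    · rintro rfl
      rcases ht with e | e | e
      exacts [r1 e, r2 e, r3 e]
  · simp only [chain, permute_ends, permute_external, e1, e3]

lemma chain'_permute {k f : Fin m × Bool} {R : Finset (Fin m × Bool)} {x y z s t : Fin m × Bool}
    (hs : s = x ∨ s = y ∨ s = z) (ht : t = x ∨ t = y ∨ t = z)
    (h : ∀ r, r = s ∨ r = t → r ≠ k ∧ r ≠ opp k ∧ r ≠ opp f) :
    (G.permute (Equiv.swap s t)).chain' k f R x y z = G.chain' k f R x y z := by
  have h1 := h s (Or.inl rfl)
  have h2 := h t (Or.inr rfl)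
  have e1 : Equiv.swap s t k = k := Equiv.swap_apply_of_ne_of_ne h1.1.symm h2.1.symm
  have e2 : Equiv.swap s t (opp k) = opp k :=
    Equiv.swap_apply_of_ne_of_ne h1.2.1.symm h2.2.1.symm
  have e3 : Equiv.swap s t (opp f) = opp f :=
    Equiv.swap_apply_of_ne_of_ne h1.2.2.symm h2.2.2.symm
  refine Net.ext (funext fun r => ?_) rfl (funext fun u => ?_)
  · simp only [chain', permute_ends, permute_solid, mem_solids, e1, e2, e3]
    by_cases r1 : r = x
    · rw [if_pos r1, if_pos r1]
    by_cases r2 : r = y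
    · rw [if_neg r1, if_neg r1, if_pos r2, if_pos r2]
    by_cases r3 : r = z
    · rw [if_neg r1, if_neg r1, if_neg r2, if_neg r2, if_pos r3, if_pos r3]
    have e4 : Equiv.swap s t r = r := by
      apply Equiv.swap_apply_of_ne_of_ne
      · rintro rfl
        rcases hs with e | e | e
        exacts [r1 e, r2 e, r3 e]
      · rintro rfl
        rcases ht with e | e | e
        exacts [r1 e, r2 e, r3 e]
    simp only [e4]
  · simp only [chain', permute_ends, permute_external, e1, e3]

namespace InternalEdge

variable {E : InternalEdge G} {L : Leg G}

lemma IsAt.swapBC (h : E.IsAt L) : E.swapBC.IsAt L := ⟨h.k_eq, h.a_eq, h.b_eq⟩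

lemma isBCR_chain (h : E.IsAt L) (hG : G.IsBCR) : (G.chain E.o E.f L.R E.a E.b E.c).IsBCR := by
  rw [← legFst_fst h hG]
  exact (legFst h hG).isBCR_fst (L.isBCR_fst hG)

lemma isBCR_chain' (h : E.IsAt L) (hG : G.IsBCR) : (G.chain' E.o E.f L.R E.c E.b E.a).IsBCR := by
  rw [← legSnd_fst h hG]
  exact (legSnd h hG).isBCR_fst (L.isBCR_snd hG)

lemma internals_chain (h : E.IsAt L) (hG : G.IsBCR) (hc : G.internals = c + 2)
    (x y z : Fin m × Bool) : (G.chain E.o E.f L.R x y z).internals = c := by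
  have h1 := (legFst h hG).internals_fst
  have h2 := L.internals_fst
  rw [legFst_fst h hG] at h1
  have h3 : (G.chain E.o E.f L.R E.a E.b E.c).internals =
    (G.chain E.o E.f L.R x y z).internals := rfl
  omega

/-- The two STU expressions of a leg that are obtained by resolving an edge at its vertex. -/
lemma total_of_isAt (hS : StuAt ψ (c + 1)) (h : E.IsAt L) (hG : G.IsBCR)
    (hc : G.internals = c + 2) : total ψ L = -(L.weight •
      ((ψ (G.chain E.o E.f L.R E.a E.b E.c) + ψ (G.chain E.o E.f L.R E.a E.c E.b)) +
      (ψ (G.chain' E.o E.f L.R E.c E.b E.a) + ψ (G.chain' E.o E.f L.R E.b E.c E.a)))) := by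
  have h1 := L.internals_fst
  have h2 := L.internals_snd
  have e1 : (legFst h hG).snd = G.chain E.o E.f L.R E.a E.c E.b := legFst_fst h.swapBC hG
  have e2 : (legSnd h hG).snd = G.chain' E.o E.f L.R E.b E.c E.a := legSnd_fst h.swapBC hG
  have e3 := hS _ (L.isBCR_fst hG) (by omega) (legFst h hG)
  have e4 := hS _ (L.isBCR_snd hG) (by omega) (legSnd h hG)
  rw [total, legFst_weight, legFst_fst, e1, one_smul] at e3
  rw [total, legSnd_weight, legSnd_fst, e2, one_smul] at e4
  rw [total, e3, e4, ← neg_add, smul_neg]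

/-- A leg at the half-edge `o` is also a leg of the second graph of the IHX relation. -/
lemma exists_isAt_swapAB (h : E.IsAt L) (hG : G.IsBCR) :
    ∃ L' : Leg (G.permute (Equiv.swap E.a E.b)),
      E.swapAB.IsAt L' ∧ L'.R = L.R ∧ L'.weight = L.weight := by
  have hk : Equiv.swap E.a E.b L.k = L.k := by
    rw [h.k_eq, Equiv.swap_apply_of_ne_of_ne E.o_ne_a E.o_ne_b]
  have ho : Equiv.swap E.a E.b (opp L.k) = opp L.k := by
    have h1 := L.external_opp
    apply Equiv.swap_apply_of_ne_of_ne <;> intro e <;> rw [e] at h1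
    · rw [E.ends_a, E.internal] at h1
      cases h1
    · rw [E.ends_b, E.internal_opp] at h1
      cases h1
  refine ⟨L.permute _ hk ho fun _ => E.swap_of_solid hG, ⟨h.k_eq, ?_, ?_⟩, rfl,
    L.permute_weight _ hk ho fun _ => E.swap_of_solid hG⟩
  · rw [Leg.permute_a, h.a_eq, Equiv.symm_swap, Equiv.swap_apply_left]
    rfl
  · rw [Leg.permute_b, h.b_eq, Equiv.symm_swap,
      Equiv.swap_apply_of_ne_of_ne E.f_ne_a E.f_ne_b]
    rfl

lemma ne_of_isAt (h : E.IsAt L) (r : Fin m × Bool) (hr : r = E.a ∨ r = E.b ∨ r = E.c) :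
    r ≠ E.o ∧ r ≠ opp E.o ∧ r ≠ opp E.f := by
  have h1 := L.external_opp
  rw [h.k_eq] at h1
  refine ⟨?_, fun e => ?_, ?_⟩
  · rcases hr with rfl | rfl | rfl
    exacts [E.o_ne_a.symm, E.o_ne_b.symm, E.o_ne_c.symm]
  · rw [← e] at h1
    rcases hr with rfl | rfl | rfl
    · rw [E.ends_a, E.internal] at h1
      cases h1
    · rw [E.ends_b, E.internal_opp] at h1
      cases h1
    · rw [E.ends_c, E.internal_opp] at h1
      cases h1
  · rcases hr with rfl | rfl | rfl
    exacts [E.opp_f_ne_a.symm, E.opp_ne_b.symm, E.opp_ne_c.symm]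

/-- The twelve-term cancellation: resolving the three STU expressions of an IHX relation once more
gives each of the six orders of `a, b, c` along the broken line twice, with opposite signs. -/
lemma ihxSum_of_isAt (hO : OrientAt p ψ (c + 1)) (hO' : OrientAt p ψ c)
    (hS : StuAt ψ (c + 1)) (hG : G.IsBCR) (hc : G.internals = c + 2)
    (h : E.IsAt L) : ihxSum (edgeTotal ψ L.k) E = 0 := by
  obtain ⟨L₂, h₂, hR₂, hw₂⟩ := exists_isAt_swapAB h hG
  obtain ⟨L₃, h₃, hR₃, hw₃⟩ : ∃ L' : Leg (G.permute (Equiv.swap E.a E.c)),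
      E.swapAC.IsAt L' ∧ L'.R = L.R ∧ L'.weight = L.weight :=
    exists_isAt_swapAB h.swapBC hG
  have hG₂ := E.isBCR_swap hG
  have hG₃ : (G.permute (Equiv.swap E.a E.c)).IsBCR := E.swapBC.isBCR_swap hG
  have k₂ : L.k = L₂.k := h.k_eq.trans h₂.k_eq.symm
  have k₃ : L.k = L₃.k := h.k_eq.trans h₃.k_eq.symm
  have t₁ := total_of_isAt hS h hG hc
  have t₂ := total_of_isAt hS h₂ hG₂ hc
  have t₃ := total_of_isAt hS h₃ hG₃ hc
  have c₂ : ∀ x y z, (∀ t, t = E.a ∨ t = E.b ∨ t = E.c ↔ t = x ∨ t = y ∨ t = z) →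
      (G.permute (Equiv.swap E.a E.b)).chain E.o E.f L.R x y z = G.chain E.o E.f L.R x y z ∧
      (G.permute (Equiv.swap E.a E.b)).chain' E.o E.f L.R x y z = G.chain' E.o E.f L.R x y z :=
    fun x y z ht => ⟨chain_permute ((ht _).1 (by simp)) ((ht _).1 (by simp)) fun r hr =>
      ne_of_isAt h r (by tauto),
      chain'_permute ((ht _).1 (by simp)) ((ht _).1 (by simp)) fun r hr =>
        ne_of_isAt h r (by tauto)⟩
  have c₃ : ∀ x y z, (∀ t, t = E.a ∨ t = E.b ∨ t = E.c ↔ t = x ∨ t = y ∨ t = z) →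
      (G.permute (Equiv.swap E.a E.c)).chain E.o E.f L.R x y z = G.chain E.o E.f L.R x y z ∧
      (G.permute (Equiv.swap E.a E.c)).chain' E.o E.f L.R x y z = G.chain' E.o E.f L.R x y z :=
    fun x y z ht => ⟨chain_permute ((ht _).1 (by simp)) ((ht _).1 (by simp)) fun r hr =>
      ne_of_isAt h r (by tauto),
      chain'_permute ((ht _).1 (by simp)) ((ht _).1 (by simp)) fun r hr =>
        ne_of_isAt h r (by tauto)⟩
  have b₁ := isBCR_chain h hG
  have b₁' := isBCR_chain' h hG
  have d₁ := isBCR_chain h.swapBC hG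
  have d₁' := isBCR_chain' h.swapBC hG
  have b₂ := isBCR_chain h₂ hG₂
  have b₂' := isBCR_chain' h₂ hG₂
  have d₂ := isBCR_chain h₂.swapBC hG₂
  have d₂' := isBCR_chain' h₂.swapBC hG₂
  have b₃ := isBCR_chain h₃ hG₃
  have b₃' := isBCR_chain' h₃ hG₃
  have d₃ := isBCR_chain h₃.swapBC hG₃
  have d₃' := isBCR_chain' h₃.swapBC hG₃
  simp only [swapAC_a, swapAC_b, swapAC_c, swapAC_f, swapAC_o, swapAB_a, swapAB_b, swapAB_c,
    swapAB_f, swapAB_o, swapBC_a, swapBC_b, swapBC_c,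
    swapBC_f, swapBC_o, hR₂, hR₃, hw₂, hw₃] at *
  have p₂ : ∀ t, t = E.a ∨ t = E.b ∨ t = E.c ↔ t = E.a ∨ t = E.c ∨ t = E.b := by tauto
  have p₃ : ∀ t, t = E.a ∨ t = E.b ∨ t = E.c ↔ t = E.b ∨ t = E.a ∨ t = E.c := by tauto
  have p₄ : ∀ t, t = E.a ∨ t = E.b ∨ t = E.c ↔ t = E.b ∨ t = E.c ∨ t = E.a := by tauto
  have p₅ : ∀ t, t = E.a ∨ t = E.b ∨ t = E.c ↔ t = E.c ∨ t = E.a ∨ t = E.b := by tauto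
  have p₆ : ∀ t, t = E.a ∨ t = E.b ∨ t = E.c ↔ t = E.c ∨ t = E.b ∨ t = E.a := by tauto
  simp only [c₂ _ _ _ p₂, c₂ _ _ _ p₃, c₂ _ _ _ p₄, c₂ _ _ _ p₅, c₃ _ _ _ (fun _ => Iff.rfl),
    c₃ _ _ _ p₃, c₃ _ _ _ p₅, c₃ _ _ _ p₆] at *
  have i := internals_chain h hG hc
  have s₁ := apply_chain' hO' hG E h.k_eq (fun _ => Iff.rfl) b₁ d₃' (i _ _ _)
  have s₂ := apply_chain' hO' hG E h.k_eq p₂ d₁ d₂' (i _ _ _)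
  have s₃ := apply_chain' hO' hG E h.k_eq p₃ b₂ b₃' (i _ _ _)
  have s₄ := apply_chain' hO' hG E h.k_eq p₄ d₂ d₁' (i _ _ _)
  have s₅ := apply_chain' hO' hG E h.k_eq p₅ b₃ b₂' (i _ _ _)
  have s₆ := apply_chain' hO' hG E h.k_eq p₆ d₃ b₁' (i _ _ _)
  have u₁ := edgeTotal_eq hO hG hc L
  have u₂ := edgeTotal_eq hO hG₂ hc L₂
  have u₃ := edgeTotal_eq hO hG₃ hc L₃
  rw [← k₂] at u₂
  rw [← k₃] at u₃
  rw [ihxSum, u₁, u₂, u₃, t₁, t₂, t₃, s₁, s₂, s₃, s₄, s₅, s₆, ← neg_add, ← neg_add, ← smul_add,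
    ← smul_add]
  convert neg_zero
  convert smul_zero _
  abel

lemma ihxSum_o (hO : OrientAt p ψ (c + 1)) (hO' : OrientAt p ψ c)
    (hS : StuAt ψ (c + 1)) (hG : G.IsBCR) (hc : G.internals = c + 2) (hk : L.k = E.o) :
    ihxSum (edgeTotal ψ L.k) E = 0 := by
  have hw : L.w = G.ends E.f := by rw [← E.ends_o, ← hk]
  have h1 := E.ends_iff L.a
  have h2 := E.ends_iff L.b
  rw [← hw, ← hk] at h1 h2
  have h3 := (h1.1 L.ends_a)
  have h4 := (h2.1 L.ends_b)
  have h5 := L.ne_a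
  have h6 := L.ne_b
  have h7 := L.a_ne_b
  by_cases ha : L.a = E.a
  · exact ihxSum_of_isAt hO hO' hS hG hc (L := L) ⟨hk, ha, by grind⟩
  · exact ihxSum_of_isAt hO hO' hS hG hc (L := L.flip)
      ⟨hk, by change L.b = _; grind, by change L.a = _; grind⟩

/-- At a leg with half-edge `a` or `c`, exchanging `a` and `c` has the same effect as exchanging `o`
and `b`. -/
lemma edgeTotal_exchange (hO : OrientAt p ψ (c + 1)) (hG : G.IsBCR) (hc : G.internals = c + 2)
    (hk : L.k = E.a ∨ L.k = E.c) : edgeTotal ψ L.k (G.permute (Equiv.swap E.a E.c)) =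
      edgeTotal ψ L.k (G.permute (Equiv.swap E.o E.b)) := by
  have hB : (G.permute (Equiv.swap E.a E.c)).IsBCR := E.swapBC.isBCR_swap hG
  have hB' : (G.permute (Equiv.swap E.o E.b)).IsBCR := E.swapOA.isBCR_swap hG
  have h1 := L.external_opp
  have ho : Equiv.swap E.o E.b (opp L.k) = opp L.k := by
    apply Equiv.swap_apply_of_ne_of_ne <;> intro e <;> rw [e] at h1
    · rw [E.ends_o, E.internal] at h1
      cases h1
    · rw [E.ends_b, E.internal_opp] at h1
      cases h1
  have hk' : Equiv.swap E.o E.b L.k = L.k := by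
    apply Equiv.swap_apply_of_ne_of_ne <;> rcases hk with hk | hk <;> rw [hk]
    exacts [E.o_ne_a.symm, E.o_ne_c.symm, E.a_ne_b, E.b_ne_c.symm]
  have hf : L.k.1 ≠ E.f.1 := fun e => by
    rcases eq_or_eq_opp e with e | e <;> rcases hk with hk | hk <;> rw [hk] at e
    exacts [E.f_ne_a e.symm, E.f_ne_c e.symm, E.opp_f_ne_a e.symm, E.opp_ne_c e.symm]
  have hr : renameHalfEdge 1 (fun d => decide (d = E.f.1)) L.k = L.k := by
    simp [renameHalfEdge_apply, hf]
  have hs : ∀ h, G.solid h.1 = true → Equiv.swap E.o E.b h = h :=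
    fun _ => E.swapOA.swap_of_solid hG
  have h2 := E.permute_eq_relabel
  have h3 := edgeTotal_relabel hO hB' hc
    (L.permute (Equiv.swap E.o E.b) hk' ho hs) (h2 ▸ hB)
  rw [Leg.permute_k, hr, ← h2, colorSign_swap p E.ends_ne] at h3
  simpa using h3

lemma fst_ends_iff (E : InternalEdge G) (L : Leg G) (h1 : L.w ≠ G.ends E.f) (x : Fin m × Bool) :
    L.fst.ends x = G.ends E.f ↔ G.ends x = G.ends E.f := by
  have h2 : x ∈ L.R → _ := Leg.of_mem_R
  have h3 : G.external L.v = true := L.external_opp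
  have h4 := E.internal
  have h5 := L.ends_a
  rw [resolve_ends]
  grind

/-- An edge between internal vertices remains one when a leg at another vertex is resolved. -/
@[simps] def after (E : InternalEdge G) (L : Leg G) (h1 : L.w ≠ G.ends E.f)
    (h2 : L.w ≠ G.ends (opp E.f)) : InternalEdge L.fst :=
  have e1 : L.fst.ends E.f = G.ends E.f := (E.fst_ends_iff L h1 _).2 rfl
  have e2 : L.fst.ends (opp E.f) = G.ends (opp E.f) := (E.reverse.fst_ends_iff L h2 _).2 rfl
  { f := E.f
    o := E.o
    a := E.a
    b := E.b
    c := E.c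
    internal := by rw [e1, resolve_external, if_neg h1.symm, E.internal]
    internal_opp := by rw [e2, resolve_external, if_neg h2.symm, E.internal_opp]
    ends_ne := by rw [e1, e2]; exact E.ends_ne
    f_ne_o := E.f_ne_o
    f_ne_a := E.f_ne_a
    o_ne_a := E.o_ne_a
    opp_ne_b := E.opp_ne_b
    opp_ne_c := E.opp_ne_c
    b_ne_c := E.b_ne_c
    ends_iff := fun x => by rw [e1, E.fst_ends_iff L h1, E.ends_iff]
    ends_opp_iff := fun x => by
      rw [e2]
      exact (E.reverse.fst_ends_iff L h2 x).trans (E.ends_opp_iff x) }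

lemma edgeTotal_swap (hO : OrientAt p ψ (c + 1)) (hG : G.IsBCR) (hc : G.internals = c + 2)
    (E : InternalEdge G) (L : Leg G) (h1 : L.w ≠ G.ends E.f) (h2 : L.w ≠ G.ends (opp E.f)) :
    edgeTotal ψ L.k (G.permute (Equiv.swap E.a E.b)) =
      L.weight • (ψ (L.fst.permute (Equiv.swap E.a E.b)) +
        ψ (L.snd.permute (Equiv.swap E.a E.b))) := by
  have key : ∀ t, G.ends t = L.w ∨ G.ends t = L.v → Equiv.swap E.a E.b t = t := fun t ht => by
    have h3 : G.external L.v = true := L.external_opp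
    apply Equiv.swap_apply_of_ne_of_ne <;> rintro rfl <;> rcases ht with ht | ht
    · exact h1 (ht.symm.trans E.ends_a)
    · rw [← ht, E.ends_a, E.internal] at h3
      cases h3
    · exact h2 (ht.symm.trans E.ends_b)
    · rw [← ht, E.ends_b, E.internal_opp] at h3
      cases h3
  have hk := key L.k (Or.inl rfl)
  have ho := key (opp L.k) (Or.inr rfl)
  have hs : ∀ h, G.solid h.1 = true → Equiv.swap E.a E.b h = h := fun _ => E.swap_of_solid hG
  have e1 := L.permute_fst _ hk ho hs (key L.a (Or.inl L.ends_a))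
  have e2 : (L.permute _ hk ho hs).snd = L.snd.permute _ :=
    L.flip.permute_fst _ hk ho hs (key L.b (Or.inl L.ends_b))
  rw [← e1, ← e2, ← L.permute_weight _ hk ho hs]
  exact edgeTotal_eq hO (E.isBCR_swap hG) hc (L.permute _ hk ho hs)

end InternalEdge

/-- The IHX relation for the values of STU expressions at a fixed leg. -/
lemma ihxSum_edgeTotal (hO : OrientAt p ψ (c + 1)) (hO' : OrientAt p ψ c)
    (hS : StuAt ψ (c + 1)) (hI : IhxAt ψ (c + 1)) (hG : G.IsBCR) (hc : G.internals = c + 2)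
    (E : InternalEdge G) (L : Leg G) : ihxSum (edgeTotal ψ L.k) E = 0 := by
  by_cases h1 : L.w = G.ends E.f
  · rcases (E.ends_iff _).1 h1 with hk | hk | hk
    · -- The edge of a leg ends at an external vertex.
      have h2 := L.external_opp
      rw [hk, E.internal_opp] at h2
      cases h2
    · exact E.ihxSum_o hO hO' hS hG hc hk
    · have h2 := E.swapOA.ihxSum_o hO hO' hS hG hc hk
      have h3 := InternalEdge.edgeTotal_exchange (E := E) hO hG hc (Or.inl hk)
      have h4 := InternalEdge.edgeTotal_exchange (E := E.swapBC) hO hG hc (Or.inl hk)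
      simp only [ihxSum, InternalEdge.swapOA_a, InternalEdge.swapOA_b, InternalEdge.swapOA_c,
        InternalEdge.swapBC_a, InternalEdge.swapBC_b, InternalEdge.swapBC_c,
        InternalEdge.swapBC_o] at h2 h3 h4 ⊢
      rw [h3, h4, ← h2]
      abel
  by_cases h2 : L.w = G.ends (opp E.f)
  · rcases (E.ends_opp_iff _).1 h2 with hk | hk | hk
    · have h2 := L.external_opp
      rw [hk, opp_opp, E.internal] at h2
      cases h2
    · have h2 := E.reverse.ihxSum_o hO hO' hS hG hc hk
      have h4 := InternalEdge.edgeTotal_exchange (E := E.swapBC) hO hG hc (Or.inr hk)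
      simp only [ihxSum, InternalEdge.reverse_a, InternalEdge.reverse_b, InternalEdge.reverse_c,
        InternalEdge.swapBC_a, InternalEdge.swapBC_b, InternalEdge.swapBC_c,
        InternalEdge.swapBC_o] at h2 h4 ⊢
      rw [h4, ← h2, Equiv.swap_comm E.c E.o, Equiv.swap_comm E.c E.a]
    · have h2 := E.reverse.swapOA.ihxSum_o hO hO' hS hG hc hk
      have h3 := InternalEdge.edgeTotal_exchange (E := E) hO hG hc (Or.inr hk)
      simp only [ihxSum, InternalEdge.reverse_b, InternalEdge.reverse_c,
        InternalEdge.swapOA_a, InternalEdge.swapOA_b, InternalEdge.swapOA_c,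
        InternalEdge.reverse_o] at h2 h3 ⊢
      rw [h3, ← h2, Equiv.swap_comm E.b E.o, Equiv.swap_comm E.b E.a]
      abel
  · have i1 := L.internals_fst
    have i2 := L.internals_snd
    have e1 := hI _ (L.isBCR_fst hG) (by omega) (E.after L h1 h2)
    have e2 := hI _ (L.isBCR_snd hG) (by omega) (E.after L.flip h1 h2)
    have e3 := E.edgeTotal_swap hO hG hc L h1 h2
    have e4 := E.swapBC.edgeTotal_swap hO hG hc L h1 h2
    simp only [ihxSum, InternalEdge.after_a, InternalEdge.after_b, InternalEdge.after_c,
      InternalEdge.swapBC_a, InternalEdge.swapBC_b] at e1 e2 e4 ⊢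
    rw [e3, e4, edgeTotal_eq hO hG hc L, total, ← smul_add, ← smul_add]
    convert smul_zero L.weight
    have e2' : ψ L.snd + ψ (L.snd.permute (Equiv.swap E.a E.b)) +
      ψ (L.snd.permute (Equiv.swap E.a E.c)) = 0 := e2
    rw [← add_zero (0 : M)]
    nth_rewrite 1 [← e1]
    rw [← e2']
    abel

/-! ### Two legs at the only internal vertex with legs -/

lemma exists_leg (hG : G.IsBCR) {k : Fin m × Bool} (hk : G.external (G.ends k) = false)
    (ho : G.external (G.ends (opp k)) = true) : ∃ L : Leg G, L.k = k := by
  obtain ⟨a, b, h1, h2, h3, h4⟩ := hG.exists_halfEdges hk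
  obtain ⟨R, hR, hc⟩ := Finset.exists_subset_card_eq
    (Nat.sub_le (G.solids (G.ends (opp k))).card 1)
  exact ⟨⟨k, a, b, R, ho, hk, h1, h2, h3, h4, hR, hc⟩, rfl⟩

/-- The half-edges at the internal vertex of the leg `L` are `L.k`, `o` and `opp f`. Here `o`
belongs to a second leg, whereas the edge of `f` leads to another internal vertex, and no other
internal vertex is joined to an external one. -/
structure Stuck (L : Leg G) (o f : Fin m × Bool) : Prop where
  ends_iff : ∀ h, G.ends h = L.w ↔ h = L.k ∨ h = o ∨ h = opp f
  k_ne_o : L.k ≠ o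
  k_ne_f : L.k ≠ opp f
  o_ne_f : o ≠ opp f
  external_opp : G.external (G.ends (opp o)) = true
  internal : G.external (G.ends f) = false
  ends_ne : G.ends f ≠ L.w
  internal_opp : ∀ h, G.external (G.ends h) = false → G.ends h ≠ L.w →
    G.external (G.ends (opp h)) = false

/-- The half-edge `L.k` is moved along the edge of `f` to the vertex of `f`, and `f` to the
vertex of `L.k`. -/
abbrev bypass (L : Leg G) (f : Fin m × Bool) : Net n m := G.permute (Equiv.swap L.k f)

/-- The graph in which the internal vertex `L.w`, with `o` and `opp f`, is inserted into the edge of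
the half-edge `h` of `bypass L f`, next to `h`. For `h = L.k` this is the graph `G`. -/
abbrev slide (L : Leg G) (f h : Fin m × Bool) : Net n m := (bypass L f).permute (Equiv.swap h f)

namespace Stuck

variable {L : Leg G} {o f : Fin m × Bool}

lemma bypass_k : (bypass L f).ends L.k = G.ends f := by
  rw [permute_ends, Equiv.swap_apply_left]

lemma bypass_f : (bypass L f).ends f = L.w := by
  rw [permute_ends, Equiv.swap_apply_right]

lemma bypass_of_ne {t : Fin m × Bool} (h1 : t ≠ L.k) (h2 : t ≠ f) :
    (bypass L f).ends t = G.ends t := by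
  rw [permute_ends, Equiv.swap_apply_of_ne_of_ne h1 h2]

lemma slide_k : slide L f L.k = G := by
  refine Net.ext (funext fun t => ?_) rfl rfl
  rw [permute_ends, permute_ends, Equiv.swap_apply_self]

lemma slide_f {h : Fin m × Bool} : (slide L f h).ends f = (bypass L f).ends h := by
  rw [permute_ends, Equiv.swap_apply_right]

lemma slide_of_ne {h t : Fin m × Bool} (h1 : t ≠ h) (h2 : t ≠ f) :
    (slide L f h).ends t = (bypass L f).ends t := by
  rw [permute_ends, Equiv.swap_apply_of_ne_of_ne h1 h2]

lemma opp_k_ne {h : Fin m × Bool} (hx : G.external (G.ends h) = false) : h ≠ opp L.k :=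
  fun e => by
    have := L.external_opp
    rw [← e, hx] at this
    cases this

lemma ne_f {h : Fin m × Bool} (hw : (bypass L f).ends h ≠ L.w) : h ≠ f := fun e =>
  hw (by rw [e, bypass_f])

lemma slide_self {h : Fin m × Bool} : (slide L f h).ends h = L.w := by
  rw [permute_ends, Equiv.swap_apply_left, bypass_f]

variable (S : Stuck L o f)
include S

lemma f_ne_k : f ≠ L.k := fun e => S.ends_ne (by rw [e])

lemma f_ne_o : f ≠ o := fun e => S.ends_ne ((S.ends_iff _).2 (by simp [e]))

lemma bypass_iff (t : Fin m × Bool) :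
    (bypass L f).ends t = L.w ↔ t = f ∨ t = o ∨ t = opp f := by
  have h1 := S.f_ne_k
  have h2 := S.k_ne_o
  have h3 := S.k_ne_f
  have h4 := S.f_ne_o
  have h5 := (opp_ne f).symm
  rw [permute_ends, S.ends_iff, Equiv.swap_apply_def]
  grind

lemma ne_opp_f {h : Fin m × Bool} (hw : (bypass L f).ends h ≠ L.w) : h ≠ opp f := fun e =>
  hw ((S.bypass_iff h).2 (by simp [e]))

lemma ne_o {h : Fin m × Bool} (hw : (bypass L f).ends h ≠ L.w) : h ≠ o := fun e =>
  hw ((S.bypass_iff h).2 (by simp [e]))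

lemma slide_opp_f {h : Fin m × Bool} (hw : (bypass L f).ends h ≠ L.w) :
    (slide L f h).ends (opp f) = L.w := by
  rw [slide_of_ne (S.ne_opp_f hw).symm (opp_ne f), S.bypass_iff]
  simp

lemma opp_k_ne_bypass {h : Fin m × Bool} (hx : G.external ((bypass L f).ends h) = false) :
    h ≠ opp L.k := fun e => by
  have h1 := L.external_opp
  have h2 : opp L.k ≠ f := (opp_k_ne (L := L) S.internal).symm
  rw [e, bypass_of_ne (opp_ne _) h2, h1] at hx
  cases hx

lemma opp_opp_ne {h : Fin m × Bool} (hx : G.external (G.ends h) = false)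
    (hw : G.ends h ≠ L.w) : opp h ≠ L.k ∧ opp h ≠ o ∧ opp h ≠ f := by
  refine ⟨fun e => opp_k_ne (L := L) hx (by rw [← e, opp_opp]), fun e => ?_, fun e => hw ?_⟩
  · have := S.external_opp
    rw [← e, opp_opp, hx] at this
    cases this
  · exact (S.ends_iff _).2 (Or.inr (Or.inr (by rw [← e, opp_opp])))

/-- Every vertex of the part that hangs at the edge of `f` is joined to `f` within this part. -/
lemma joined_f (hG : G.IsBCR) {h : Fin m × Bool}
    (hx : G.external ((bypass L f).ends h) = false) (hw : (bypass L f).ends h ≠ L.w) :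
    (slide L f h).Joined ((bypass L f).ends h) (G.ends f) := by
  have hxw : (slide L f h).Joined L.w ((bypass L f).ends h) := by
    have := (slide L f h).joined_opp (opp f)
    rwa [S.slide_opp_f hw, opp_opp, slide_f] at this
  have hj : ∀ t, t ≠ f → (slide L f h).Joined ((bypass L f).ends t) ((slide L f h).ends t) :=
    fun t ht => by
      by_cases e : t = h
      · rw [e, slide_self]
        exact hxw.symm
      · rw [slide_of_ne e ht]
  by_contra hcon
  obtain ⟨k, ⟨⟨h1, h2⟩, h3⟩, h4⟩ := exists_crossing hG.connected
    (X := {y | (G.external y = false ∧ y ≠ L.w) ∧ (slide L f h).Joined ((bypass L f).ends h) y})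
    (x := (bypass L f).ends h) (y := L.w) ⟨⟨hx, hw⟩, SimpleGraph.Reachable.refl _⟩
    (fun h => h.1.2 rfl)
  have hk : k ≠ f := fun e => hcon (e ▸ h3)
  obtain ⟨g1, g2, g3⟩ := S.opp_opp_ne h1 h2
  have hkw : G.ends (opp k) ≠ L.w := fun e => by
    rcases (S.ends_iff _).1 e with e | e | e
    · exact g1 e
    · exact g2 e
    · exact hk (by rw [← opp_opp k, e, opp_opp])
  refine h4 ⟨⟨S.internal_opp k h1 h2, hkw⟩, h3.trans ?_⟩
  have hk' : k ≠ L.k := fun e => h2 (by rw [e])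
  rw [← bypass_of_ne hk' hk, ← bypass_of_ne g1 g3]
  exact ((hj k hk).trans ((slide L f h).joined_opp k)).trans (hj (opp k) g3).symm

lemma isBCR_slide (hG : G.IsBCR) {h : Fin m × Bool}
    (hx : G.external ((bypass L f).ends h) = false) (hw : (bypass L f).ends h ≠ L.w) :
    (slide L f h).IsBCR := by
  have hxw : (slide L f h).Joined L.w ((bypass L f).ends h) := by
    have := (slide L f h).joined_opp (opp f)
    rwa [S.slide_opp_f hw, opp_opp, slide_f] at this
  have hJ := S.joined_f hG hx hw
  refine IsBCR.permute (π := Equiv.swap L.k f * Equiv.swap h f) hG (fun t ht => ?_) ?_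
  · have hs : ∀ s, G.external (G.ends s) = false → t ≠ s := fun s hs e => by
      rw [e, hG.solid_eq_false hs] at ht
      cases ht
    have h1 := hs L.k L.internal
    have h2 := hs f S.internal
    have h3 : t ≠ h := fun e => by
      rw [← e, bypass_of_ne h1 h2] at hx
      exact hs t hx rfl
    rw [Equiv.Perm.mul_apply, Equiv.swap_apply_of_ne_of_ne h3 h2,
      Equiv.swap_apply_of_ne_of_ne h1 h2]
  · refine connected_of_joined_ends (G' := slide L f h) hG.connected fun t => ?_
    by_cases e2 : t = f
    · rw [e2, slide_f]
      exact hJ.symm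
    by_cases e1 : t = h
    · rw [e1, slide_self]
      by_cases e3 : h = L.k
      · rw [e3]
      · have h4 := ne_f hw
        rw [← bypass_of_ne e3 h4]
        exact hxw.symm
    · rw [slide_of_ne e1 e2]
      by_cases e3 : t = L.k
      · rw [e3, bypass_k]
        exact hxw.trans hJ
      · rw [bypass_of_ne e3 e2]

lemma exists_leg_slide (hG : G.IsBCR) {h : Fin m × Bool}
    (hx : G.external ((bypass L f).ends h) = false) (hw : (bypass L f).ends h ≠ L.w) :
    ∃ L' : Leg (slide L f h), L'.k = L.k := by
  apply exists_leg (S.isBCR_slide hG hx hw)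
  · by_cases e : h = L.k
    · rw [e, slide_k]
      exact L.internal
    · rw [slide_of_ne (Ne.symm e) S.f_ne_k.symm, bypass_k]
      exact S.internal
  · have h1 := S.opp_k_ne_bypass hx
    have h2 := opp_k_ne (L := L) S.internal
    rw [slide_of_ne h1.symm h2.symm, bypass_of_ne (opp_ne _) h2.symm]
    exact L.external_opp

/-- At every internal vertex other than `L.w`, the three insertions next to its half-edges form
an IHX relation. -/
lemma exists_internalEdge (hG : G.IsBCR) {h : Fin m × Bool}
    (hx : G.external ((bypass L f).ends h) = false) (hw : (bypass L f).ends h ≠ L.w) :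
    ∃ E : InternalEdge (slide L f h), h ≠ E.b ∧ h ≠ E.c ∧ E.b ≠ E.c ∧
      (∀ t, (bypass L f).ends t = (bypass L f).ends h ↔ t = h ∨ t = E.b ∨ t = E.c) ∧
      (slide L f h).permute (Equiv.swap E.a E.b) = slide L f E.b ∧
      (slide L f h).permute (Equiv.swap E.a E.c) = slide L f E.c := by
  obtain ⟨a, b, h1, h2, h3, h4⟩ := hG.exists_halfEdges (k := Equiv.swap L.k f h) hx
  set b' := Equiv.swap L.k f a with hb'
  set c' := Equiv.swap L.k f b with hc'
  have hb : h ≠ b' := fun e => h1 (by rw [e, hb', Equiv.swap_apply_self])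
  have hc : h ≠ c' := fun e => h2 (by rw [e, hc', Equiv.swap_apply_self])
  have hbc : b' ≠ c' := fun e => h3 ((Equiv.swap L.k f).injective e)
  have key : ∀ t, (bypass L f).ends t = (bypass L f).ends h ↔ t = h ∨ t = b' ∨ t = c' := by
    intro t
    have e : ∀ s, Equiv.swap L.k f t = s ↔ t = Equiv.swap L.k f s := fun s =>
      ⟨fun e => by rw [← e, Equiv.swap_apply_self], fun e => by rw [e, Equiv.swap_apply_self]⟩
    rw [permute_ends, permute_ends, h4, e, e, e, Equiv.swap_apply_self]
  have hf := ne_f hw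
  have eb : (bypass L f).ends b' = (bypass L f).ends h := (key _).2 (by simp)
  have ec : (bypass L f).ends c' = (bypass L f).ends h := (key _).2 (by simp)
  have hwb := eb ▸ hw
  have hwc := ec ▸ hw
  have hfb := ne_f hwb
  have hfc := ne_f hwc
  have e1 := S.slide_opp_f hw
  have hff := opp_ne f
  have k1 := S.ne_opp_f hw
  have k2 := S.ne_o hw
  have k3 := S.ne_opp_f hwb
  have k4 := S.f_ne_o
  have k5 := S.ne_o hwb
  have k6 := S.ne_o hwc
  have k7 := S.ne_opp_f hwc
  have swap_eq : ∀ y, y = b' ∨ y = c' →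
      (slide L f h).permute (Equiv.swap h y) = slide L f y := fun y hy => by
    have hyh : (bypass L f).ends y = (bypass L f).ends h := by
      rcases hy with rfl | rfl
      exacts [eb, ec]
    have hyf : y ≠ f := by
      rcases hy with rfl | rfl
      exacts [hfb, hfc]
    have hyn : h ≠ y := by
      rcases hy with rfl | rfl
      exacts [hb, hc]
    refine Net.ext (funext fun t => ?_) rfl rfl
    rw [permute_ends]
    by_cases t1 : t = h
    · rw [t1, Equiv.swap_apply_left, slide_of_ne hyn.symm hyf, slide_of_ne hyn hf, hyh]
    by_cases t2 : t = y
    · rw [t2, Equiv.swap_apply_right, slide_self, slide_self]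
    rw [Equiv.swap_apply_of_ne_of_ne t1 t2]
    by_cases t3 : t = f
    · rw [t3, slide_f, slide_f, hyh]
    · rw [slide_of_ne t1 t3, slide_of_ne t2 t3]
  refine ⟨⟨opp f, o, h, b', c', ?_, ?_, ?_, S.o_ne_f.symm, k1.symm, k2.symm, ?_, ?_, hbc, ?_, ?_⟩,
    hb, hc, hbc, key, swap_eq _ (Or.inl rfl), swap_eq _ (Or.inr rfl)⟩
  · rw [e1]
    exact L.internal
  · rw [opp_opp, slide_f]
    exact hx
  · rw [opp_opp, slide_f, e1]
    exact hw.symm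
  · rw [opp_opp]
    exact hfb.symm
  · rw [opp_opp]
    exact hfc.symm
  · intro t
    rw [e1]
    by_cases t1 : t = h
    · rw [t1, slide_self]
      simp
    by_cases t2 : t = f
    · rw [t2, slide_f]
      exact iff_of_false hw (by grind)
    · rw [slide_of_ne t1 t2, S.bypass_iff]
      grind
  · intro t
    rw [opp_opp, slide_f]
    by_cases t1 : t = h
    · rw [t1, slide_self]
      exact iff_of_false hw.symm (by grind)
    by_cases t2 : t = f
    · rw [t2, slide_f]
      simp
    · rw [slide_of_ne t1 t2, key]
      grind

/-- The two insertions into the same edge differ by a transposition of two edges, one of which is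
reversed. -/
lemma slide_opp_eq_relabel (hG : G.IsBCR) {h : Fin m × Bool} (hx : G.external (G.ends h) = false)
    (hw : G.ends h ≠ L.w) (hf : h ≠ f) : slide L f (opp h) = (slide L f h).relabel 1
      (Equiv.swap f.1 h.1)
      (fun d => if d = f.1 then xor f.2 h.2 else if d = h.1 then !(xor f.2 h.2) else false) := by
  have hk : h ≠ L.k := fun e => hw (by rw [e])
  obtain ⟨g1, g2, g3⟩ := S.opp_opp_ne hx hw
  have hof : h ≠ opp f := fun e => g3 (by rw [e, opp_opp])
  have hfh : f.1 ≠ h.1 := fun e => by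
    rcases eq_or_eq_opp e with e | e
    · exact hf e.symm
    · exact g3 e.symm
  have eh := bypass_of_ne hk hf
  have eoh := bypass_of_ne g1 g3
  have hoh := opp_ne h
  have hof' : opp f ≠ opp h := fun e => hf (by rw [← opp_opp h, ← e, opp_opp])
  have hbf : (bypass L f).ends (opp f) = L.w := (S.bypass_iff _).2 (by simp)
  set ε : Fin m → Bool := fun d => if d = f.1 then xor f.2 h.2 else if d = h.1
    then !(xor f.2 h.2) else false with hε
  have r1 : renameHalfEdge (Equiv.swap f.1 h.1) ε f = h := by
    rw [renameHalfEdge_apply]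
    simp [hε]
  have r2 : renameHalfEdge (Equiv.swap f.1 h.1) ε h = opp f := by
    rw [renameHalfEdge_apply]
    simp only [hε, Equiv.swap_apply_right, if_neg hfh.symm, if_pos, opp]
    generalize f.2 = s
    generalize h.2 = s'
    cases s <;> cases s' <;> rfl
  apply eq_relabel
  · intro t
    rw [Equiv.Perm.one_apply]
    by_cases t1 : t.1 = f.1
    · rcases eq_or_eq_opp t1 with rfl | rfl
      · rw [r1, slide_of_ne hoh.symm hf, slide_f]
      · rw [renameHalfEdge_opp, r1, slide_self, slide_of_ne hof.symm (opp_ne f), hbf]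
    by_cases t2 : t.1 = h.1
    · rcases eq_or_eq_opp t2 with rfl | rfl
      · rw [r2, slide_of_ne hof' (opp_ne f), slide_self, hbf]
      · rw [renameHalfEdge_opp, r2, opp_opp, slide_f, slide_of_ne hoh g3]
    · have r3 : renameHalfEdge (Equiv.swap f.1 h.1) ε t = t := by
        rw [renameHalfEdge_apply, Equiv.swap_apply_of_ne_of_ne t1 t2]
        simp [hε, t1, t2]
      have t3 : t ≠ f := fun e => t1 (by rw [e])
      rw [r3, slide_of_ne (fun e => t2 (by rw [e, opp_fst])) t3,
        slide_of_ne (fun e => t2 (by rw [e])) t3]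
  · intro d
    change G.solid _ = G.solid _
    have s1 := hG.solid_eq_false S.internal
    have s2 := hG.solid_eq_false hx
    rw [Equiv.swap_apply_def]
    split_ifs with d1 d2
    · rw [d1, s1, s2]
    · rw [d2, s1, s2]
    · rfl
  · intro u
    rfl

/-- The STU expression at a stuck leg vanishes: sum the values of `slide L f h` at the leg `L.k`
over all half-edges `h` at the internal vertices other than `L.w`. The sum is zero by the IHX
relation at each vertex. On the other hand, the two halves of each edge cancel, except for
`L.k` itself, where `slide L f L.k = G`. -/
theorem total_eq_zero (hO : OrientAt p ψ (c + 1)) (hO' : OrientAt p ψ c)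
    (hS : StuAt ψ (c + 1)) (hI : IhxAt ψ (c + 1)) (hG : G.IsBCR) (hc : G.internals = c + 2) :
    total ψ L = 0 := by
  set T : Finset (Fin m × Bool) := Finset.univ.filter fun h =>
    G.external ((bypass L f).ends h) = false ∧ (bypass L f).ends h ≠ L.w with hT
  have hmem : ∀ h, h ∈ T ↔
      G.external ((bypass L f).ends h) = false ∧ (bypass L f).ends h ≠ L.w := fun h => by
    rw [hT, Finset.mem_filter, and_iff_right (Finset.mem_univ _)]
  set g : Fin m × Bool → M := fun h => edgeTotal ψ L.k (slide L f h) with hg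
  have hsum : ∑ h ∈ T, g h = 0 := by
    rw [← Finset.sum_fiberwise_of_maps_to (g := (bypass L f).ends) (t := Finset.univ)
      fun _ _ => Finset.mem_univ _]
    refine Finset.sum_eq_zero fun x _ => ?_
    rcases (T.filter fun h => (bypass L f).ends h = x).eq_empty_or_nonempty with he | ⟨h, hh⟩
    · rw [he, Finset.sum_empty]
    obtain ⟨hhT, rfl⟩ := Finset.mem_filter.1 hh
    obtain ⟨hx, hw⟩ := (hmem h).1 hhT
    obtain ⟨E, hab, hac, hbc, hE, e1, e2⟩ := S.exists_internalEdge hG hx hw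
    have hf : T.filter (fun t => (bypass L f).ends t = (bypass L f).ends h) =
        {h, E.b, E.c} := by
      ext t
      rw [Finset.mem_filter, hmem, hE, Finset.mem_insert, Finset.mem_insert, Finset.mem_singleton]
      refine ⟨fun ht => ht.2, fun ht => ⟨?_, ht⟩⟩
      rw [← hE] at ht
      rw [ht]
      exact ⟨hx, hw⟩
    obtain ⟨L', hL'⟩ := S.exists_leg_slide hG hx hw
    have h1 := ihxSum_edgeTotal hO hO' hS hI (S.isBCR_slide hG hx hw) hc E L'
    rw [ihxSum, e1, e2, hL'] at h1
    rw [hf, Finset.sum_insert (by simp [hab, hac]), Finset.sum_insert (by simpa using hbc),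
      Finset.sum_singleton, ← add_assoc]
    exact h1
  have hk : L.k ∈ T := by
    rw [hmem, bypass_k]
    exact ⟨S.internal, S.ends_ne⟩
  rw [← Finset.add_sum_erase _ _ hk] at hsum
  have hmem' : ∀ h, h ∈ T.erase L.k →
      h ≠ L.k ∧ h ≠ f ∧ G.external (G.ends h) = false ∧ G.ends h ≠ L.w := fun h hh => by
    obtain ⟨h1, h2⟩ := Finset.mem_erase.1 hh
    obtain ⟨hx, hw⟩ := (hmem h).1 h2
    have h3 := ne_f hw
    rw [bypass_of_ne h1 h3] at hx hw
    exact ⟨h1, h3, hx, hw⟩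
  have hzero : ∑ h ∈ T.erase L.k, g h = 0 := by
    refine Finset.sum_involution (fun h _ => opp h) (fun h hh => ?_) (fun h _ _ => opp_ne h)
      (fun h hh => ?_) (fun h _ => opp_opp h)
    · obtain ⟨h1, h2, hx, hw⟩ := hmem' h hh
      obtain ⟨hx', hw'⟩ := (hmem h).1 (Finset.mem_erase.1 hh).2
      obtain ⟨g1, g2, g3⟩ := S.opp_opp_ne hx hw
      have hfh : f.1 ≠ h.1 := fun e => by
        rcases eq_or_eq_opp e with e | e
        exacts [h2 e.symm, g3 e.symm]
      have hkf : L.k.1 ≠ f.1 := fun e => by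
        rcases eq_or_eq_opp e with e | e
        exacts [S.f_ne_k e.symm, S.k_ne_f e]
      have hkh : L.k.1 ≠ h.1 := fun e => by
        rcases eq_or_eq_opp e with e | e
        exacts [h1 e.symm, g1 e.symm]
      obtain ⟨L', hL'⟩ := S.exists_leg_slide hG hx' hw'
      have e := S.slide_opp_eq_relabel hG hx hw h2
      have hB : (slide L f (opp h)).IsBCR := by
        have ho : (bypass L f).ends (opp h) = G.ends (opp h) := bypass_of_ne g1 g3
        apply S.isBCR_slide hG <;> rw [ho]
        · exact S.internal_opp h hx hw
        · intro e
          rcases (S.ends_iff _).1 e with e | e | e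
          · exact g1 e
          · exact g2 e
          · exact h2 (by rw [← opp_opp h, e, opp_opp])
      have h3 := edgeTotal_relabel hO (S.isBCR_slide hG hx' hw') hc L' (e ▸ hB)
      have hr : renameHalfEdge (Equiv.swap f.1 h.1) (fun d => if d = f.1 then xor f.2 h.2
          else if d = h.1 then !(xor f.2 h.2) else false) L.k = L.k := by
        rw [renameHalfEdge_apply, Equiv.swap_apply_of_ne_of_ne hkf hkh]
        simp [hkf, hkh]
      rw [hL', hr, ← e, colorSign_swap_edges p (map_one _) hfh] at h3
      simp only [hg]
      rw [h3]
      simp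
    · obtain ⟨h1, h2, hx, hw⟩ := hmem' h hh
      obtain ⟨g1, g2, g3⟩ := S.opp_opp_ne hx hw
      rw [Finset.mem_erase, hmem, bypass_of_ne g1 g3]
      refine ⟨g1, S.internal_opp h hx hw, fun e => ?_⟩
      rcases (S.ends_iff _).1 e with e | e | e
      · exact g1 e
      · exact g2 e
      · exact h2 (by rw [← opp_opp h, e, opp_opp])
  rw [hzero, add_zero, hg] at hsum
  simp only [slide_k] at hsum
  rw [← edgeTotal_eq hO hG hc L, hsum]

end Stuck

/-! ### Independence of the leg -/

lemma internals_ne_zero {v : Fin n} (hv : G.external v = false) : G.internals ≠ 0 := by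
  unfold internals
  rw [Finset.card_ne_zero]
  exact ⟨v, by simpa using hv⟩

lemma exists_internal (h : G.internals ≠ 0) : ∃ v, G.external v = false := by
  unfold internals at h
  rw [Finset.card_ne_zero] at h
  obtain ⟨v, hv⟩ := h
  exact ⟨v, by simpa using hv⟩

/-- A BCR graph with an internal vertex has a leg, since it is connected. -/
lemma nonempty_leg (hG : G.IsBCR) (h : G.internals ≠ 0) : Nonempty (Leg G) := by
  obtain ⟨v, hv⟩ := exists_internal h
  obtain ⟨u, hu⟩ := hG.exists_external
  obtain ⟨k, h1, h2⟩ := exists_crossing hG.connected (X := {y | G.external y = false}) hv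
    (y := u) (by simpa using hu)
  obtain ⟨L, -⟩ := exists_leg hG h1 (by simpa using h2)
  exact ⟨L⟩

/-- If all legs of a graph with at least two internal vertices are at the same vertex, and there are
two of them, then the third edge at this vertex leads to the other internal vertices. -/
lemma exists_stuck (hG : G.IsBCR) (hc : G.internals = c + 2) {L L' : Leg G} (hw : L.w = L'.w)
    (hk : L.k ≠ L'.k) (h : ∀ K : Leg G, K.w = L.w) : ∃ f, Stuck L L'.k f := by
  wlog hb : L'.k = L.a generalizing L
  · have h1 := ((L.ends_iff L'.k).1 hw.symm).resolve_left hk.symm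
    obtain ⟨f, S⟩ := this (L := L.flip) hw hk h (h1.resolve_left hb)
    exact ⟨f, S.1, S.2, S.3, S.4, S.5, S.6, S.7, S.8⟩
  have hopp : ∀ t, G.external (G.ends t) = false → G.ends t ≠ L.w →
      G.external (G.ends (opp t)) = false := fun t h1 h2 => by
    by_contra h3
    obtain ⟨K, rfl⟩ := exists_leg hG h1 (by simpa using h3)
    exact h2 (h K)
  obtain ⟨x, hx, hxw⟩ : ∃ x, G.external x = false ∧ x ≠ L.w := by
    have h1 : 1 < (Finset.univ.filter fun v => G.external v = false).card := by
      change 1 < G.internals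
      omega
    obtain ⟨x, hx, hne⟩ := Finset.exists_mem_ne h1 L.w
    exact ⟨x, by simpa using hx, hne⟩
  obtain ⟨f, ⟨h1, h2⟩, h3⟩ := exists_crossing hG.connected
    (X := {y | G.external y = false ∧ y ≠ L.w}) ⟨hx, hxw⟩ (y := L.w) (fun h => h.2 rfl)
  have h4 : G.ends (opp f) = L.w := by
    by_contra h5
    exact h3 ⟨hopp f h1 h2, h5⟩
  have hf : opp f = L.b := by
    rcases (L.ends_iff _).1 h4 with e | e | e
    · have := L.external_opp
      rw [← e, opp_opp, h1] at this
      cases this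
    · have := L'.external_opp
      rw [hb, ← e, opp_opp, h1] at this
      cases this
    · exact e
  refine ⟨f, fun t => ?_, hk, ?_, ?_, L'.external_opp, h1, h2, hopp⟩
  · rw [hb, hf]
    exact L.ends_iff t
  · rw [hf]
    exact L.ne_b
  · rw [hf, hb]
    exact L.a_ne_b

/-- All STU expressions of a graph with at least two internal vertices have the same value. -/
lemma total_eq_total (hO : OrientAt p ψ (c + 1)) (hO' : OrientAt p ψ c)
    (hS : StuAt ψ (c + 1)) (hI : IhxAt ψ (c + 1)) (hG : G.IsBCR) (hc : G.internals = c + 2)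
    (L L' : Leg G) : total ψ L = total ψ L' := by
  by_cases hw : L.w = L'.w
  swap
  · exact total_eq_of_ne hS hG hc hw
  by_cases hk : L.k = L'.k
  · exact total_congr hO hG hc hk
  by_cases h : ∀ K : Leg G, K.w = L.w
  · obtain ⟨f, S⟩ := exists_stuck hG hc hw hk h
    obtain ⟨f', S'⟩ := exists_stuck hG hc hw.symm (Ne.symm hk) fun K => (h K).trans hw
    rw [S.total_eq_zero hO hO' hS hI hG hc, S'.total_eq_zero hO hO' hS hI hG hc]
  · push Not at h
    obtain ⟨K, hK⟩ := h
    rw [← total_eq_of_ne hS hG hc hK, total_eq_of_ne hS hG hc fun e => hK (e.trans hw.symm)]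

/-! ### Extension to graphs with internal vertices -/

open Classical in
/-- The extension of a function on chord diagrams to graphs with internal vertices by means of STU
relations, with an arbitrary choice of the leg to be resolved. -/
noncomputable def extend (ψ₀ : Net n m → M) (G : Net n m) : M :=
  if h : Nonempty (Leg G) then
    -((Classical.choice h).weight •
      (extend ψ₀ (Classical.choice h).fst + extend ψ₀ (Classical.choice h).snd))
  else ψ₀ G
termination_by G.internals
decreasing_by
  · have := (Classical.choice h).internals_fst
    omega
  · have := (Classical.choice h).internals_snd
    omega

variable {ψ₀ : Net n m → M}

lemma extend_eq_of_internals (h : G.internals = 0) : extend ψ₀ G = ψ₀ G := by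
  rw [extend, dif_neg]
  rintro ⟨L⟩
  exact internals_ne_zero L.internal h

lemma exists_extend_eq (h : Nonempty (Leg G)) :
    ∃ L : Leg G, extend ψ₀ G = -total (extend ψ₀) L := by
  refine ⟨Classical.choice h, ?_⟩
  rw [extend, dif_pos h]
  rfl

/-- If `ψ₀` respects the orientation relations of chord diagrams and, in the form of the second
hypothesis, the 4T relations, then its extension respects the orientation, STU and IHX
relations. -/
theorem extend_spec (h₀ : OrientAt p ψ₀ 0) (h₁ : ∀ G : Net n m, G.IsBCR → G.internals = 1 →
    ∀ L L' : Leg G, total ψ₀ L = total ψ₀ L') (c : ℕ) :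
    OrientAt p (extend ψ₀) c ∧ StuAt (extend ψ₀) c ∧ IhxAt (extend ψ₀) c := by
  induction c using Nat.strong_induction_on with
  | _ c ih =>
  rcases c with _ | c
  · refine ⟨fun G σ τ ε hG hH hc => ?_, fun G _ hc L => ?_, fun G _ hc E => ?_⟩
    · rw [extend_eq_of_internals hc, extend_eq_of_internals (relabel_internals.trans hc),
        h₀ G σ τ ε hG hH hc]
    · exact absurd hc (internals_ne_zero L.internal)
    · exact absurd hc (internals_ne_zero E.internal)
  obtain ⟨hO, hS, hI⟩ := ih c (by omega)
  have htotal : ∀ G : Net n m, G.IsBCR → G.internals = c + 1 → ∀ L L' : Leg G,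
      total (extend ψ₀) L = total (extend ψ₀) L' := by
    rcases c with _ | c
    · intro G hG hc L L'
      have e : ∀ L : Leg G, total (extend ψ₀) L = total ψ₀ L := fun L => by
        have h1 := L.internals_fst
        have h2 := L.internals_snd
        unfold total
        rw [extend_eq_of_internals (by omega), extend_eq_of_internals (by omega)]
      rw [e, e, h₁ G hG hc L L']
    · intro G hG hc L L'
      exact total_eq_total hO (ih c (by omega)).1 hS hI hG hc L L'
  have hS' : StuAt (extend ψ₀) (c + 1) := fun G hG hc L => by
    obtain ⟨L', e⟩ := exists_extend_eq (ψ₀ := ψ₀) ⟨L⟩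
    rw [e, htotal G hG hc L L']
  refine ⟨fun G σ τ ε hG hH hc => ?_, hS', fun G hG hc E => ?_⟩
  · -- Both graphs are resolved at corresponding legs.
    obtain ⟨L⟩ := nonempty_leg hG (by omega)
    rw [hS' G hG hc L, hS' _ hH (relabel_internals.trans hc) (L.relabel σ τ ε),
      total_relabel hO L hG hH hc, smul_neg]
  · obtain ⟨L⟩ := nonempty_leg hG (by omega)
    rcases c with _ | c
    · -- The edge of an IHX relation has two internal vertices.
      have h1 : 1 < G.internals := Finset.one_lt_card.2
        ⟨G.ends E.f, by simpa using E.internal, G.ends (opp E.f), by simpa using E.internal_opp,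
          E.ends_ne⟩
      omega
    -- The half-edge of `L` belongs to a leg in all three graphs, where they can be resolved.
    have key : ∀ E : InternalEdge G, extend ψ₀ (G.permute (Equiv.swap E.a E.b)) =
        -edgeTotal (extend ψ₀) L.k (G.permute (Equiv.swap E.a E.b)) := fun E => by
      have hB := E.isBCR_swap hG
      have hx : ∀ t, G.external (G.ends (Equiv.swap E.a E.b t)) = G.external (G.ends t) :=
        fun t => by
          rw [Equiv.swap_apply_def]
          split_ifs with h1 h2
          · rw [h1, E.ends_a, E.ends_b, E.internal, E.internal_opp]
          · rw [h2, E.ends_a, E.ends_b, E.internal, E.internal_opp]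
          · rfl
      obtain ⟨L', hL'⟩ := exists_leg hB (k := L.k) ((hx _).trans L.internal)
        ((hx _).trans L.external_opp)
      rw [hS' _ hB hc L', ← hL', edgeTotal_eq hO hB hc]
    have h1 := ihxSum_edgeTotal hO (ih c (by omega)).1 hS hI hG hc E L
    have h2 := key E.swapBC
    simp only [InternalEdge.swapBC_a, InternalEdge.swapBC_b] at h2
    rw [ihxSum, key E, h2, hS' _ hG hc L, ← edgeTotal_eq hO hG hc L, ← neg_add, ← neg_add]
    rw [ihxSum] at h1
    rw [h1, neg_zero]

/-! ### Linear maps on the spaces of graphs -/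

/-- The numbers of vertices and edges of a graph become parameters. -/
def ofGraph (G : ColoredGraph) : Net G.nV G.nE := ⟨G.ends, G.solid, G.external⟩

/-- The linear map on `D` with given values on the basis. -/
noncomputable def lift (ψ : ∀ n m, Net n m → M) : D →ₗ[ℚ] M :=
  Finsupp.linearCombination ℚ fun G : Graph => ψ G.1.nV G.1.nE (ofGraph G.1)

lemma lift_cls (ψ : ∀ n m, Net n m → M) (hG : G.IsBCR) :
    lift ψ (cls ⟨G.toGraph, hG⟩) = ψ n m G := by
  unfold lift cls
  rw [Finsupp.linearCombination_single, one_smul]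
  rfl

/-- Every BCR graph is given by a `Net`. -/
lemma exists_eq_toGraph (S : Graph) :
    ∃ (n m : ℕ) (G : Net n m) (hG : G.IsBCR), S = ⟨G.toGraph, hG⟩ :=
  ⟨_, _, ofGraph S.1, S.2, rfl⟩

/-- The three half-edges at an internal vertex are distinct. -/
lemma distinct_of_halfEdges (hG : G.IsBCR) {k a b : Fin m × Bool}
    (hk : G.external (G.ends k) = false) (h : G.toGraph.halfEdges (G.ends k) = {k, a, b}) :
    k ≠ a ∧ k ≠ b ∧ a ≠ b ∧ ∀ h, G.ends h = G.ends k ↔ h = k ∨ h = a ∨ h = b := by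
  have hiff : ∀ h, G.ends h = G.ends k ↔ h = k ∨ h = a ∨ h = b := fun x => by
    have : x ∈ G.toGraph.halfEdges (G.ends k) ↔ x ∈ ({k, a, b} : Finset (Fin m × Bool)) := by
      rw [h]
    simpa [ColoredGraph.halfEdges] using this
  have hcard : Finset.card {k, a, b} = 3 := by
    rw [← hG.internal_dashed _ hk, toGraph_dashedHalfEdges, ← h]
    congr 1
    ext x
    simp only [ColoredGraph.halfEdges, Finset.mem_filter, Finset.mem_univ, true_and, mem_dasheds]
    refine ⟨fun e => ⟨e, hG.solid_eq_false ?_⟩, fun e => e.1⟩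
    rw [show G.ends x = _ from e]
    exact hk
  refine ⟨?_, ?_, ?_, hiff⟩
  · rintro rfl
    rw [Finset.insert_eq_of_mem (by simp)] at hcard
    have := Finset.card_le_two (a := k) (b := b)
    omega
  · rintro rfl
    rw [Finset.insert_eq_of_mem (by simp)] at hcard
    have := Finset.card_le_two (a := a) (b := k)
    omega
  · rintro rfl
    rw [Finset.pair_eq_singleton] at hcard
    have := Finset.card_le_two (a := k) (b := a)
    omega

lemma iota_clsc (G : ChordDiagram) : iota (clsc G) = cls G.1 := by
  unfold iota clsc cls
  rw [Finsupp.lmapDomain_apply, Finsupp.mapDomain_single]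

lemma external_of_internals (h : G.internals = 0) (v : Fin n) : G.external v = true := by
  by_contra hv
  exact internals_ne_zero (by simpa using hv) h

lemma internals_eq_zero (h : ∀ v, G.external v = true) : G.internals = 0 := by
  by_contra h0
  obtain ⟨v, hv⟩ := exists_internal h0
  rw [h v] at hv
  cases hv

lemma cls_mem_range_iota (hG : G.IsBCR) (h : G.internals = 0) :
    cls ⟨G.toGraph, hG⟩ ∈ LinearMap.range iota :=
  ⟨clsc ⟨⟨G.toGraph, hG⟩, external_of_internals h⟩, iota_clsc _⟩

namespace Leg

open Classical in
/-- The element `y` of the STU relation `G + y = 0` at a leg. -/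
noncomputable def expression (L : Leg G) (hG : G.IsBCR) : D :=
  if G.solids L.v = ∅ then cls ⟨L.fst.toGraph, L.isBCR_fst hG⟩
  else cls ⟨L.fst.toGraph, L.isBCR_fst hG⟩ + cls ⟨L.snd.toGraph, L.isBCR_snd hG⟩

lemma exists_erase (L : Leg G) (h : G.solids L.v ≠ ∅) :
    ∃ l ∈ G.solids L.v, L.R = (G.solids L.v).erase l := by
  have h1 : 0 < (G.solids L.v).card := Finset.card_pos.2 (Finset.nonempty_iff_ne_empty.2 h)
  have h2 : L.R.card = (G.solids L.v).card - 1 := L.card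
  have h3 : L.R ⊆ G.solids L.v := L.subset
  obtain ⟨l, hl⟩ := Finset.card_eq_one.1 (show (G.solids L.v \ L.R).card = 1 by
    rw [Finset.card_sdiff_of_subset h3]
    omega)
  have h4 : l ∈ G.solids L.v \ L.R := by simp [hl]
  refine ⟨l, (Finset.mem_sdiff.1 h4).1, ?_⟩
  rw [Finset.erase_eq, ← hl, Finset.sdiff_sdiff_eq_self h3]

lemma R_eq_empty (L : Leg G) (h : G.solids L.v = ∅) : L.R = ∅ :=
  Finset.subset_empty.1 (h ▸ L.subset)

lemma isSTU_expression (L : Leg G) (hG : G.IsBCR) :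
    IsSTU ⟨G.toGraph, hG⟩ (L.expression hG) := by
  obtain ⟨⟨e, s⟩, hk⟩ : ∃ k, k = opp L.k := ⟨_, rfl⟩
  have hk' : L.k = (e, !s) := by
    rw [← opp_opp L.k, ← hk]
    rfl
  refine ⟨e, s, L.v, L.w, L.a, L.b, ?_, ?_, L.external_opp, ?_, L.internal, ?_, ?_⟩
  · have := L.solid_k hG
    rwa [hk'] at this
  · change G.ends (e, s) = _
    rw [hk]
  · change G.ends (e, !s) = _
    rw [← hk']
  · ext h
    have := L.ends_iff h
    rw [← hk']
    simpa [ColoredGraph.halfEdges] using this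
  · rw [toGraph_solidHalfEdges]
    unfold expression
    have he : e = L.k.1 := by rw [hk']
    split_ifs with h
    · refine Or.inr ⟨h, _, ?_, rfl⟩
      rw [he]
      change L.fst.toGraph = _
      unfold fst
      rw [L.R_eq_empty h]
      rfl
    · obtain ⟨l, hl, hR⟩ := L.exists_erase h
      refine Or.inl ⟨l, hl, _, _, ?_, ?_, rfl⟩
      · rw [he]
        change L.fst.toGraph = _
        unfold fst
        rw [hR]
        rfl
      · rw [he]
        change L.snd.toGraph = _
        unfold snd
        rw [hR]
        rfl

lemma lift_expression {ψ : ∀ n m, Net n m → M} (L : Leg G) (hG : G.IsBCR)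
    (hO : OrientAt p (ψ n m) c) (hc : G.internals = c + 1) :
    lift ψ (L.expression hG) = total (ψ n m) L := by
  unfold expression total weight
  split_ifs with h
  · have hR := L.R_eq_empty h
    have := L.apply_snd_eq hO hG hc (R' := ∅) (by simp) (by simp [h, hR])
      (by rw [← hR]; exact L.isBCR_snd hG)
    rw [lift_cls]
    unfold snd
    rw [hR, this, ← two_smul ℚ, smul_smul]
    norm_num
  · rw [map_add, lift_cls, lift_cls, one_smul]

lemma expression_mem {X : Submodule ℚ D} (L : Leg G) (hG : G.IsBCR)
    (h1 : cls ⟨L.fst.toGraph, L.isBCR_fst hG⟩ ∈ X)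
    (h2 : cls ⟨L.snd.toGraph, L.isBCR_snd hG⟩ ∈ X) : L.expression hG ∈ X := by
  unfold expression
  split_ifs
  · exact h1
  · exact X.add_mem h1 h2

end Leg

lemma exists_expression_eq_of_halfEdges (hG : G.IsBCR) {k a b : Fin m × Bool}
    (hv : G.external (G.ends (opp k)) = true) (hw : G.external (G.ends k) = false)
    (hab : G.toGraph.halfEdges (G.ends k) = {k, a, b}) {y : D}
    (h : (∃ l ∈ G.solids (G.ends (opp k)), ∃ T U : Graph,
        T.1 = (G.resolve k a ((G.solids (G.ends (opp k))).erase l)).toGraph ∧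
        U.1 = (G.resolve k b ((G.solids (G.ends (opp k))).erase l)).toGraph ∧
        y = cls T + cls U) ∨
      (G.solids (G.ends (opp k)) = ∅ ∧
        ∃ T : Graph, T.1 = (G.resolve k a ∅).toGraph ∧ y = cls T)) :
    ∃ L : Leg G, y = L.expression hG := by
  obtain ⟨h1, h2, h3, hiff⟩ := distinct_of_halfEdges hG hw hab
  rcases h with ⟨l, hl, T, U, hT, hU, rfl⟩ | ⟨h0, T, hT, rfl⟩
  · refine ⟨⟨k, a, b, _, hv, hw, h1, h2, h3, hiff, Finset.erase_subset l _,
      Finset.card_erase_of_mem hl⟩, ?_⟩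
    rw [Leg.expression, if_neg (Finset.ne_empty_of_mem hl)]
    congr 2
    · exact Subtype.ext hT
    · exact Subtype.ext hU
  · refine ⟨⟨k, a, b, ∅, hv, hw, h1, h2, h3, hiff, Finset.empty_subset _, by simp [h0]⟩, ?_⟩
    rw [Leg.expression, if_pos h0]
    congr 1
    exact Subtype.ext hT

/-- Every STU relation is the STU relation of a leg. -/
lemma exists_expression_eq {S : Graph} {y : D} (h : IsSTU S y) :
    ∃ L : Leg (ofGraph S.1), y = L.expression (G := ofGraph S.1) S.2 := by
  obtain ⟨n, m, G, hG, rfl⟩ := exists_eq_toGraph S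
  obtain ⟨e, i, v, w, a, b, he, rfl, hv, rfl, hw, hab, h⟩ := h
  rw [toGraph_solidHalfEdges G] at h
  cases i
  · exact exists_expression_eq_of_halfEdges hG (k := (e, true)) hv hw hab h
  · exact exists_expression_eq_of_halfEdges hG (k := (e, false)) hv hw hab h

lemma lift_orientationRel {ψ : ∀ n m, Net n m → M} (hO : ∀ n m c, OrientAt p (ψ n m) c) {x : D}
    (hx : x ∈ orientationRel p) : lift ψ x = 0 := by
  obtain ⟨S, ⟨H, hH⟩, σ, τ, ε, rfl, rfl⟩ := hx
  obtain ⟨n, m, G, hG, rfl⟩ := exists_eq_toGraph S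
  rw [map_sub, map_smul, lift_cls, sub_eq_zero]
  exact (lift_cls (G := G.relabel σ τ ε) ψ hH).trans (hO n m _ G σ τ ε hG hH rfl)

lemma lift_stuRel {ψ : ∀ n m, Net n m → M} (hO : ∀ n m c, OrientAt p (ψ n m) c)
    (hS : ∀ n m c, StuAt (ψ n m) c) {x : D} (hx : x ∈ stuRel) : lift ψ x = 0 := by
  obtain ⟨S, y, h, rfl⟩ := hx
  obtain ⟨L, rfl⟩ := exists_expression_eq h
  have h1 := L.internals_fst
  rw [map_add, L.lift_expression (G := ofGraph S.1) S.2 (hO _ _ _) h1.symm]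
  have h2 : lift ψ (cls S) = _ := lift_cls (G := ofGraph S.1) ψ S.2
  rw [h2, hS _ _ _ _ S.2 rfl L, neg_add_cancel]

lemma lift_ihxRel {ψ : ∀ n m, Net n m → M} (hI : ∀ n m c, IhxAt (ψ n m) c) {x : D}
    (hx : x ∈ ihxRel) : lift ψ x = 0 := by
  obtain ⟨S, ⟨D₂, h₂⟩, ⟨D₃, h₃⟩, e, a, b, c, d, he, hne, hx1, hx2, hab, hcd, rfl, rfl, rfl⟩ := hx
  obtain ⟨n, m, G, hG, rfl⟩ := exists_eq_toGraph S
  obtain ⟨h1, h2, h3, h4⟩ := distinct_of_halfEdges hG (k := (e, false)) hx1 hab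
  obtain ⟨h5, h6, h7, h8⟩ := distinct_of_halfEdges hG (k := (e, true)) hx2 hcd
  let E : InternalEdge G := ⟨(e, false), a, b, c, d, hx1, hx2, hne, h1, h2, h3, h5, h6, h7, h4, h8⟩
  rw [map_add, map_add, lift_cls]
  have e1 : lift ψ (cls ⟨_, h₂⟩) = _ := lift_cls (G := G.permute (Equiv.swap E.a E.b)) ψ h₂
  have e2 : lift ψ (cls ⟨_, h₃⟩) = _ := lift_cls (G := G.permute (Equiv.swap E.a E.c)) ψ h₃
  have e3 := hI n m _ G hG rfl E
  rw [ihxSum, ← e1, ← e2] at e3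
  exact e3

/-! ### Chord relations -/

/-- The edge `e` is a chord from `v` to `u`, and `H` consists of the solid half-edges at these two
vertices. -/
structure IsChord (G : Net n m) (e : Fin m) (v u : Fin n) (H : Finset (Fin m × Bool)) : Prop where
  solid : G.solid e = false
  ends_false : G.ends (e, false) = v
  external_v : G.external v = true
  ends_true : G.ends (e, true) = u
  external_u : G.external u = true
  eq_union : H = G.solids v ∪ G.solids u

/-- The half-edges in `A` are attached to `v` and the other ones in `H` to `u`. -/
def distribute (G : Net n m) (v u : Fin n) (H A : Finset (Fin m × Bool)) : Net n m where
  ends h := if h ∈ A then v else if h ∈ H then u else G.ends h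
  solid := G.solid
  external := G.external

section Chord

variable {e : Fin m} {v u : Fin n} {H A : Finset (Fin m × Bool)}

lemma distribute_ends (h : Fin m × Bool) : (G.distribute v u H A).ends h =
    if h ∈ A then v else if h ∈ H then u else G.ends h := rfl

lemma distribute_solid (e : Fin m) : (G.distribute v u H A).solid e = G.solid e := rfl

lemma distribute_external (x : Fin n) : (G.distribute v u H A).external x = G.external x := rfl

lemma IsChord.ends_of_mem (hC : G.IsChord e v u H) {h : Fin m × Bool} (hh : h ∈ H) :
    G.solid h.1 = true ∧ (G.ends h = v ∨ G.ends h = u) := by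
  rw [hC.eq_union, Finset.mem_union, mem_solids, mem_solids] at hh
  tauto

namespace IsChord

variable (hC : G.IsChord e v u H) (hG : G.IsBCR) (L : Leg G)
include hC hG

lemma v_ne : L.v ≠ v := fun h => by
  have h1 := hG.eq_of_dashed (h := (e, false)) (k := opp L.k) (hC.ends_false.trans h.symm)
    L.external_opp hC.solid (L.solid_k hG)
  have h2 : L.k = (e, true) := by
    rw [← opp_opp L.k, ← h1]
    rfl
  have h3 := L.internal
  rw [h2, hC.ends_true, hC.external_u] at h3
  cases h3

lemma v_ne' : L.v ≠ u := fun h => by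
  have h1 := hG.eq_of_dashed (h := (e, true)) (k := opp L.k) (hC.ends_true.trans h.symm)
    L.external_opp hC.solid (L.solid_k hG)
  have h2 : L.k = (e, false) := by
    rw [← opp_opp L.k, ← h1]
    rfl
  have h3 := L.internal
  rw [h2, hC.ends_false, hC.external_v] at h3
  cases h3

omit hG in
lemma w_ne : v ≠ L.w ∧ u ≠ L.w := by
  constructor <;> rintro rfl
  · have := hC.external_v
    rw [L.internal] at this
    cases this
  · have := hC.external_u
    rw [L.internal] at this
    cases this

/-- A chord remains a chord when a leg is resolved. -/
lemma resolve : L.fst.IsChord e v u H := by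
  have h1 := hC.v_ne hG L
  have h2 := hC.v_ne' hG L
  have ⟨h3, h4⟩ := hC.w_ne L
  have h5 : ∀ h, h.1 = e → L.fst.ends h = G.ends h := fun h he => by
    have h6 : h ∈ L.R → _ := Leg.of_mem_R
    have h7 : G.ends h = v ∨ G.ends h = u := by
      rcases h with ⟨h, _ | _⟩
      · obtain rfl : h = e := he
        exact Or.inl hC.ends_false
      · obtain rfl : h = e := he
        exact Or.inr hC.ends_true
    have h8 := L.ends_a
    rw [resolve_ends]
    grind
  refine ⟨?_, (h5 _ rfl).trans hC.ends_false, ?_, (h5 _ rfl).trans hC.ends_true, ?_, ?_⟩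
  · rw [resolve_solid, if_neg, hC.solid]
    intro h
    rcases eq_or_eq_opp (h := (e, false)) (k := L.k) h with h | h
    · exact h3 (by rw [← hC.ends_false, h])
    · exact h1 (by rw [← hC.ends_false, h])
  · rw [resolve_external, if_neg h3, hC.external_v]
  · rw [resolve_external, if_neg h4, hC.external_u]
  · rw [hC.eq_union, L.solids_fst_of_ne h1.symm h3, L.solids_fst_of_ne h2.symm h4]

lemma exists_leg_distribute (hA : A ⊆ H) : ∃ L' : Leg (G.distribute v u H A),
    L'.weight = L.weight ∧ L'.fst = L.fst.distribute v u H A ∧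
      L'.snd = L.snd.distribute v u H A := by
  have h1 := hC.v_ne hG L
  have h2 := hC.v_ne' hG L
  have ⟨h3, h4⟩ := hC.w_ne L
  have h5 : ∀ h, h ∈ H → _ := fun h => hC.ends_of_mem (h := h)
  have h6 : ∀ h, h ∈ A → h ∈ H := fun h hh => hA hh
  have h7 : ∀ x, x ≠ v → x ≠ u → ∀ h, (G.distribute v u H A).ends h = x ↔ G.ends h = x :=
    fun x hv hu h => by
      have := h5 h
      have := h6 h
      rw [distribute_ends]
      grind
  have h8 := (h7 L.w h3.symm h4.symm L.k).2 rfl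
  have h9 := (h7 L.v h1 h2 (opp L.k)).2 rfl
  have h10 : (G.distribute v u H A).solids L.v = G.solids L.v := by
    ext h
    rw [mem_solids, mem_solids, h7 L.v h1 h2, distribute_solid]
  have h11 : ∀ a, G.ends a = L.w → a ∉ H := fun a ha hh => by
    rcases (h5 a hh).2 with h | h
    · exact h3 (h.symm.trans ha)
    · exact h4 (h.symm.trans ha)
  have h12 : ∀ a, G.ends a = L.w → (G.distribute v u H A).resolve L.k a L.R =
      (G.resolve L.k a L.R).distribute v u H A := fun a ha => by
    ext h
    · have h13 : h ∈ L.R → _ := Leg.of_mem_R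
      have h14 := h5 h
      have h15 := h6 h
      have h16 := h11 a ha
      simp only [resolve_ends, h8, h9]
      simp only [distribute_ends, resolve_ends]
      grind
    · rw [resolve_solid, distribute_solid, distribute_solid, resolve_solid]
    · rw [resolve_external, distribute_external, distribute_external, resolve_external, h8]
  refine ⟨⟨L.k, L.a, L.b, L.R, ?_, ?_, L.ne_a, L.ne_b, L.a_ne_b, fun h => ?_, ?_, ?_⟩, ?_,
    h12 _ L.ends_a, h12 _ L.ends_b⟩
  · rw [h9]
    exact L.external_opp
  · rw [h8]
    exact L.internal
  · rw [h8, h7 L.w h3.symm h4.symm, L.ends_iff]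
  · rw [h9, h10]
    exact L.subset
  · rw [h9, h10]
    exact L.card
  · unfold Leg.weight Leg.v
    rw [h9, h10]

end IsChord

/-- A chord relation of graphs with internal vertices follows from chord relations of chord
diagrams, since resolving the internal vertices does not affect the chord. -/
lemma sum_distribute_eq_zero (hS : ∀ c, StuAt ψ c) {X : Finset (Finset (Fin m × Bool))}
    (hX : ∀ A ∈ X, A ⊆ H)
    (h₀ : ∀ G : Net n m, G.IsBCR → G.internals = 0 → G.IsChord e v u H →
      (∀ A ∈ X, (G.distribute v u H A).IsBCR) → ∑ A ∈ X, ψ (G.distribute v u H A) = 0)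
    (hG : G.IsBCR) (hC : G.IsChord e v u H) (hB : ∀ A ∈ X, (G.distribute v u H A).IsBCR) :
    ∑ A ∈ X, ψ (G.distribute v u H A) = 0 := by
  induction hc : G.internals generalizing G with
  | zero => exact h₀ G hG hc hC hB
  | succ c ih =>
    obtain ⟨L⟩ := nonempty_leg hG (by omega)
    have h1 := L.internals_fst
    have h2 := L.internals_snd
    choose K hw hf hs using fun A (hA : A ∈ X) => hC.exists_leg_distribute hG L (hX A hA)
    have h3 : ∀ A ∈ X, ψ (G.distribute v u H A) =
        -(L.weight • (ψ (L.fst.distribute v u H A) + ψ (L.snd.distribute v u H A))) :=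
      fun A hA => by
        rw [hS _ _ (hB A hA) rfl (K A hA), total, hw A hA, hf A hA, hs A hA]
    rw [Finset.sum_congr rfl h3, Finset.sum_neg_distrib, ← Finset.smul_sum,
      Finset.sum_add_distrib, ih (L.isBCR_fst hG) (hC.resolve hG L) _ (by omega),
      ih (L.isBCR_snd hG) (hC.resolve hG L.flip) _ (by omega)]
    · simp
    · intro A hA
      rw [← hs A hA]
      exact (K A hA).isBCR_snd (hB A hA)
    · intro A hA
      rw [← hf A hA]
      exact (K A hA).isBCR_fst (hB A hA)

end Chord

end Extension

section Retraction

variable {p : Parity} {c : ℕ} {G : Net n m}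

/-! ### The retraction onto chord diagrams -/

open Classical in
/-- The class of a chord diagram modulo orientation and 4T relations, and `0` for other
graphs. -/
noncomputable def diagramClass (p : Parity) (n m : ℕ) (G : Net n m) : Ac p :=
  if h : G.IsBCR ∧ ∀ v, G.external v = true then
    (relationsc p).mkQ (clsc ⟨⟨G.toGraph, h.1⟩, h.2⟩)
  else 0

lemma diagramClass_eq (hG : G.IsBCR) (h : ∀ v, G.external v = true) :
    diagramClass p n m G = (relationsc p).mkQ (clsc ⟨⟨G.toGraph, hG⟩, h⟩) :=
  dif_pos ⟨hG, h⟩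

lemma lift_iota {ψ : ∀ n m, Net n m → Ac p}
    (h : ∀ n m (G : Net n m), G.internals = 0 → ψ n m G = diagramClass p n m G) (y : Dc) :
    lift ψ (iota y) = (relationsc p).mkQ y := by
  suffices lift ψ ∘ₗ iota = (relationsc p).mkQ from LinearMap.congr_fun this y
  ext ⟨S, hS⟩ : 2
  obtain ⟨n, m, G, hG, rfl⟩ := exists_eq_toGraph S
  change lift ψ (iota (clsc _)) = (relationsc p).mkQ (clsc _)
  rw [iota_clsc, lift_cls, h n m G (internals_eq_zero hS), diagramClass_eq hG hS]

lemma orientAt_diagramClass : OrientAt p (diagramClass p n m) 0 := fun G σ τ ε hG hH hc => by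
  rw [diagramClass_eq hG (external_of_internals hc),
    diagramClass_eq hH (external_of_internals (relabel_internals.trans hc)), ← map_smul,
    ← sub_eq_zero, ← map_sub, Submodule.mkQ_apply, Submodule.Quotient.mk_eq_zero]
  exact Submodule.subset_span (Or.inl ⟨⟨⟨G.toGraph, hG⟩, external_of_internals hc⟩,
    ⟨⟨(G.relabel σ τ ε).toGraph, hH⟩, _⟩, σ, τ, ε, rfl, rfl⟩)

lemma total_diagramClass (hG : G.IsBCR) (hc : G.internals = 1) (L L' : Leg G) :
    total (diagramClass p n m) L = total (diagramClass p n m) L' := by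
  have key : ∀ L : Leg G, ∃ y, IsSTU ⟨G.toGraph, hG⟩ (iota y) ∧
      total (diagramClass p n m) L = (relationsc p).mkQ y := fun L => by
    have h1 := L.internals_fst
    have h2 := L.internals_snd
    obtain ⟨y, hy⟩ := L.expression_mem hG
      (cls_mem_range_iota (L.isBCR_fst hG) (by omega))
      (cls_mem_range_iota (L.isBCR_snd hG) (by omega))
    refine ⟨y, hy ▸ L.isSTU_expression hG, ?_⟩
    rw [← lift_iota (fun _ _ _ _ => rfl) y, hy, L.lift_expression hG orientAt_diagramClass hc]
  obtain ⟨y, h1, h2⟩ := key L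
  obtain ⟨z, h3, h4⟩ := key L'
  rw [h2, h4, ← sub_eq_zero, ← map_sub, Submodule.mkQ_apply, Submodule.Quotient.mk_eq_zero]
  exact Submodule.subset_span (Or.inr ⟨_, y, z, h1, h3, rfl⟩)

/-- The value of a graph in the space of chord diagrams, obtained by resolving all internal
vertices. -/
noncomputable def value (p : Parity) (n m : ℕ) (G : Net n m) : Ac p := extend (diagramClass p n m) G

lemma value_spec (p : Parity) (n m c : ℕ) :
    OrientAt p (value p n m) c ∧ StuAt (value p n m) c ∧ IhxAt (value p n m) c :=
  extend_spec orientAt_diagramClass (fun _ => total_diagramClass) c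

lemma lift_value_iota (y : Dc) : lift (value p) (iota y) = (relationsc p).mkQ y :=
  lift_iota (fun _ _ _ => extend_eq_of_internals) y

lemma lift_value_eq_zero {x : D} (hx : x ∈ relations p) : lift (value p) x = 0 := by
  suffices relations p ≤ LinearMap.ker (lift (value p)) from this hx
  refine Submodule.span_le.2 ?_
  rintro x ((h | h) | h)
  · exact lift_orientationRel (fun n m c => (value_spec p n m c).1) h
  · exact lift_ihxRel (fun n m c => (value_spec p n m c).2.2) h
  · exact lift_stuRel (fun n m c => (value_spec p n m c).1)
      (fun n m c => (value_spec p n m c).2.1) h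

lemma relationsc_le_relationscBar : relationsc p ≤ relationscBar p :=
  Submodule.span_mono Set.subset_union_left

lemma relations_le_relationsBar : relations p ≤ relationsBar p :=
  Submodule.span_mono Set.subset_union_left

/-- The image of `value` modulo the chord relations. -/
noncomputable def valueBar (p : Parity) (n m : ℕ) (G : Net n m) : AcBar p :=
  Submodule.factor relationsc_le_relationscBar (value p n m G)

lemma lift_valueBar (x : D) : lift (valueBar p) x =
    Submodule.factor relationsc_le_relationscBar (lift (value p) x) := by
  suffices lift (valueBar p) = Submodule.factor relationsc_le_relationscBar ∘ₗ lift (value p) from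
    LinearMap.congr_fun this x
  ext S : 2
  obtain ⟨n, m, G, hG, rfl⟩ := exists_eq_toGraph S
  change lift (valueBar p) (cls _) =
    Submodule.factor relationsc_le_relationscBar (lift (value p) (cls _))
  rw [lift_cls, lift_cls]
  rfl

lemma lift_valueBar_iota (y : Dc) : lift (valueBar p) (iota y) = (relationscBar p).mkQ y := by
  rw [lift_valueBar, lift_value_iota]
  rfl

lemma stuAt_valueBar : StuAt (valueBar p n m) c := fun G hG hc L => by
  unfold valueBar
  rw [(value_spec p n m c).2.1 G hG hc L]
  simp only [total, map_neg, map_smul, map_add]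

/-- For chord diagrams, the chord relations hold by definition. -/
lemma lift_valueBar_of_mem_range {x : D} (h : x ∈ chordRel) (hx : x ∈ LinearMap.range iota) :
    lift (valueBar p) x = 0 := by
  obtain ⟨y, rfl⟩ := hx
  rw [lift_valueBar_iota, Submodule.mkQ_apply, Submodule.Quotient.mk_eq_zero]
  exact Submodule.subset_span (Or.inr h)

lemma lift_chordRel {x : D} (hx : x ∈ chordRel) : lift (valueBar p) x = 0 := by
  obtain ⟨S, e, v, u, H, he, h1, h2, h3, h4, h5, h⟩ := hx
  obtain ⟨n, m, G, hG, rfl⟩ := exists_eq_toGraph S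
  rw [toGraph_solidHalfEdges G, toGraph_solidHalfEdges G] at h5
  have hC : G.IsChord e v u H := ⟨he, h1, h2, h3, h4, h5⟩
  rcases h with ⟨h0, rfl⟩ | ⟨h₀, hh, F, hF, rfl⟩
  · -- With no solid half-edges, the graph is the only distribution.
    have e1 : ∀ G : Net n m, G.distribute v u H ∅ = G := fun G => by
      ext <;> simp [distribute, h0]
    have key := sum_distribute_eq_zero (H := H) (X := {∅})
      (fun c => stuAt_valueBar (p := p) (c := c)) (by simp)
      (fun G hG h hC _ => ?_) hG hC (by simpa [e1] using hG)
    · rw [lift_cls]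
      simpa [e1] using key
    · rw [Finset.sum_singleton, e1, ← lift_cls (valueBar p) hG]
      refine lift_valueBar_of_mem_range ?_ (cls_mem_range_iota hG h)
      refine ⟨⟨G.toGraph, hG⟩, e, v, u, H, hC.1, hC.2, hC.3, hC.4, hC.5, ?_, Or.inl ⟨h0, rfl⟩⟩
      rw [toGraph_solidHalfEdges G, toGraph_solidHalfEdges G]
      exact hC.6
  · have hB : ∀ A ∈ distributions H h₀, (G.distribute v u H A).IsBCR := fun A hA => by
      have := (F A).2
      rw [hF A hA] at this
      exact this
    have key := sum_distribute_eq_zero (fun c => stuAt_valueBar (p := p) (c := c))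
      (X := distributions H h₀) (fun A hA => Finset.mem_powerset.1 (Finset.mem_filter.1 hA).1)
      (fun G hG h hC hB => ?_) hG hC hB
    · rw [map_sum, ← key]
      refine Finset.sum_congr rfl fun A hA => ?_
      rw [← lift_cls (valueBar p) (hB A hA)]
      congr 2
      exact Subtype.ext (hF A hA)
    · let F' : Finset (Fin m × Bool) → Graph := fun A =>
        if h : A ∈ distributions H h₀ then ⟨(G.distribute v u H A).toGraph, hB A h⟩
        else ⟨G.toGraph, hG⟩
      have e1 : ∀ A, ∀ hA : A ∈ distributions H h₀,
          F' A = ⟨(G.distribute v u H A).toGraph, hB A hA⟩ := fun A hA => dif_pos hA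
      have e2 : ∑ A ∈ distributions H h₀, valueBar p n m (G.distribute v u H A) =
          lift (valueBar p) (∑ A ∈ distributions H h₀, cls (F' A)) := by
        rw [map_sum]
        refine Finset.sum_congr rfl fun A hA => ?_
        rw [e1 A hA, lift_cls]
      rw [e2]
      refine lift_valueBar_of_mem_range ?_ (Submodule.sum_mem _ fun A hA => ?_)
      · refine ⟨⟨G.toGraph, hG⟩, e, v, u, H, hC.1, hC.2, hC.3, hC.4, hC.5, ?_,
          Or.inr ⟨h₀, hh, F', fun A hA => ?_, rfl⟩⟩
        · rw [toGraph_solidHalfEdges G, toGraph_solidHalfEdges G]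
          exact hC.6
        · rw [e1 A hA]
          rfl
      · rw [e1 A hA]
        exact cls_mem_range_iota (hB A hA) h

lemma lift_valueBar_eq_zero {x : D} (hx : x ∈ relationsBar p) : lift (valueBar p) x = 0 := by
  suffices relationsBar p ≤ LinearMap.ker (lift (valueBar p)) from this hx
  refine Submodule.span_le.2 ?_
  rintro x (h | h)
  · rw [SetLike.mem_coe, LinearMap.mem_ker, lift_valueBar,
      lift_value_eq_zero (Submodule.subset_span h), map_zero]
  · exact lift_chordRel h

/-! ### The inclusion of chord diagrams -/

lemma iota_orientationRelc {y : Dc} (hy : y ∈ orientationRelc p) : iota y ∈ orientationRel p := by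
  obtain ⟨G, H, σ, τ, ε, h, rfl⟩ := hy
  refine ⟨G.1, H.1, σ, τ, ε, h, ?_⟩
  rw [map_sub, map_smul, iota_clsc, iota_clsc]

lemma iota_fourTRel {y : Dc} (hy : y ∈ fourTRel) : iota y ∈ relations p := by
  obtain ⟨S, y, z, h1, h2, rfl⟩ := hy
  have h : ∀ y, IsSTU S y → cls S + y ∈ relations p := fun y hy =>
    Submodule.subset_span (Or.inr ⟨S, y, hy, rfl⟩)
  have := Submodule.sub_mem _ (h _ h1) (h _ h2)
  rwa [add_sub_add_left_eq_sub, ← map_sub] at this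

lemma relationsc_le_comap : relationsc p ≤ (relations p).comap iota := by
  refine Submodule.span_le.2 ?_
  rintro y (h | h)
  · exact Submodule.subset_span (Or.inl (Or.inl (iota_orientationRelc h)))
  · exact iota_fourTRel h

lemma relationscBar_le_comap : relationscBar p ≤ (relationsBar p).comap iota := by
  refine Submodule.span_le.2 ?_
  rintro y (h | h)
  · exact relations_le_relationsBar (relationsc_le_comap (Submodule.subset_span h))
  · exact Submodule.subset_span (Or.inr h)

/-- Modulo STU relations, every graph is a combination of chord diagrams. -/
lemma cls_mem_sup (hG : G.IsBCR) :
    cls ⟨G.toGraph, hG⟩ ∈ LinearMap.range iota ⊔ relations p := by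
  induction hc : G.internals generalizing G with
  | zero => exact Submodule.mem_sup_left (cls_mem_range_iota hG hc)
  | succ c ih =>
    obtain ⟨L⟩ := nonempty_leg hG (by omega)
    have h1 := L.internals_fst
    have h2 := L.internals_snd
    have h3 := L.expression_mem hG (ih (L.isBCR_fst hG) (by omega))
      (ih (L.isBCR_snd hG) (by omega))
    have h4 : cls ⟨G.toGraph, hG⟩ + L.expression hG ∈ relations p :=
      Submodule.subset_span (Or.inr ⟨_, _, L.isSTU_expression hG, rfl⟩)
    have h5 := Submodule.sub_mem _ (Submodule.mem_sup_right (S := LinearMap.range iota) h4) h3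
    rwa [add_sub_cancel_right] at h5

lemma range_iota_sup (p : Parity) : LinearMap.range iota ⊔ relations p = ⊤ := by
  refine eq_top_iff.2 fun x _ => ?_
  induction x using Finsupp.induction_linear with
  | zero => exact Submodule.zero_mem _
  | add x y hx hy => exact Submodule.add_mem _ (hx trivial) (hy trivial)
  | single S q =>
    obtain ⟨n, m, G, hG, rfl⟩ := exists_eq_toGraph S
    have := Submodule.smul_mem _ q (cls_mem_sup (p := p) hG)
    rwa [cls, Finsupp.smul_single, smul_eq_mul, mul_one] at this

/-- A linear map `f` induces a bijection of quotients if it has a left inverse modulo the relations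
of the source that respects the relations of the target, and its range generates the target. -/
lemma _root_.Submodule.mapQ_bijective {R V W : Type*} [Ring R] [AddCommGroup V] [AddCommGroup W]
    [Module R V] [Module R W] {X : Submodule R V} {Y : Submodule R W} {f : V →ₗ[R] W}
    (h : X ≤ Y.comap f) (g : W →ₗ[R] V ⧸ X) (hg : ∀ x, g (f x) = X.mkQ x)
    (hY : ∀ y ∈ Y, g y = 0) (hf : LinearMap.range f ⊔ Y = ⊤) :
    Function.Bijective (Submodule.mapQ X Y f h) := by
  constructor
  · refine (injective_iff_map_eq_zero _).2 fun x hx => ?_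
    obtain ⟨x, rfl⟩ := Submodule.Quotient.mk_surjective X x
    rw [Submodule.mapQ_apply, Submodule.Quotient.mk_eq_zero] at hx
    exact (hg x).symm.trans (hY _ hx)
  · intro y
    obtain ⟨y, rfl⟩ := Submodule.Quotient.mk_surjective Y y
    obtain ⟨_, ⟨x, rfl⟩, z, hz, rfl⟩ := Submodule.mem_sup.1 (hf ▸ Submodule.mem_top (x := y))
    refine ⟨Submodule.Quotient.mk x, ?_⟩
    rw [Submodule.mapQ_apply, Submodule.Quotient.eq, sub_add_cancel_left]
    exact Y.neg_mem hz

end Retraction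

end Net

end BCR

theorem mainTheorem2 (p : BCR.Parity) :
    (∃ h : BCR.relationsc p ≤ (BCR.relations p).comap BCR.iota,
      Function.Bijective
        (Submodule.mapQ (BCR.relationsc p) (BCR.relations p) BCR.iota h : BCR.Ac p →ₗ[ℚ] BCR.A p)) ∧
    (∃ h : BCR.relationscBar p ≤ (BCR.relationsBar p).comap BCR.iota,
      Function.Bijective
        (Submodule.mapQ (BCR.relationscBar p) (BCR.relationsBar p) BCR.iota h :
          BCR.AcBar p →ₗ[ℚ] BCR.ABar p)) := by
  refine ⟨⟨BCR.Net.relationsc_le_comap, ?_⟩, ⟨BCR.Net.relationscBar_le_comap, ?_⟩⟩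
  · exact Submodule.mapQ_bijective _ (BCR.Net.lift (BCR.Net.value p)) BCR.Net.lift_value_iota
      (fun _ => BCR.Net.lift_value_eq_zero) (BCR.Net.range_iota_sup p)
  · refine Submodule.mapQ_bijective _ (BCR.Net.lift (BCR.Net.valueBar p))
      BCR.Net.lift_valueBar_iota (fun _ => BCR.Net.lift_valueBar_eq_zero) (eq_top_iff.2 ?_)
    rw [← BCR.Net.range_iota_sup p]
    exact sup_le_sup_left BCR.Net.relations_le_relationsBar _
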